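/- Let $A$ and $H$ be Hopf $*$-algebras over $\mathbb C$, where $H$ is a compact quantum group algebra (i.e. $H$ is spanned by the matrix coefficients of its finite-dimensional unitary corepresentations), and let $\pi:A\to H$ be a surjective homomorphism of Hopf $*$-algebras such that $B=A^{\mathrm{co}(H)}=\{a\in A:(\mathrm{id}\otimes\pi)\Delta(a)=a\otimes 1\}$ is a quantum homogeneous space, i.e. $A$ is faithfully flat as a right $B$-module. Let ${}^A_B\mathcal M_B$ be the category of relative Hopf modules: $B$-bimodules $M$ with a left $A$-coaction $m\mapsto m_{(-1)}\otimes m_{(0)}$ satisfying $\delta(bmc)=b_{(1)}m_{(-1)}c_{(1)}\otimes b_{(2)}m_{(0)}c_{(2)}$; its morphisms are the $A$-covariant $B$-bimodule maps. Put $B^+=B\cap\ker\epsilon$ and $\Phi(M)=M/B^+M$, with the left $H$-coaction $[m]\mapsto\pi(m_{(-1)})\otimes[m_{(0)}]$; identify $\Phi(B)$ with $\mathbb C$ by $[b]\mapsto\epsilon(b)$ and, if $MB^+=B^+M$, identify $\Phi(M)\otimes\Phi(N)$ with $\Phi(M\otimes_BN)$ by $[m]\otimes[n]\mapsto[m\otimes_Bn]$.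 Let $(\Omega^{(\bullet,\bullet)},\wedge,\partial,\overline\partial)$ be a left $A$-covariant complex structure on a left $A$-covariant $*$-differential calculus $(\Omega^\bullet,\wedge,d)$ on $B$, such that $\Omega^1$ is finitely generated as a left $B$-module and $\Omega^1B^+=B^+\Omega^1$. Write $V^{(1,0)}=\Phi(\Omega^{(1,0)})$, $V^{(0,1)}=\Phi(\Omega^{(0,1)})$, and fix inner products $\langle\,,\rangle$ on $V^{(1,0)}$ and on $V^{(0,1)}$ (conjugate-linear on the right) which are $H$-invariant: $v_{(-1)}w_{(-1)}^*\langle v_{(0)},w_{(0)}\rangle=\langle v,w\rangle 1_H$. Then for $(p,q)=(1,0)$ and for $(p,q)=(0,1)$ there are unique morphisms of ${}^A_B\mathcal M_B$ $$(\,,)^{p,q}:\Omega^{(p,q)}\otimes_B\Omega^{(q,p)}\to B,\qquad \mathrm{coev}^{p,q}:B\to\Omega^{(q,p)}\otimes_B\Omega^{(p,q)}$$ such that $\Phi((\,,)^{p,q})$ is the map $[\omega]\otimes[\eta]\mapsto\langle[\omega],[\eta^*]\rangle_{V^{(p,q)}}$ and $\Phi(\mathrm{coev}^{p,q})$ is the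 map $1\mapsto\sum_i v_i^*\otimes v_i$, where $(v_i)$ is an orthonormal basis of $V^{(p,q)}$ and $[\omega]^*:=[\omega^*]\in V^{(q,p)}$. Moreover, for every $\lambda\in\mathbb R\setminus\{0\}$, define, with respect to the decomposition $$\Omega^1\otimes_B\Omega^1\cong(\Omega^{(1,0)}\otimes_B\Omega^{(0,1)})\oplus(\Omega^{(0,1)}\otimes_B\Omega^{(1,0)})\oplus(\Omega^{(1,0)}\otimes_B\Omega^{(1,0)})\oplus(\Omega^{(0,1)}\otimes_B\Omega^{(0,1)}),$$ the pairing $(\,,)=(\,,)^{1,0}\oplus(-\lambda^{-1})(\,,)^{0,1}\oplus0\oplus0:\Omega^1\otimes_B\Omega^1\to B$, and let $g\in\Omega^1\otimes_B\Omega^1$ be the element $\mathrm{coev}^{1,0}(1)-\lambda\,\mathrm{coev}^{0,1}(1)$. Then $(g,(\,,))$ is an $A$-covariant real metric on $\Omega^1$: $(\,,)$ is $B$-bilinear, $((\omega,\cdot)\otimes_B\mathrm{id})g=\omega=(\mathrm{id}\otimes_B(\cdot,\omega))g$ for all $\omega\in\Omega^1$, the maps $(\,,)$ and $b\mapsto bg$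 are $A$-covariant, and $g^\dagger=g$, where $(\omega\otimes_B\eta)^\dagger=\eta^*\otimes_B\omega^*$. Finally, $(\omega,\eta)=0$ if $\omega,\eta\in\Omega^{(1,0)}$ or $\omega,\eta\in\Omega^{(0,1)}$. -/

import Mathlib

universe u

noncomputable section

open TensorProduct MulOpposite

set_option linter.unusedSectionVars false

namespace QuantumHomogeneous

/-! ### Hopf star-algebras, comodules, comodule algebras -/

/-- A Hopf algebra over `ℂ` whose underlying algebra is a star-algebra is a Hopf star-algebra
if the coproduct is a star-homomorphism. -/
class HopfStarAlgebra (A : Type u) [Ring A] [HopfAlgebra ℂ A] [StarRing A] [StarModule ℂ A] :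
    Prop where
  comul_star : ∀ a : A, Coalgebra.comul (R := ℂ) (star a) = star (Coalgebra.comul (R := ℂ) a)

/-- Left comodules `(M, coact : M → A ⊗ M)` over a Hopf algebra `A`. -/
class LeftComodule (A : Type u) (M : Type u) [Ring A] [HopfAlgebra ℂ A]
    [AddCommGroup M] [Module ℂ M] where
  coact : M →ₗ[ℂ] A ⊗[ℂ] M
  coassoc : ∀ m, TensorProduct.assoc ℂ A A M
      ((Coalgebra.comul (R := ℂ) (A := A)).rTensor M (coact m)) = coact.lTensor A (coact m)
  counit : ∀ m, TensorProduct.lid ℂ M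
      ((Coalgebra.counit (R := ℂ) (A := A)).rTensor M (coact m)) = m

/-- The coaction of a left `A`-comodule. -/
def coact (A : Type u) {M : Type u} [Ring A] [HopfAlgebra ℂ A]
    [AddCommGroup M] [Module ℂ M] [LeftComodule A M] : M →ₗ[ℂ] A ⊗[ℂ] M :=
  LeftComodule.coact

/-- A linear map is `A`-covariant if it intertwines the coactions. -/
def IsCovariant (A : Type u) {M N : Type u} [Ring A] [HopfAlgebra ℂ A]
    [AddCommGroup M] [Module ℂ M] [LeftComodule A M]
    [AddCommGroup N] [Module ℂ N] [LeftComodule A N] (f : M →ₗ[ℂ] N) : Prop :=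
  ∀ m, coact A (f m) = f.lTensor A (coact A m)

/-- Left `A`-comodule star-algebras. -/
class ComoduleStarAlgebra (A : Type u) (B : Type u) [Ring A] [HopfAlgebra ℂ A] [StarRing A]
    [StarModule ℂ A] [Ring B] [Algebra ℂ B] [StarRing B] [StarModule ℂ B]
    extends LeftComodule A B where
  coact_one : coact 1 = 1
  coact_mul : ∀ b c : B, coact (b * c) = coact b * coact c
  coact_star : ∀ b : B, coact (star b) = star (coact b)

section Restrict

variable {A M : Type u} [Ring A] [HopfAlgebra ℂ A] [AddCommGroup M] [Module ℂ M]

theorem lTensor_subtype_injective (S : Submodule ℂ M) :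
    Function.Injective (S.subtype.lTensor A) :=
  Module.Flat.lTensor_preserves_injective_linearMap S.subtype S.injective_subtype

/-- The restriction of a coaction `δ : M → A ⊗ M` to a subspace `S` with `δ(S) ⊆ A ⊗ S`. -/
def restrictCoact (δ : M →ₗ[ℂ] A ⊗[ℂ] M) (S : Submodule ℂ M)
    (h : ∀ x ∈ S, δ x ∈ LinearMap.range (S.subtype.lTensor A)) : S →ₗ[ℂ] A ⊗[ℂ] S :=
  (LinearEquiv.ofInjective (S.subtype.lTensor A) (lTensor_subtype_injective S)).symm.toLinearMap
    ∘ₗ LinearMap.codRestrict _ (δ ∘ₗ S.subtype) (fun x => h x x.2)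

theorem lTensor_restrictCoact (δ : M →ₗ[ℂ] A ⊗[ℂ] M) (S : Submodule ℂ M)
    (h : ∀ x ∈ S, δ x ∈ LinearMap.range (S.subtype.lTensor A)) (x : S) :
    S.subtype.lTensor A (restrictCoact δ S h x) = δ x := by
  have := LinearEquiv.apply_symm_apply
    (LinearEquiv.ofInjective (S.subtype.lTensor A) (lTensor_subtype_injective S))
    (LinearMap.codRestrict _ (δ ∘ₗ S.subtype) (fun x => h x x.2) x)
  exact congrArg Subtype.val this

theorem restrict_coassoc [LeftComodule A M] (S : Submodule ℂ M)
    (h : ∀ x ∈ S, coact A x ∈ LinearMap.range (S.subtype.lTensor A)) (x : S) :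
    TensorProduct.assoc ℂ A A S ((Coalgebra.comul (R := ℂ) (A := A)).rTensor S
      (restrictCoact (coact A) S h x)) =
    (restrictCoact (coact A) S h).lTensor A (restrictCoact (coact A) S h x) := by
  apply Module.Flat.lTensor_preserves_injective_linearMap (M := A) _
    (lTensor_subtype_injective (A := A) S)
  have e1 : ∀ z : A ⊗[ℂ] S, (S.subtype.lTensor A).lTensor A
      (TensorProduct.assoc ℂ A A S ((Coalgebra.comul (R := ℂ) (A := A)).rTensor S z)) =
      TensorProduct.assoc ℂ A A M ((Coalgebra.comul (R := ℂ) (A := A)).rTensor M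
        (S.subtype.lTensor A z)) := by
    intro z
    induction z with
    | zero => simp
    | add x y hx hy => simp only [map_add, hx, hy]
    | tmul a s =>
      simp only [LinearMap.rTensor_tmul, LinearMap.lTensor_tmul]
      generalize Coalgebra.comul (R := ℂ) a = w
      induction w with
      | zero => simp
      | add x y hx hy => simp only [add_tmul, map_add, hx, hy]
      | tmul a b => simp
  have e2 : ∀ z : A ⊗[ℂ] S, (S.subtype.lTensor A).lTensor A
      ((restrictCoact (coact A) S h).lTensor A z) =
      (coact A).lTensor A (S.subtype.lTensor A z) := by
    intro z
    induction z with
    | zero => simp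
    | add x y hx hy => simp only [map_add, hx, hy]
    | tmul a s => simp only [LinearMap.lTensor_tmul, lTensor_restrictCoact, Submodule.subtype_apply]
  rw [e1, e2, lTensor_restrictCoact]
  exact LeftComodule.coassoc _

theorem restrict_counit [LeftComodule A M] (S : Submodule ℂ M)
    (h : ∀ x ∈ S, coact A x ∈ LinearMap.range (S.subtype.lTensor A)) (x : S) :
    TensorProduct.lid ℂ S ((Coalgebra.counit (R := ℂ) (A := A)).rTensor S
      (restrictCoact (coact A) S h x)) = x := by
  apply S.injective_subtype
  have e1 : ∀ z : A ⊗[ℂ] S, S.subtype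
      (TensorProduct.lid ℂ S ((Coalgebra.counit (R := ℂ) (A := A)).rTensor S z)) =
      TensorProduct.lid ℂ M ((Coalgebra.counit (R := ℂ) (A := A)).rTensor M
        (S.subtype.lTensor A z)) := by
    intro z
    induction z with
    | zero => simp
    | add x y hx hy => simp only [map_add, hx, hy]
    | tmul a s => simp
  rw [e1, lTensor_restrictCoact]
  exact LeftComodule.counit _

/-- A subcomodule is a comodule. -/
abbrev restrictComodule [LeftComodule A M] (S : Submodule ℂ M)
    (h : ∀ x ∈ S, coact A x ∈ LinearMap.range (S.subtype.lTensor A)) : LeftComodule A S where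
  coact := restrictCoact (coact A) S h
  coassoc := restrict_coassoc S h
  counit := restrict_counit S h

end Restrict

/-! ### Balanced tensor products over a noncommutative algebra -/

section Balanced

variable (B : Type u) [Ring B] [Algebra ℂ B] (M N : Type u)
  [AddCommGroup M] [Module ℂ M] [AddCommGroup N] [Module ℂ N]

/-- The relations `m b ⊗ n = m ⊗ b n`. -/
def balancedRel [Module Bᵐᵒᵖ M] [Module B N] : Submodule ℂ (M ⊗[ℂ] N) :=
  Submodule.span ℂ {x | ∃ (m : M) (b : B) (n : N), x = (op b • m) ⊗ₜ[ℂ] n - m ⊗ₜ[ℂ] (b • n)}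

/-- The tensor product `M ⊗_B N` of a right `B`-module `M` and a left `B`-module `N`. -/
def BalTensor [Module Bᵐᵒᵖ M] [Module B N] : Type u := (M ⊗[ℂ] N) ⧸ balancedRel B M N

instance [Module Bᵐᵒᵖ M] [Module B N] : AddCommGroup (BalTensor B M N) :=
  inferInstanceAs (AddCommGroup ((M ⊗[ℂ] N) ⧸ balancedRel B M N))

instance [Module Bᵐᵒᵖ M] [Module B N] : Module ℂ (BalTensor B M N) :=
  inferInstanceAs (Module ℂ ((M ⊗[ℂ] N) ⧸ balancedRel B M N))

variable {M N}

/-- The quotient map `M ⊗ N → M ⊗_B N`. -/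
def balMk [Module Bᵐᵒᵖ M] [Module B N] : M ⊗[ℂ] N →ₗ[ℂ] BalTensor B M N :=
  (balancedRel B M N).mkQ

theorem balMk_surjective [Module Bᵐᵒᵖ M] [Module B N] :
    Function.Surjective (balMk B (M := M) (N := N)) :=
  (balancedRel B M N).mkQ_surjective

theorem balMk_balanced [Module Bᵐᵒᵖ M] [Module B N] (m : M) (b : B) (n : N) :
    balMk B ((op b • m) ⊗ₜ[ℂ] n) = balMk B (m ⊗ₜ[ℂ] (b • n)) := by
  rw [← sub_eq_zero, ← map_sub]
  exact (Submodule.Quotient.mk_eq_zero _).2 (Submodule.subset_span ⟨m, b, n, rfl⟩)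

/-- The linear map on `M ⊗_B N` induced by a balanced (semi)linear map on `M ⊗ N`. -/
def balLift {σ : ℂ →+* ℂ} [Module Bᵐᵒᵖ M] [Module B N] {P : Type u} [AddCommGroup P] [Module ℂ P]
    (f : M ⊗[ℂ] N →ₛₗ[σ] P)
    (h : ∀ (m : M) (b : B) (n : N), f ((op b • m) ⊗ₜ n) = f (m ⊗ₜ (b • n))) :
    BalTensor B M N →ₛₗ[σ] P :=
  (balancedRel B M N).liftQ f (by
    rw [balancedRel, Submodule.span_le]
    rintro _ ⟨m, b, n, rfl⟩
    simp [h])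

@[simp] theorem balLift_mk {σ : ℂ →+* ℂ} [Module Bᵐᵒᵖ M] [Module B N] {P : Type u}
    [AddCommGroup P] [Module ℂ P] (f : M ⊗[ℂ] N →ₛₗ[σ] P)
    (h : ∀ (m : M) (b : B) (n : N), f ((op b • m) ⊗ₜ n) = f (m ⊗ₜ (b • n))) (x : M ⊗[ℂ] N) :
    balLift B f h (balMk B x) = f x := rfl

theorem balTensor_ext {σ : ℂ →+* ℂ} [Module Bᵐᵒᵖ M] [Module B N] {P : Type u}
    [AddCommGroup P] [Module ℂ P] {f g : BalTensor B M N →ₛₗ[σ] P}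
    (h : ∀ m n, f (balMk B (m ⊗ₜ n)) = g (balMk B (m ⊗ₜ n))) : f = g := by
  ext x
  obtain ⟨x, rfl⟩ := balMk_surjective B x
  induction x with
  | zero => simp
  | add x y hx hy => simp only [map_add, hx, hy]
  | tmul m n => exact h m n

end Balanced

/-- `M` is faithfully flat as a right `B`-module: a sequence `N₁ → N₂ → N₃` of left `B`-modules is
exact if and only if `M ⊗_B N₁ → M ⊗_B N₂ → M ⊗_B N₃` is exact. -/
def FaithfullyFlatRight (B : Type u) [Ring B] [Algebra ℂ B] (M : Type u) [AddCommGroup M]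
    [Module ℂ M] [Module Bᵐᵒᵖ M] : Prop :=
  ∀ (N₁ N₂ N₃ : Type u) [AddCommGroup N₁] [AddCommGroup N₂] [AddCommGroup N₃]
    [Module ℂ N₁] [Module ℂ N₂] [Module ℂ N₃] [Module B N₁] [Module B N₂] [Module B N₃]
    [IsScalarTower ℂ B N₁] [IsScalarTower ℂ B N₂] [IsScalarTower ℂ B N₃]
    (f : N₁ →ₗ[B] N₂) (g : N₂ →ₗ[B] N₃),
    Function.Exact f g ↔
      Function.Exact
        (balLift B (balMk B ∘ₗ (f.restrictScalars ℂ).lTensor M)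
          (fun m b n => by simp [balMk_balanced]) : BalTensor B M N₁ →ₗ[ℂ] BalTensor B M N₂)
        (balLift B (balMk B ∘ₗ (g.restrictScalars ℂ).lTensor M)
          (fun m b n => by simp [balMk_balanced]) : BalTensor B M N₂ →ₗ[ℂ] BalTensor B M N₃)

/-! ### Relative Hopf modules -/

section RelativeHopfModules

variable (A : Type u) [Ring A] [HopfAlgebra ℂ A] [StarRing A] [StarModule ℂ A]
  (B : Type u) [Ring B] [Algebra ℂ B] [StarRing B] [StarModule ℂ B]

section Actions

variable {A B} {M : Type u} [AddCommGroup M] [Module ℂ M]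

/-- `(a ⊗ b, x ⊗ m) ↦ a x ⊗ b m`. -/
def diagL [Module B M] [IsScalarTower ℂ B M] :
    A ⊗[ℂ] B →ₗ[ℂ] A ⊗[ℂ] M →ₗ[ℂ] A ⊗[ℂ] M :=
  TensorProduct.map₂ (LinearMap.mul ℂ A) (Algebra.lsmul ℂ ℂ M : B →ₐ[ℂ] Module.End ℂ M).toLinearMap

/-- `(a ⊗ b, x ⊗ m) ↦ x a ⊗ m b`. -/
def diagR [Module Bᵐᵒᵖ M] [IsScalarTower ℂ Bᵐᵒᵖ M] :
    A ⊗[ℂ] B →ₗ[ℂ] A ⊗[ℂ] M →ₗ[ℂ] A ⊗[ℂ] M :=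
  TensorProduct.map₂ (LinearMap.mul ℂ A).flip
    ((Algebra.lsmul ℂ ℂ M : Bᵐᵒᵖ →ₐ[ℂ] Module.End ℂ M).toLinearMap ∘ₗ
      (opLinearEquiv ℂ : B ≃ₗ[ℂ] Bᵐᵒᵖ).toLinearMap)

@[simp] theorem diagL_tmul [Module B M] [IsScalarTower ℂ B M] (a x : A) (b : B) (m : M) :
    diagL (a ⊗ₜ[ℂ] b) (x ⊗ₜ[ℂ] m) = (a * x) ⊗ₜ[ℂ] (b • m) := rfl

@[simp] theorem diagR_tmul [Module Bᵐᵒᵖ M] [IsScalarTower ℂ Bᵐᵒᵖ M] (a x : A) (b : B) (m : M) :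
    diagR (a ⊗ₜ[ℂ] b) (x ⊗ₜ[ℂ] m) = (x * a) ⊗ₜ[ℂ] (op b • m) := rfl

end Actions

/-- Objects of the category of relative Hopf modules: `B`-bimodules `M` with a left `A`-coaction
such that `δ(b m) = b₍₁₎ m₍₋₁₎ ⊗ b₍₂₎ m₍₀₎` and `δ(m b) = m₍₋₁₎ b₍₁₎ ⊗ m₍₀₎ b₍₂₎`. -/
structure RelHopfModule [ComoduleStarAlgebra A B] where
  carrier : Type u
  [addCommGroup : AddCommGroup carrier]
  [module : Module ℂ carrier]
  [leftModule : Module B carrier]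
  [rightModule : Module Bᵐᵒᵖ carrier]
  [leftTower : IsScalarTower ℂ B carrier]
  [rightTower : IsScalarTower ℂ Bᵐᵒᵖ carrier]
  [bimodule : SMulCommClass B Bᵐᵒᵖ carrier]
  [comodule : LeftComodule A carrier]
  coact_smul : ∀ (b : B) (m : carrier), coact A (b • m) = diagL (coact A b) (coact A m)
  coact_op_smul : ∀ (b : B) (m : carrier), coact A (op b • m) = diagR (coact A b) (coact A m)

attribute [instance] RelHopfModule.addCommGroup RelHopfModule.module RelHopfModule.leftModule
  RelHopfModule.rightModule RelHopfModule.leftTower RelHopfModule.rightTower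
  RelHopfModule.bimodule RelHopfModule.comodule

variable {A B} [ComoduleStarAlgebra A B]

instance : CoeSort (RelHopfModule A B) (Type u) := ⟨RelHopfModule.carrier⟩

/-- The `B`-bimodule maps `M → N`, as a subspace of the linear maps. Morphisms of relative Hopf
modules are the covariant bimodule maps. -/
def BimodHom (M N : RelHopfModule A B) : Submodule ℂ (M →ₗ[ℂ] N) where
  carrier := {f | (∀ (b : B) m, f (b • m) = b • f m) ∧ ∀ (b : B) m, f (op b • m) = op b • f m}
  add_mem' := by
    rintro f g ⟨hf, hf'⟩ ⟨hg, hg'⟩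
    exact ⟨fun b m => by simp [hf, hg], fun b m => by simp [hf', hg']⟩
  zero_mem' := by constructor <;> simp
  smul_mem' := by
    rintro c f ⟨hf, hf'⟩
    refine ⟨fun b m => ?_, fun b m => ?_⟩
    · rw [LinearMap.smul_apply, LinearMap.smul_apply, hf, smul_comm c b (f m)]
    · rw [LinearMap.smul_apply, LinearMap.smul_apply, hf', smul_comm c (op b) (f m)]

/-- Composition of bimodule maps. -/
def BimodHom.comp {M N P : RelHopfModule A B} (g : BimodHom N P) (f : BimodHom M N) :
    BimodHom M P :=
  ⟨g.1 ∘ₗ f.1,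
    fun b m => (congrArg g.1 (f.2.1 b m)).trans (g.2.1 b (f.1 m)),
    fun b m => (congrArg g.1 (f.2.2 b m)).trans (g.2.2 b (f.1 m))⟩

/-- The monoidal unit: the bimodule `B`. -/
def RelHopfModule.unit (A B : Type u) [Ring A] [HopfAlgebra ℂ A] [StarRing A] [StarModule ℂ A]
    [Ring B] [Algebra ℂ B] [StarRing B] [StarModule ℂ B] [ComoduleStarAlgebra A B] :
    RelHopfModule A B where
  carrier := B
  coact_smul b m := by
    rw [smul_eq_mul]
    refine (ComoduleStarAlgebra.coact_mul (A := A) b m).trans ?_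
    change coact A b * coact A m = _
    induction coact A m with
    | zero => simp
    | add x y hx hy => simp only [map_add, mul_add, hx, hy]
    | tmul a m =>
      induction coact A b with
      | zero => simp
      | add x y hx hy => simp only [map_add, LinearMap.add_apply, add_mul, hx, hy]
      | tmul x y => simp
  coact_op_smul b m := by
    rw [op_smul_eq_mul]
    refine (ComoduleStarAlgebra.coact_mul (A := A) m b).trans ?_
    change coact A m * coact A b = _
    induction coact A m with
    | zero => simp
    | add x y hx hy => simp only [map_add, add_mul, hx, hy]
    | tmul a m =>
      induction coact A b with
      | zero => simp
      | add x y hx hy => simp only [map_add, LinearMap.add_apply, mul_add, hx, hy]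
      | tmul x y => simp

/-- The identification of the unit object with `B`. -/
def unitVal (A : Type u) {B : Type u} [Ring A] [HopfAlgebra ℂ A] [StarRing A] [StarModule ℂ A]
    [Ring B] [Algebra ℂ B] [StarRing B] [StarModule ℂ B] [ComoduleStarAlgebra A B] :
    RelHopfModule.unit A B ≃ₗ[ℂ] B :=
  LinearEquiv.refl ℂ B

/-- A sub-bimodule and subcomodule of a relative Hopf module is a relative Hopf module. -/
def RelHopfModule.sub (M : RelHopfModule A B) (S : Submodule ℂ M)
    (hl : ∀ (b : B), ∀ x ∈ S, b • x ∈ S) (hr : ∀ (b : B), ∀ x ∈ S, op b • x ∈ S)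
    (hc : ∀ x ∈ S, coact A x ∈ LinearMap.range (S.subtype.lTensor A)) : RelHopfModule A B :=
  letI i1 : Module B S :=
    { smul := fun b x => ⟨b • (x : M), hl b x x.2⟩
      one_smul := fun x => Subtype.ext (one_smul B (x : M))
      mul_smul := fun b c x => Subtype.ext (mul_smul b c (x : M))
      smul_zero := fun b => Subtype.ext (smul_zero b)
      smul_add := fun b x y => Subtype.ext (smul_add b (x : M) y)
      add_smul := fun b c x => Subtype.ext (add_smul b c (x : M))
      zero_smul := fun x => Subtype.ext (zero_smul B (x : M)) }
  letI i2 : Module Bᵐᵒᵖ S :=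
    { smul := fun b x => ⟨b • (x : M), hr b.unop x x.2⟩
      one_smul := fun x => Subtype.ext (one_smul Bᵐᵒᵖ (x : M))
      mul_smul := fun b c x => Subtype.ext (mul_smul b c (x : M))
      smul_zero := fun b => Subtype.ext (smul_zero b)
      smul_add := fun b x y => Subtype.ext (smul_add b (x : M) y)
      add_smul := fun b c x => Subtype.ext (add_smul b c (x : M))
      zero_smul := fun x => Subtype.ext (zero_smul Bᵐᵒᵖ (x : M)) }
  haveI i3 : IsScalarTower ℂ B S := ⟨fun c b x => Subtype.ext (smul_assoc c b (x : M))⟩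
  haveI i4 : IsScalarTower ℂ Bᵐᵒᵖ S := ⟨fun c b x => Subtype.ext (smul_assoc c b (x : M))⟩
  haveI i5 : SMulCommClass B Bᵐᵒᵖ S := ⟨fun b c x => Subtype.ext (smul_comm b c (x : M))⟩
  letI i6 : LeftComodule A S := restrictComodule S hc
  { carrier := S
    coact_smul := fun b m => by
      apply lTensor_subtype_injective (A := A) S
      refine (lTensor_restrictCoact _ S hc _).trans ((M.coact_smul b m).trans ?_)
      rw [← lTensor_restrictCoact (coact A) S hc m]
      change _ = S.subtype.lTensor A (diagL (coact A b) (restrictCoact (coact A) S hc m))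
      induction restrictCoact (coact A) S hc m with
      | zero => simp
      | add x y hx hy => simp only [map_add, hx, hy]
      | tmul a m =>
        induction coact A b with
        | zero => simp
        | add x y hx hy => simp only [map_add, LinearMap.add_apply, hx, hy]
        | tmul x y => rfl
    coact_op_smul := fun b m => by
      apply lTensor_subtype_injective (A := A) S
      refine (lTensor_restrictCoact _ S hc _).trans ((M.coact_op_smul b m).trans ?_)
      rw [← lTensor_restrictCoact (coact A) S hc m]
      change _ = S.subtype.lTensor A (diagR (coact A b) (restrictCoact (coact A) S hc m))
      induction restrictCoact (coact A) S hc m with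
      | zero => simp
      | add x y hx hy => simp only [map_add, hx, hy]
      | tmul a m =>
        induction coact A b with
        | zero => simp
        | add x y hx hy => simp only [map_add, LinearMap.add_apply, hx, hy]
        | tmul x y => rfl }

/-! #### The tensor product of relative Hopf modules -/

section Tensor

variable (M N : RelHopfModule A B)

/-- `b ↦ (m ⊗ n ↦ b m ⊗ n)`. -/
def balLeftAct : B →+* Module.End ℂ (BalTensor B M N) where
  toFun b := balLift B (balMk B ∘ₗ (Algebra.lsmul ℂ ℂ M b).rTensor N) (fun m c n => by
    simp [smul_comm b, balMk_balanced])
  map_one' := balTensor_ext B fun m n => by simp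
  map_mul' b c := balTensor_ext B fun m n =>
    congrArg (fun z => balMk B (z ⊗ₜ[ℂ] n)) (mul_smul b c m)
  map_zero' := balTensor_ext B fun m n => by simp
  map_add' b c := balTensor_ext B fun m n =>
    (congrArg (fun z => balMk B (z ⊗ₜ[ℂ] n)) (add_smul b c m)).trans (by
      rw [add_tmul, map_add]; rfl)

/-- `b ↦ (m ⊗ n ↦ m ⊗ n b)`. -/
def balRightAct : Bᵐᵒᵖ →+* Module.End ℂ (BalTensor B M N) where
  toFun b := balLift B (balMk B ∘ₗ (Algebra.lsmul ℂ ℂ N b).lTensor M) (fun m c n => by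
    simp [← smul_comm c, balMk_balanced])
  map_one' := balTensor_ext B fun m n => by simp
  map_mul' b c := balTensor_ext B fun m n =>
    congrArg (fun z => balMk B (m ⊗ₜ[ℂ] z)) (mul_smul b c n)
  map_zero' := balTensor_ext B fun m n => by simp
  map_add' b c := balTensor_ext B fun m n =>
    (congrArg (fun z => balMk B (m ⊗ₜ[ℂ] z)) (add_smul b c n)).trans (by
      rw [tmul_add, map_add]; rfl)

instance : Module B (BalTensor B M N) := Module.compHom _ (balLeftAct M N)
instance : Module Bᵐᵒᵖ (BalTensor B M N) := Module.compHom _ (balRightAct M N)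

variable {M N}

theorem smul_balMk (b : B) (m : M) (n : N) :
    b • balMk B (m ⊗ₜ[ℂ] n) = balMk B ((b • m) ⊗ₜ[ℂ] n) := rfl

theorem op_smul_balMk (b : Bᵐᵒᵖ) (m : M) (n : N) :
    b • balMk B (m ⊗ₜ[ℂ] n) = balMk B (m ⊗ₜ[ℂ] (b • n)) := rfl

theorem balTensor_induction {p : BalTensor B M N → Prop} (x : BalTensor B M N)
    (tmul : ∀ m n, p (balMk B (m ⊗ₜ n))) (add : ∀ x y, p x → p y → p (x + y)) : p x := by
  obtain ⟨x, rfl⟩ := balMk_surjective B x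
  induction x with
  | zero => simpa using tmul 0 0
  | add x y hx hy => rw [map_add]; exact add _ _ hx hy
  | tmul m n => exact tmul m n

instance : IsScalarTower ℂ B (BalTensor B M N) := ⟨fun c b x => by
  induction x using balTensor_induction with
  | add x y hx hy => simp only [smul_add, hx, hy]
  | tmul m n =>
    rw [smul_balMk, smul_balMk, smul_assoc, ← smul_tmul', map_smul]⟩

instance : IsScalarTower ℂ Bᵐᵒᵖ (BalTensor B M N) := ⟨fun c b x => by
  induction x using balTensor_induction with
  | add x y hx hy => simp only [smul_add, hx, hy]
  | tmul m n =>
    simp only [op_smul_balMk, smul_assoc, tmul_smul, map_smul]⟩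

instance : SMulCommClass B Bᵐᵒᵖ (BalTensor B M N) := ⟨fun b c x => by
  induction x using balTensor_induction with
  | add x y hx hy => simp only [smul_add, hx, hy]
  | tmul m n =>
    simp only [op_smul_balMk, smul_balMk]⟩

variable (M N) in
/-- `(a ⊗ m, c ⊗ n) ↦ a c ⊗ (m ⊗_B n)`. -/
def codiag : A ⊗[ℂ] M →ₗ[ℂ] A ⊗[ℂ] N →ₗ[ℂ] A ⊗[ℂ] BalTensor B M N :=
  TensorProduct.map₂ (LinearMap.mul ℂ A) ((TensorProduct.mk ℂ M N).compr₂ (balMk B))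

@[simp] theorem codiag_tmul (a c : A) (m : M) (n : N) :
    codiag M N (a ⊗ₜ m) (c ⊗ₜ n) = (a * c) ⊗ₜ balMk B (m ⊗ₜ n) := rfl

theorem codiag_balanced (x : A ⊗[ℂ] B) (y : A ⊗[ℂ] M) (z : A ⊗[ℂ] N) :
    codiag M N (diagR x y) z = codiag M N y (diagL x z) := by
  induction x with
  | zero => simp
  | add x y hx hy => simp only [map_add, LinearMap.add_apply, hx, hy]
  | tmul a b =>
    induction y with
    | zero => simp
    | add x y hx hy => simp only [map_add, LinearMap.add_apply, hx, hy]
    | tmul c m =>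
      induction z with
      | zero => simp
      | add x y hx hy => simp only [map_add, hx, hy]
      | tmul d n => simp [balMk_balanced, mul_assoc]

variable (M N) in
/-- The diagonal coaction `m ⊗_B n ↦ m₍₋₁₎ n₍₋₁₎ ⊗ (m₍₀₎ ⊗_B n₍₀₎)`. -/
def balCoact : BalTensor B M N →ₗ[ℂ] A ⊗[ℂ] BalTensor B M N :=
  balLift B (TensorProduct.lift ((codiag M N).compl₁₂ (coact A) (coact A))) (fun m b n => by
    simp only [lift.tmul, LinearMap.compl₁₂_apply, M.coact_op_smul, N.coact_smul, codiag_balanced])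

theorem balCoact_mk (m : M) (n : N) :
    balCoact M N (balMk B (m ⊗ₜ n)) = codiag M N (coact A m) (coact A n) := rfl

variable (M N) in
/-- `(a ⊗ (c ⊗ m), a' ⊗ (c' ⊗ n)) ↦ a a' ⊗ (c c' ⊗ (m ⊗_B n))`. -/
def codiag₂ : A ⊗[ℂ] (A ⊗[ℂ] M) →ₗ[ℂ] A ⊗[ℂ] (A ⊗[ℂ] N) →ₗ[ℂ] A ⊗[ℂ] (A ⊗[ℂ] BalTensor B M N) :=
  TensorProduct.map₂ (LinearMap.mul ℂ A) (codiag M N)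

theorem balCoact_coassoc (x : BalTensor B M N) :
    TensorProduct.assoc ℂ A A (BalTensor B M N)
      ((Coalgebra.comul (R := ℂ) (A := A)).rTensor _ (balCoact M N x)) =
    (balCoact M N).lTensor A (balCoact M N x) := by
  induction x using balTensor_induction with
  | add x y hx hy => simp only [map_add, hx, hy]
  | tmul m n =>
    rw [balCoact_mk]
    have e1 : ∀ (y : A ⊗[ℂ] M) (z : A ⊗[ℂ] N), TensorProduct.assoc ℂ A A (BalTensor B M N)
        ((Coalgebra.comul (R := ℂ) (A := A)).rTensor _ (codiag M N y z)) =
        codiag₂ M N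
          (TensorProduct.assoc ℂ A A M ((Coalgebra.comul (R := ℂ) (A := A)).rTensor _ y))
          (TensorProduct.assoc ℂ A A N ((Coalgebra.comul (R := ℂ) (A := A)).rTensor _ z)) := by
      intro y z
      induction y with
      | zero => simp
      | add x y hx hy => simp only [map_add, LinearMap.add_apply, hx, hy]
      | tmul a m =>
        induction z with
        | zero => simp
        | add x y hx hy => simp only [map_add, hx, hy]
        | tmul c n =>
          simp only [codiag_tmul, LinearMap.rTensor_tmul, Bialgebra.comul_mul]
          induction Coalgebra.comul (R := ℂ) a with
          | zero => simp
          | add x y hx hy => simp only [map_add, add_mul, add_tmul, LinearMap.add_apply, hx, hy]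
          | tmul p q =>
            induction Coalgebra.comul (R := ℂ) c with
            | zero => simp
            | add x y hx hy => simp only [map_add, mul_add, add_tmul, hx, hy]
            | tmul r s => simp [codiag₂]
    have e2 : ∀ (y : A ⊗[ℂ] M) (z : A ⊗[ℂ] N), (balCoact M N).lTensor A (codiag M N y z) =
        codiag₂ M N ((coact A).lTensor A y) ((coact A).lTensor A z) := by
      intro y z
      induction y with
      | zero => simp
      | add x y hx hy => simp only [map_add, LinearMap.add_apply, hx, hy]
      | tmul a m =>
        induction z with
        | zero => simp
        | add x y hx hy => simp only [map_add, hx, hy]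
        | tmul c n => simp [codiag₂, balCoact_mk]
    rw [e1, e2]
    congr 1
    · exact congrArg _ (LeftComodule.coassoc m)
    · exact LeftComodule.coassoc n

theorem balCoact_counit (x : BalTensor B M N) :
    TensorProduct.lid ℂ (BalTensor B M N)
      ((Coalgebra.counit (R := ℂ) (A := A)).rTensor _ (balCoact M N x)) = x := by
  induction x using balTensor_induction with
  | add x y hx hy => simp only [map_add, hx, hy]
  | tmul m n =>
    rw [balCoact_mk]
    have e1 : ∀ (y : A ⊗[ℂ] M) (z : A ⊗[ℂ] N), TensorProduct.lid ℂ (BalTensor B M N)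
        ((Coalgebra.counit (R := ℂ) (A := A)).rTensor _ (codiag M N y z)) =
        balMk B ((TensorProduct.lid ℂ M ((Coalgebra.counit (R := ℂ) (A := A)).rTensor _ y)) ⊗ₜ
          (TensorProduct.lid ℂ N ((Coalgebra.counit (R := ℂ) (A := A)).rTensor _ z))) := by
      intro y z
      induction y with
      | zero => simp
      | add x y hx hy => simp only [map_add, LinearMap.add_apply, add_tmul, hx, hy]
      | tmul a m =>
        induction z with
        | zero => simp
        | add x y hx hy => simp only [map_add, tmul_add, hx, hy]
        | tmul c n =>
        simp only [codiag_tmul, LinearMap.rTensor_tmul, Bialgebra.counit_mul,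
          TensorProduct.lid_tmul, smul_tmul_smul, map_smul]
    rw [e1]
    congr 2
    · exact LeftComodule.counit m
    · exact LeftComodule.counit n

instance : LeftComodule A (BalTensor B M N) where
  coact := balCoact M N
  coassoc := balCoact_coassoc
  counit := balCoact_counit

theorem coact_balMk (m : M) (n : N) :
    coact A (balMk B (m ⊗ₜ[ℂ] n)) = codiag M N (coact A m) (coact A n) := rfl

theorem codiag_diagL (x : A ⊗[ℂ] B) (y : A ⊗[ℂ] M) (z : A ⊗[ℂ] N) :
    codiag M N (diagL x y) z = diagL x (codiag M N y z) := by
  induction x with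
  | zero => simp
  | add x y hx hy => simp only [map_add, LinearMap.add_apply, hx, hy]
  | tmul a b =>
    induction y with
    | zero => simp
    | add x y hx hy => simp only [map_add, LinearMap.add_apply, hx, hy]
    | tmul c m =>
      induction z with
      | zero => simp
      | add x y hx hy => simp only [map_add, hx, hy]
      | tmul d n => simp [smul_balMk, mul_assoc]

theorem codiag_diagR (x : A ⊗[ℂ] B) (y : A ⊗[ℂ] M) (z : A ⊗[ℂ] N) :
    codiag M N y (diagR x z) = diagR x (codiag M N y z) := by
  induction x with
  | zero => simp
  | add x y hx hy => simp only [map_add, LinearMap.add_apply, hx, hy]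
  | tmul a b =>
    induction y with
    | zero => simp
    | add x y hx hy => simp only [map_add, LinearMap.add_apply, hx, hy]
    | tmul c m =>
      induction z with
      | zero => simp
      | add x y hx hy => simp only [map_add, hx, hy]
      | tmul d n => simp [op_smul_balMk, mul_assoc]

variable (M N) in
/-- The tensor product `M ⊗_B N` in the category of relative Hopf modules. -/
def RelHopfModule.tensor : RelHopfModule A B where
  carrier := BalTensor B M N
  coact_smul b x := by
    induction x using balTensor_induction with
    | add x y hx hy => simp only [smul_add, map_add, hx, hy]
    | tmul m n =>
      rw [smul_balMk, coact_balMk, coact_balMk, M.coact_smul, codiag_diagL]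
  coact_op_smul b x := by
    induction x using balTensor_induction with
    | add x y hx hy => simp only [smul_add, map_add, hx, hy]
    | tmul m n =>
      rw [op_smul_balMk, coact_balMk, coact_balMk, N.coact_op_smul, codiag_diagR]

/-- The element `m ⊗_B n`. -/
def tmulB (m : M) (n : N) : M.tensor N := balMk B (m ⊗ₜ[ℂ] n)

/-- The tensor product `f ⊗_B g` of bimodule maps. -/
def BimodHom.tensor {M' N' : RelHopfModule A B} (f : BimodHom M M') (g : BimodHom N N') :
    BimodHom (M.tensor N) (M'.tensor N') :=
  ⟨balLift B (P := BalTensor B M' N') (balMk B ∘ₗ TensorProduct.map f.1 g.1) (fun m b n => by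
      rw [LinearMap.comp_apply, LinearMap.comp_apply, map_tmul, map_tmul, f.2.2, g.2.1,
        balMk_balanced]),
    fun b x => by
      induction x using balTensor_induction with
      | add x y hx hy => exact (congrArg _ (smul_add b x y)).trans ((map_add _ _ _).trans
          ((congrArg₂ (· + ·) hx hy).trans ((smul_add b _ _).symm.trans
          (congrArg _ (map_add _ _ _).symm))))
      | tmul m n => exact congrArg (fun z => balMk B (z ⊗ₜ[ℂ] g.1 n)) (f.2.1 b m),
    fun b x => by
      induction x using balTensor_induction with
      | add x y hx hy => exact (congrArg _ (smul_add (op b) x y)).trans ((map_add _ _ _).trans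
          ((congrArg₂ (· + ·) hx hy).trans ((smul_add (op b) _ _).symm.trans
          (congrArg _ (map_add _ _ _).symm))))
      | tmul m n => exact congrArg (fun z => balMk B (f.1 m ⊗ₜ[ℂ] z)) (g.2.2 b n)⟩

end Tensor

end RelativeHopfModules

/-! ### Differential calculi and complex structures -/

/-- A differential calculus over `B`: a differential graded algebra `Ω = ⨁ₖ Ωᵏ` with `Ω⁰ = B`
(identified through `ofBase`), generated as an algebra by `B` and `dB`. -/
structure DifferentialCalculus (B : Type u) [Ring B] [Algebra ℂ B] where
  Ω : Type u
  [ring : Ring Ω]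
  [algebra : Algebra ℂ Ω]
  form : ℕ → Submodule ℂ Ω
  [graded : GradedAlgebra form]
  ofBase : B →ₐ[ℂ] Ω
  ofBase_injective : Function.Injective ofBase
  range_ofBase : LinearMap.range ofBase.toLinearMap = form 0
  d : Ω →ₗ[ℂ] Ω
  d_mem : ∀ k, ∀ ω ∈ form k, d ω ∈ form (k + 1)
  d_d : ∀ ω, d (d ω) = 0
  leibniz : ∀ k, ∀ ω ∈ form k, ∀ ν, d (ω * ν) = d ω * ν + (-1 : ℂ) ^ k • (ω * d ν)
  generated : Algebra.adjoin ℂ (Set.range ofBase ∪ Set.range fun b => d (ofBase b)) = ⊤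

attribute [instance] DifferentialCalculus.ring DifferentialCalculus.algebra
  DifferentialCalculus.graded

/-- A star-differential calculus: a conjugate-linear degree-preserving involution `conj` on `Ω`
which extends the star of `B`, commutes with `d`, and satisfies
`(ω ∧ ν)* = (-1)ᵏˡ ν* ∧ ω*` for `ω ∈ Ωᵏ`, `ν ∈ Ωˡ`. -/
structure StarDifferentialCalculus (B : Type u) [Ring B] [Algebra ℂ B] [StarRing B]
    extends DifferentialCalculus B where
  conj : Ω →ₛₗ[starRingEnd ℂ] Ω
  conj_conj : ∀ ω, conj (conj ω) = ω
  conj_ofBase : ∀ b, conj (ofBase b) = ofBase (star b)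
  conj_mem : ∀ k, ∀ ω ∈ form k, conj ω ∈ form k
  conj_d : ∀ ω, conj (d ω) = d (conj ω)
  conj_mul : ∀ k l, ∀ ω ∈ form k, ∀ ν ∈ form l,
    conj (ω * ν) = (-1 : ℂ) ^ (k * l) • (conj ν * conj ω)

/-- A left `A`-covariant star-differential calculus on a left `A`-comodule star-algebra `B`: the
coaction of `B` extends to a comodule algebra map `Ω → A ⊗ Ω` which preserves the degree and is
compatible with `d` and with the star. -/
structure CovariantStarCalculus (A B : Type u) [Ring A] [HopfAlgebra ℂ A] [StarRing A]
    [StarModule ℂ A] [Ring B] [Algebra ℂ B] [StarRing B] [StarModule ℂ B]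
    [ComoduleStarAlgebra A B] extends StarDifferentialCalculus B where
  δ : Ω →ₐ[ℂ] A ⊗[ℂ] Ω
  δ_coassoc : ∀ ω, TensorProduct.assoc ℂ A A Ω
      ((Coalgebra.comul (R := ℂ) (A := A)).rTensor Ω (δ ω)) = δ.toLinearMap.lTensor A (δ ω)
  δ_counit : ∀ ω, TensorProduct.lid ℂ Ω
      ((Coalgebra.counit (R := ℂ) (A := A)).rTensor Ω (δ ω)) = ω
  δ_ofBase : ∀ b, δ (ofBase b) = ofBase.toLinearMap.lTensor A (coact A b)
  δ_mem : ∀ k, ∀ ω ∈ form k, δ ω ∈ LinearMap.range ((form k).subtype.lTensor A)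
  δ_d : ∀ ω, δ (d ω) = d.lTensor A (δ ω)
  δ_conj : ∀ ω, δ (conj ω) =
    TensorProduct.map (starLinearEquiv ℂ (A := A)).toLinearMap conj (δ ω)

/-- A covariant complex structure: an algebra grading `Ω = ⨁ Ω^{(p,q)}` by `ℕ × ℕ`
with `Ωᵏ = ⨁_{p+q=k} Ω^{(p,q)}`, `(Ω^{(p,q)})* = Ω^{(q,p)}`,
`d Ω^{(p,q)} ⊆ Ω^{(p+1,q)} ⊕ Ω^{(p,q+1)}`, and such that each `Ω^{(p,q)}` is a subcomodule. -/
structure CovariantComplexStructure (A B : Type u) [Ring A] [HopfAlgebra ℂ A] [StarRing A]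
    [StarModule ℂ A] [Ring B] [Algebra ℂ B] [StarRing B] [StarModule ℂ B]
    [ComoduleStarAlgebra A B] extends CovariantStarCalculus A B where
  bi : ℕ × ℕ → Submodule ℂ Ω
  [bigraded : GradedAlgebra bi]
  form_eq : ∀ k, form k = ⨆ pq : {pq : ℕ × ℕ // pq.1 + pq.2 = k}, bi pq.1
  conj_bi : ∀ p q ω, conj ω ∈ bi (q, p) ↔ ω ∈ bi (p, q)
  d_bi : ∀ p q, ∀ ω ∈ bi (p, q), d ω ∈ bi (p + 1, q) ⊔ bi (p, q + 1)
  δ_bi : ∀ pq, ∀ ω ∈ bi pq, δ ω ∈ LinearMap.range ((bi pq).subtype.lTensor A)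

attribute [instance] CovariantComplexStructure.bigraded

section Calculus

variable {A : Type u} [Ring A] [HopfAlgebra ℂ A] [StarRing A] [StarModule ℂ A]
  {B : Type u} [Ring B] [Algebra ℂ B] [StarRing B] [StarModule ℂ B] [ComoduleStarAlgebra A B]

namespace CovariantStarCalculus

variable (K : CovariantStarCalculus A B)

/-- The whole calculus `Ω` as a relative Hopf module. -/
def total : RelHopfModule A B :=
  letI i1 : Module B K.Ω := Module.compHom K.Ω (K.ofBase : B →+* K.Ω)
  letI i2 : Module Bᵐᵒᵖ K.Ω := Module.compHom K.Ω (RingHom.op (K.ofBase : B →+* K.Ω))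
  haveI i3 : IsScalarTower ℂ B K.Ω := ⟨fun c b x => by
    change K.ofBase (c • b) * x = c • (K.ofBase b * x)
    rw [map_smul, smul_mul_assoc]⟩
  haveI i4 : IsScalarTower ℂ Bᵐᵒᵖ K.Ω := ⟨fun c b x => by
    change x * K.ofBase (c • b.unop) = c • (x * K.ofBase b.unop)
    rw [map_smul, mul_smul_comm]⟩
  haveI i5 : SMulCommClass B Bᵐᵒᵖ K.Ω := ⟨fun b c x => by
    change K.ofBase b * (x * K.ofBase c.unop) = K.ofBase b * x * K.ofBase c.unop
    rw [mul_assoc]⟩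
  letI i6 : LeftComodule A K.Ω := ⟨K.δ.toLinearMap, K.δ_coassoc, K.δ_counit⟩
  { carrier := K.Ω
    coact_smul := fun b m => by
      change K.δ (K.ofBase b * m) = diagL (coact A b) (K.δ m)
      rw [map_mul, K.δ_ofBase]
      induction K.δ m with
      | zero => simp
      | add x y hx hy => simp only [map_add, mul_add, hx, hy]
      | tmul a m =>
        induction coact A b with
        | zero => simp
        | add x y hx hy => simp only [map_add, add_mul, LinearMap.add_apply, hx, hy]
        | tmul x y =>
          rw [LinearMap.lTensor_tmul, Algebra.TensorProduct.tmul_mul_tmul]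
          rfl
    coact_op_smul := fun b m => by
      change K.δ (m * K.ofBase b) = diagR (coact A b) (K.δ m)
      rw [map_mul, K.δ_ofBase]
      induction K.δ m with
      | zero => simp
      | add x y hx hy => simp only [map_add, add_mul, hx, hy]
      | tmul a m =>
        induction coact A b with
        | zero => simp
        | add x y hx hy => simp only [map_add, mul_add, LinearMap.add_apply, hx, hy]
        | tmul x y =>
          rw [LinearMap.lTensor_tmul, Algebra.TensorProduct.tmul_mul_tmul]
          rfl }

theorem ofBase_mem (b : B) : K.ofBase b ∈ K.form 0 := by
  rw [← K.range_ofBase]; exact ⟨b, rfl⟩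

theorem ofBase_mul_mem (b : B) {k : ℕ} {x : K.Ω} (hx : x ∈ K.form k) :
    K.ofBase b * x ∈ K.form k := by
  simpa using SetLike.mul_mem_graded (K.ofBase_mem b) hx

theorem mul_ofBase_mem (b : B) {k : ℕ} {x : K.Ω} (hx : x ∈ K.form k) :
    x * K.ofBase b ∈ K.form k := by
  simpa using SetLike.mul_mem_graded hx (K.ofBase_mem b)

/-- The relative Hopf module `Ωᵏ` of `k`-forms. -/
def forms (k : ℕ) : RelHopfModule A B :=
  K.total.sub (K.form k)
    (fun b _ hx => K.ofBase_mul_mem b hx)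
    (fun b _ hx => K.mul_ofBase_mem b hx)
    (K.δ_mem k)

/-- The inclusion of `Ωᵏ` in `Ω`. -/
def formVal (k : ℕ) : K.forms k →ₗ[ℂ] K.Ω := (K.form k).subtype

/-- A `k`-form, as an element of the relative Hopf module `Ωᵏ`. -/
def formMk {k : ℕ} (ω : K.Ω) (h : ω ∈ K.form k) : K.forms k := (⟨ω, h⟩ : K.form k)

theorem formVal_mem {k : ℕ} (ω : K.forms k) : K.formVal k ω ∈ K.form k :=
  Subtype.property (p := (· ∈ K.form k)) ω

theorem formVal_injective (k : ℕ) : Function.Injective (K.formVal k) :=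
  (K.form k).injective_subtype

end CovariantStarCalculus

namespace CovariantComplexStructure

variable (C : CovariantComplexStructure A B)

theorem ofBase_mem_bi (b : B) : C.ofBase b ∈ C.bi 0 := by
  have h := C.toCovariantStarCalculus.ofBase_mem b
  rw [C.form_eq 0] at h
  refine (iSup_le ?_ : _ ≤ C.bi 0) h
  rintro ⟨⟨p, q⟩, hpq⟩
  obtain ⟨rfl, rfl⟩ : p = 0 ∧ q = 0 := by simpa using hpq
  exact le_rfl

theorem ofBase_mul_mem_bi (b : B) {pq : ℕ × ℕ} {x : C.Ω} (hx : x ∈ C.bi pq) :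
    C.ofBase b * x ∈ C.bi pq := by
  simpa using SetLike.mul_mem_graded (C.ofBase_mem_bi b) hx

theorem mul_ofBase_mem_bi (b : B) {pq : ℕ × ℕ} {x : C.Ω} (hx : x ∈ C.bi pq) :
    x * C.ofBase b ∈ C.bi pq := by
  simpa using SetLike.mul_mem_graded hx (C.ofBase_mem_bi b)

/-- The relative Hopf module `Ω^{(p,q)}`. -/
def biforms (pq : ℕ × ℕ) : RelHopfModule A B :=
  C.total.sub (C.bi pq)
    (fun b _ hx => C.ofBase_mul_mem_bi b hx)
    (fun b _ hx => C.mul_ofBase_mem_bi b hx)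
    (C.δ_bi pq)

/-- The inclusion of `Ω^{(p,q)}` in `Ω`. -/
def biVal (pq : ℕ × ℕ) : C.biforms pq →ₗ[ℂ] C.Ω := (C.bi pq).subtype

/-- An element of `Ω^{(p,q)}`, as an element of the relative Hopf module. -/
def biMk {pq : ℕ × ℕ} (ω : C.Ω) (h : ω ∈ C.bi pq) : C.biforms pq := (⟨ω, h⟩ : C.bi pq)

theorem biVal_mem {pq : ℕ × ℕ} (ω : C.biforms pq) : C.biVal pq ω ∈ C.bi pq :=
  Subtype.property (p := (· ∈ C.bi pq)) ω

theorem biVal_injective (pq : ℕ × ℕ) : Function.Injective (C.biVal pq) :=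
  (C.bi pq).injective_subtype

/-- The relative Hopf module `Ω¹` of one-forms. -/
abbrev Ω1 : RelHopfModule A B := C.forms 1

/-- The relative Hopf module `Ω^{(1,0)}`. -/
abbrev Ω10 : RelHopfModule A B := C.biforms (1, 0)

/-- The relative Hopf module `Ω^{(0,1)}`. -/
abbrev Ω01 : RelHopfModule A B := C.biforms (0, 1)

theorem bi_le_form (p q : ℕ) : C.bi (p, q) ≤ C.form (p + q) := by
  rw [C.form_eq]
  exact le_iSup (fun pq : {pq : ℕ × ℕ // pq.1 + pq.2 = p + q} => C.bi pq.1) ⟨(p, q), rfl⟩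

/-- The inclusion of `Ω^{(p,q)}` in `Ω^{p+q}`. -/
def incl (p q : ℕ) : BimodHom (C.biforms (p, q)) (C.forms (p + q)) :=
  ⟨{ toFun := fun ω => C.formMk (C.biVal (p, q) ω) (C.bi_le_form p q (C.biVal_mem ω))
     map_add' := fun _ _ => rfl
     map_smul' := fun _ _ => rfl },
    fun _ _ => rfl, fun _ _ => rfl⟩

/-- The projection `π^{p,q}` of `Ωᵏ` to `Ω^{(p,q)}`. -/
def proj (k : ℕ) (pq : ℕ × ℕ) : BimodHom (C.forms k) (C.biforms pq) :=
  ⟨{ toFun := fun ω => C.biMk (DirectSum.decompose C.bi (C.formVal k ω) pq) (Subtype.property _)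
     map_add' := fun ω ν => C.biVal_injective pq (by
      change (DirectSum.decompose C.bi (C.formVal k (ω + ν)) pq : C.Ω) =
        DirectSum.decompose C.bi (C.formVal k ω) pq + DirectSum.decompose C.bi (C.formVal k ν) pq
      rw [map_add, DirectSum.decompose_add]; rfl)
     map_smul' := fun c ω => C.biVal_injective pq (by
      change (DirectSum.decompose C.bi (C.formVal k (c • ω)) pq : C.Ω) =
        c • (DirectSum.decompose C.bi (C.formVal k ω) pq : C.Ω)
      rw [map_smul, DirectSum.decompose_smul]; rfl) },
    fun b _ => C.biVal_injective pq
      (DirectSum.coe_decompose_mul_of_left_mem_zero C.bi (C.ofBase_mem_bi b)),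
    fun b _ => C.biVal_injective pq
      (DirectSum.coe_decompose_mul_of_right_mem_zero C.bi (C.ofBase_mem_bi b))⟩

/-- The star on one-forms. -/
def star1 : C.Ω1 →ₛₗ[starRingEnd ℂ] C.Ω1 where
  toFun ω := C.formMk (C.conj (C.formVal 1 ω)) (C.conj_mem 1 _ (C.formVal_mem ω))
  map_add' ω ν := C.formVal_injective 1 (map_add C.conj (C.formVal 1 ω) (C.formVal 1 ν))
  map_smul' c ω := C.formVal_injective 1 (C.conj.map_smulₛₗ c (C.formVal 1 ω))

/-- The star as a map `Ω^{(p,q)} → Ω^{(q,p)}`. -/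
def starBi (p q : ℕ) : C.biforms (p, q) →ₛₗ[starRingEnd ℂ] C.biforms (q, p) where
  toFun ω := C.biMk (C.conj (C.biVal (p, q) ω)) ((C.conj_bi p q _).2 (C.biVal_mem ω))
  map_add' ω ν := C.biVal_injective (q, p) (map_add C.conj (C.biVal _ ω) (C.biVal _ ν))
  map_smul' c ω := C.biVal_injective (q, p) (C.conj.map_smulₛₗ c (C.biVal _ ω))

theorem conj_ofBase_mul (b : B) {k : ℕ} {ω : C.Ω} (h : ω ∈ C.form k) :
    C.conj (C.ofBase b * ω) = C.conj ω * C.ofBase (star b) := by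
  rw [C.conj_mul 0 k _ (C.toCovariantStarCalculus.ofBase_mem b) _ h, C.conj_ofBase]
  simp

theorem conj_mul_ofBase (b : B) {k : ℕ} {ω : C.Ω} (h : ω ∈ C.form k) :
    C.conj (ω * C.ofBase b) = C.ofBase (star b) * C.conj ω := by
  rw [C.conj_mul k 0 _ h _ (C.toCovariantStarCalculus.ofBase_mem b), C.conj_ofBase]
  simp

theorem star1_smul (b : B) (ω : C.Ω1) : C.star1 (b • ω) = op (star b) • C.star1 ω :=
  C.formVal_injective 1 (C.conj_ofBase_mul b (C.formVal_mem ω))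

theorem star1_op_smul (b : B) (ω : C.Ω1) : C.star1 (op b • ω) = star b • C.star1 ω :=
  C.formVal_injective 1 (C.conj_mul_ofBase b (C.formVal_mem ω))

theorem starBi_smul (p q : ℕ) (b : B) (ω : C.biforms (p, q)) :
    C.starBi p q (b • ω) = op (star b) • C.starBi p q ω :=
  C.biVal_injective (q, p) (C.conj_ofBase_mul b (C.bi_le_form p q (C.biVal_mem ω)))

/-- The map `† = flip ∘ (* ⊗ *)` on `Ω¹ ⊗_B Ω¹`. -/
def dagger : C.Ω1.tensor C.Ω1 →ₛₗ[starRingEnd ℂ] C.Ω1.tensor C.Ω1 :=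
  balLift B (P := BalTensor B C.Ω1 C.Ω1)
    ((balMk B ∘ₗ (TensorProduct.comm ℂ C.Ω1 C.Ω1).toLinearMap).comp
      (TensorProduct.map C.star1 C.star1))
    (fun ω b η => by
      simp only [LinearMap.comp_apply, TensorProduct.map_tmul, LinearEquiv.coe_coe,
        TensorProduct.comm_tmul, star1_smul, star1_op_smul, balMk_balanced])

end CovariantComplexStructure

/-! ### Metrics -/

/-- The value `(x, y) ∈ B` of a bimodule map `p = (,) : M ⊗_B N → B`. -/
def pair {M N : RelHopfModule A B} (p : BimodHom (M.tensor N) (RelHopfModule.unit A B)) :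
    M →ₗ[ℂ] N →ₗ[ℂ] B :=
  LinearMap.mk₂ ℂ (fun x y => unitVal A (p.1 (tmulB x y)))
    (fun x x' y => by
      rw [tmulB, add_tmul, map_add]; exact map_add p.1 _ _)
    (fun c x y => by
      rw [tmulB, ← smul_tmul', map_smul]; exact map_smul p.1 _ _)
    (fun x y y' => by
      rw [tmulB, tmul_add, map_add]; exact map_add p.1 _ _)
    (fun c x y => by
      rw [tmulB, tmul_smul, map_smul]; exact map_smul p.1 _ _)

theorem pair_smul {M N : RelHopfModule A B}
    (p : BimodHom (M.tensor N) (RelHopfModule.unit A B)) (b : B) (x : M) (y : N) :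
    pair p (b • x) y = b * pair p x y := p.2.1 b (tmulB x y)

theorem pair_op_smul {M N : RelHopfModule A B}
    (p : BimodHom (M.tensor N) (RelHopfModule.unit A B)) (b : B) (x : M) (y : N) :
    pair p x (op b • y) = pair p x y * b := p.2.2 b (tmulB x y)

theorem pair_balanced {M N : RelHopfModule A B}
    (p : BimodHom (M.tensor N) (RelHopfModule.unit A B)) (b : B) (x : M) (y : N) :
    pair p (op b • x) y = pair p x (b • y) :=
  congrArg (fun z => unitVal A (p.1 z)) (balMk_balanced B x b y)

/-- For a bimodule map `p = (,) : M ⊗_B M → B` and `ω ∈ M`, the map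
`(ω, ·) ⊗_B id : M ⊗_B M → M`, `x ⊗ y ↦ (ω, x) y`. -/
def contractLeft {M : RelHopfModule A B}
    (p : BimodHom (M.tensor M) (RelHopfModule.unit A B)) (ω : M) : M.tensor M →ₗ[ℂ] M :=
  balLift B (TensorProduct.lift (LinearMap.mk₂ ℂ (fun x y => pair p ω x • y)
      (fun x x' y => by rw [map_add, add_smul])
      (fun c x y => by rw [map_smul, smul_assoc])
      (fun x y y' => smul_add _ _ _)
      (fun c x y => smul_comm _ _ _)))
    (fun x b y => by
      simp only [lift.tmul, LinearMap.mk₂_apply, pair_op_smul, mul_smul])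

/-- The map `id ⊗_B (·, ω) : M ⊗_B M → M`, `x ⊗ y ↦ x (y, ω)`. -/
def contractRight {M : RelHopfModule A B}
    (p : BimodHom (M.tensor M) (RelHopfModule.unit A B)) (ω : M) : M.tensor M →ₗ[ℂ] M :=
  balLift B (TensorProduct.lift (LinearMap.mk₂ ℂ (fun x y => op (pair p y ω) • x)
      (fun x x' y => smul_add _ _ _)
      (fun c x y => smul_comm _ _ _)
      (fun x y y' => by rw [map_add, LinearMap.add_apply, op_add, add_smul])
      (fun c x y => by rw [map_smul, LinearMap.smul_apply, op_smul, smul_assoc])))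
    (fun x b y => by
      simp only [lift.tmul, LinearMap.mk₂_apply, pair_smul, op_mul, mul_smul])

/-- `(g, (,))` is a metric on `M`: `((ω, ·) ⊗ id) g = ω = (id ⊗ (·, ω)) g` for all `ω`. -/
def IsMetric {M : RelHopfModule A B} (g : M.tensor M)
    (p : BimodHom (M.tensor M) (RelHopfModule.unit A B)) : Prop :=
  ∀ ω : M, contractLeft p ω g = ω ∧ contractRight p ω g = ω

/-- The map `coev_g : B → M ⊗_B M`, `b ↦ b g`. -/
def coevOf {M : RelHopfModule A B} (g : M.tensor M) :
    RelHopfModule.unit A B →ₗ[ℂ] M.tensor M :=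
  ((Algebra.lsmul ℂ ℂ (M.tensor M) : B →ₐ[ℂ] _).toLinearMap.flip g) ∘ₗ (unitVal A).toLinearMap

/-- `(g, (,))` is an `A`-covariant metric. -/
def IsCovariantMetric {M : RelHopfModule A B} (g : M.tensor M)
    (p : BimodHom (M.tensor M) (RelHopfModule.unit A B)) : Prop :=
  IsMetric g p ∧ IsCovariant A p.1 ∧ IsCovariant A (coevOf g)

end Calculus

/-! ### Quantum homogeneous spaces -/

section HomogeneousSpace

variable {A H : Type u} [Ring A] [HopfAlgebra ℂ A] [StarRing A] [StarModule ℂ A]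
  [Ring H] [HopfAlgebra ℂ H] [StarRing H] [StarModule ℂ H]

/-- A Hopf star-algebra is a compact quantum group algebra if it is spanned by the matrix
coefficients of its finite-dimensional unitary corepresentations. -/
def IsCQGAlgebra (H : Type u) [Ring H] [HopfAlgebra ℂ H] [StarRing H] [StarModule ℂ H] : Prop :=
  HopfStarAlgebra H ∧
  Submodule.span ℂ {x : H | ∃ (n : ℕ) (u : Matrix (Fin n) (Fin n) H),
    (∀ i j, Coalgebra.comul (R := ℂ) (u i j) = ∑ k, u i k ⊗ₜ[ℂ] u k j) ∧
    (∀ i j, Coalgebra.counit (R := ℂ) (u i j) = if i = j then 1 else 0) ∧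
    u.conjTranspose * u = 1 ∧ u * u.conjTranspose = 1 ∧ ∃ i j, u i j = x} = ⊤

/-- Homomorphisms of Hopf star-algebras. (A bialgebra map between Hopf algebras automatically
commutes with the antipodes.) -/
structure HopfStarHom (A H : Type u) [Ring A] [HopfAlgebra ℂ A] [StarRing A] [StarModule ℂ A]
    [Ring H] [HopfAlgebra ℂ H] [StarRing H] [StarModule ℂ H] extends A →ₐc[ℂ] H where
  map_star : ∀ a, toBialgHom (star a) = star (toBialgHom a)

/-- The underlying algebra map. -/
def HopfStarHom.alg (π : HopfStarHom A H) : A →ₐ[ℂ] H := (π.toBialgHom : A →ₐ[ℂ] H)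

/-- The right `H`-coaction `(id ⊗ π) ∘ Δ` on `A`. -/
def HopfStarHom.rightCoact (π : HopfStarHom A H) : A →ₐ[ℂ] A ⊗[ℂ] H :=
  (Algebra.TensorProduct.map (AlgHom.id ℂ A) π.alg).comp (Bialgebra.comulAlgHom ℂ A)

theorem HopfStarHom.comul_alg (π : HopfStarHom A H) (a : A) :
    Coalgebra.comul (R := ℂ) (π.alg a) =
      TensorProduct.map π.alg.toLinearMap π.alg.toLinearMap (Coalgebra.comul (R := ℂ) a) :=
  (LinearMap.congr_fun π.toBialgHom.map_comp_comul a).symm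

theorem HopfStarHom.counit_alg (π : HopfStarHom A H) (a : A) :
    Coalgebra.counit (R := ℂ) (π.alg a) = Coalgebra.counit (R := ℂ) a :=
  LinearMap.congr_fun π.toBialgHom.counit_comp a

variable [HopfStarAlgebra A]

theorem HopfStarHom.rightCoact_star (π : HopfStarHom A H) (a : A) :
    π.rightCoact (star a) = star (π.rightCoact a) := by
  change TensorProduct.map LinearMap.id π.alg.toLinearMap (Coalgebra.comul (R := ℂ) (star a)) =
    star (TensorProduct.map LinearMap.id π.alg.toLinearMap (Coalgebra.comul (R := ℂ) a))
  rw [HopfStarAlgebra.comul_star]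
  induction Coalgebra.comul (R := ℂ) a with
  | zero => simp
  | add x y hx hy => simp only [map_add, star_add, hx, hy]
  | tmul x y => exact congrArg (star x ⊗ₜ[ℂ] ·) (π.map_star y)

/-- The star-algebra `B = A^{co H}` of elements with `(id ⊗ π) Δ(a) = a ⊗ 1`. -/
def coinvariants (π : HopfStarHom A H) : StarSubalgebra ℂ A where
  toSubalgebra := AlgHom.equalizer π.rightCoact Algebra.TensorProduct.includeLeft
  star_mem' {a} ha := by
    change π.rightCoact (star a) = star a ⊗ₜ[ℂ] (1 : H)
    have ha' : π.rightCoact a = a ⊗ₜ[ℂ] (1 : H) := ha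
    rw [π.rightCoact_star, ha']
    simp

variable (π : HopfStarHom A H)

theorem mem_coinvariants {a : A} : a ∈ coinvariants π ↔ π.rightCoact a = a ⊗ₜ[ℂ] (1 : H) :=
  Iff.rfl

/-- The underlying subspace of `A^{co H}`. -/
abbrev coinvSub : Submodule ℂ A := Subalgebra.toSubmodule (coinvariants π).toSubalgebra

/-- `A` is a left comodule over itself. -/
abbrev regularComodule : LeftComodule A A where
  coact := Coalgebra.comul
  coassoc a := Coalgebra.coassoc_apply a
  counit a := by simp

theorem comul_mem_range (a : A) (ha : a ∈ coinvSub π) :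
    Coalgebra.comul (R := ℂ) a ∈ LinearMap.range ((coinvSub π).subtype.lTensor A) := by
  let f : A →ₗ[ℂ] A ⊗[ℂ] H := π.rightCoact.toLinearMap -
    (Algebra.TensorProduct.includeLeft : A →ₐ[ℂ] A ⊗[ℂ] H).toLinearMap
  have hf : Function.Exact (coinvSub π).subtype f := by
    intro x
    refine sub_eq_zero.trans ⟨fun h => ⟨⟨x, h⟩, rfl⟩, ?_⟩
    rintro ⟨y, rfl⟩
    exact y.2
  refine (Module.Flat.lTensor_exact A hf _).1 ?_
  have e1 : ∀ z : A ⊗[ℂ] A, f.lTensor A z =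
      (π.alg.toLinearMap.lTensor A).lTensor A ((Coalgebra.comul (R := ℂ)).lTensor A z) -
        TensorProduct.assoc ℂ A A H (z ⊗ₜ[ℂ] (1 : H)) := by
    intro z
    induction z with
    | zero => simp
    | add x y hx hy => simp only [map_add, add_tmul, hx, hy]; abel
    | tmul x y =>
      simp only [LinearMap.lTensor_tmul, TensorProduct.assoc_tmul, f, LinearMap.sub_apply,
        tmul_sub]
      rfl
  have e2 : ∀ z : A ⊗[ℂ] A, (π.alg.toLinearMap.lTensor A).lTensor A
      (TensorProduct.assoc ℂ A A A ((Coalgebra.comul (R := ℂ)).rTensor A z)) =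
      TensorProduct.assoc ℂ A A H ((Coalgebra.comul (R := ℂ)).rTensor H
        (π.alg.toLinearMap.lTensor A z)) := by
    intro z
    induction z with
    | zero => simp
    | add x y hx hy => simp only [map_add, hx, hy]
    | tmul x y =>
      simp only [LinearMap.lTensor_tmul, LinearMap.rTensor_tmul]
      induction Coalgebra.comul (R := ℂ) x with
      | zero => simp
      | add x y hx hy => simp only [map_add, add_tmul, hx, hy]
      | tmul x y => simp
  have e3 : π.alg.toLinearMap.lTensor A (Coalgebra.comul (R := ℂ) a) = a ⊗ₜ[ℂ] (1 : H) := ha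
  rw [e1, ← Coalgebra.coassoc_apply, e2, e3, LinearMap.rTensor_tmul, sub_self]

/-- `B = A^{co H}` is a left `A`-comodule star-algebra via the coproduct. -/
instance : ComoduleStarAlgebra A (coinvariants π) :=
  letI : LeftComodule A A := regularComodule
  letI c : LeftComodule A (coinvariants π) := restrictComodule (coinvSub π) (comul_mem_range π)
  have key : ∀ b : coinvariants π, (coinvSub π).subtype.lTensor A (c.coact b) =
      Coalgebra.comul (R := ℂ) (b : A) := fun b =>
    lTensor_restrictCoact _ (coinvSub π) (comul_mem_range π) b
  have inj := lTensor_subtype_injective (A := A) (coinvSub π)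
  { toLeftComodule := c
    coact_one := inj (by
      refine (key 1).trans ?_
      exact Bialgebra.comul_one)
    coact_mul := fun x y => inj (by
      refine (key (x * y)).trans ?_
      change Coalgebra.comul (R := ℂ) ((x : A) * (y : A)) = _
      rw [Bialgebra.comul_mul, ← key, ← key]
      induction c.coact x with
      | zero => simp
      | add p q hp hq => simp only [map_add, add_mul, hp, hq]
      | tmul p q =>
        induction c.coact y with
        | zero => simp
        | add p q hp hq => simp only [map_add, mul_add, hp, hq]
        | tmul r s =>
          rw [LinearMap.lTensor_tmul, LinearMap.lTensor_tmul,
            Algebra.TensorProduct.tmul_mul_tmul, Algebra.TensorProduct.tmul_mul_tmul]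
          rfl)
    coact_star := fun x => inj (by
      refine (key (star x)).trans ?_
      change Coalgebra.comul (R := ℂ) (star (x : A)) = _
      rw [HopfStarAlgebra.comul_star, ← key]
      induction c.coact x with
      | zero => simp
      | add p q hp hq => simp only [map_add, star_add, hp, hq]
      | tmul p q => rfl) }

theorem lTensor_coact_coinvariants (b : coinvariants π) :
    (coinvSub π).subtype.lTensor A (coact A b : A ⊗[ℂ] coinvariants π) = Coalgebra.comul (R := ℂ) (b : A) :=
  letI : LeftComodule A A := regularComodule
  lTensor_restrictCoact _ (coinvSub π) (comul_mem_range π) b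

/-- `A` as a right module over `B = A^{co H}`, by multiplication. -/
instance rightRegular : Module (coinvariants π)ᵐᵒᵖ A :=
  Module.compHom A (RingHom.op (coinvariants π).subtype.toAlgHom.toRingHom)

/-- `B = A^{co H}` is a quantum homogeneous space: `π` is surjective, and `A` is faithfully flat
as a right `B`-module. -/
def IsQuantumHomogeneousSpace : Prop :=
  Function.Surjective π.toBialgHom ∧ FaithfullyFlatRight (coinvariants π) A

section Takeuchi

variable {π}
variable (M N : RelHopfModule A (coinvariants π))

/-- `B⁺ M`, where `B⁺ = B ∩ ker ε`. -/
def plusLeft : Submodule ℂ M :=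
  Submodule.span ℂ {x | ∃ (b : coinvariants π) (m : M),
    Coalgebra.counit (R := ℂ) (b : A) = 0 ∧ x = b • m}

/-- `M B⁺`, where `B⁺ = B ∩ ker ε`. -/
def plusRight : Submodule ℂ M :=
  Submodule.span ℂ {x | ∃ (b : coinvariants π) (m : M),
    Coalgebra.counit (R := ℂ) (b : A) = 0 ∧ x = op b • m}

/-- `M` is finitely generated as a left `B`-module and `M B⁺ = B⁺ M`. -/
def IsModZero : Prop :=
  Module.Finite (coinvariants π) M ∧ plusRight M = plusLeft M

/-- `Φ(M) = M / B⁺ M`. -/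
def Φ : Type u := M ⧸ plusLeft M

instance : AddCommGroup (Φ M) := inferInstanceAs (AddCommGroup (M ⧸ plusLeft M))
instance : Module ℂ (Φ M) := inferInstanceAs (Module ℂ (M ⧸ plusLeft M))

/-- The class `[m] ∈ Φ(M)` of `m ∈ M`. -/
def Φ.mk : M →ₗ[ℂ] Φ M := (plusLeft M).mkQ

variable {M N}

theorem Φ.mk_surjective : Function.Surjective (Φ.mk M) := (plusLeft M).mkQ_surjective

theorem Φ.mk_eq_zero {m : M} : Φ.mk M m = 0 ↔ m ∈ plusLeft M :=
  Submodule.Quotient.mk_eq_zero _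

theorem counit_sub_mem (b : coinvariants π) : Coalgebra.counit (R := ℂ)
    ((b - algebraMap ℂ (coinvariants π) (Coalgebra.counit (R := ℂ) (b : A)) :
      coinvariants π) : A) = 0 := by
  change Coalgebra.counit (R := ℂ)
    ((b : A) - algebraMap ℂ A (Coalgebra.counit (R := ℂ) (b : A))) = 0
  rw [map_sub, Bialgebra.counit_algebraMap]
  simp

theorem Φ.mk_smul (b : coinvariants π) (m : M) :
    Φ.mk M (b • m) = Coalgebra.counit (R := ℂ) (b : A) • Φ.mk M m := by
  rw [← map_smul, ← sub_eq_zero, ← map_sub, Φ.mk_eq_zero]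
  refine Submodule.subset_span ⟨_, m, counit_sub_mem b, ?_⟩
  rw [sub_smul, algebraMap_smul]

/-- The linear map `Φ(M) → P` induced by a (semi)linear map which kills `B⁺ M`. -/
def Φ.lift {σ : ℂ →+* ℂ} {P : Type*} [AddCommGroup P] [Module ℂ P] (f : M →ₛₗ[σ] P)
    (h : ∀ (b : coinvariants π) (m : M), Coalgebra.counit (R := ℂ) (b : A) = 0 →
      f (b • m) = 0) : Φ M →ₛₗ[σ] P :=
  (plusLeft M).liftQ f (by
    rw [plusLeft, Submodule.span_le]
    rintro _ ⟨b, m, hb, rfl⟩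
    exact h b m hb)

@[simp] theorem Φ.lift_mk {σ : ℂ →+* ℂ} {P : Type*} [AddCommGroup P] [Module ℂ P]
    (f : M →ₛₗ[σ] P) (h : ∀ (b : coinvariants π) (m : M),
      Coalgebra.counit (R := ℂ) (b : A) = 0 → f (b • m) = 0) (m : M) :
    Φ.lift f h (Φ.mk M m) = f m := rfl

theorem Φ.alg_coinvariant (b : coinvariants π) :
    π.alg (b : A) = Coalgebra.counit (R := ℂ) (b : A) • (1 : H) := by
  have h : π.alg.toLinearMap.lTensor A (Coalgebra.comul (R := ℂ) (b : A)) =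
    (b : A) ⊗ₜ[ℂ] (1 : H) := b.2
  have h2 := congrArg (fun z => TensorProduct.lid ℂ H
    ((Coalgebra.counit (R := ℂ) (A := A)).rTensor H z)) h
  have e : ∀ z : A ⊗[ℂ] A, (Coalgebra.counit (R := ℂ) (A := A)).rTensor H
      (π.alg.toLinearMap.lTensor A z) =
      π.alg.toLinearMap.lTensor ℂ ((Coalgebra.counit (R := ℂ) (A := A)).rTensor A z) := by
    intro z
    induction z with
    | zero => simp
    | add x y hx hy => simp only [map_add, hx, hy]
    | tmul x y => simp
  simpa [e] using h2

variable (M) in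
/-- `m ↦ π(m₍₋₁₎) ⊗ [m₍₀₎]`. -/
def Φ.preCoact : M →ₗ[ℂ] H ⊗[ℂ] Φ M :=
  TensorProduct.map π.alg.toLinearMap (Φ.mk M) ∘ₗ coact A

theorem Φ.preCoact_smul (b : coinvariants π) (m : M) :
    Φ.preCoact M (b • m) = Coalgebra.counit (R := ℂ) (b : A) • Φ.preCoact M m := by
  have e : ∀ (x : A ⊗[ℂ] coinvariants π) (y : A ⊗[ℂ] M),
      TensorProduct.map π.alg.toLinearMap (Φ.mk M) (diagL x y) =
      (LinearMap.mul ℂ H (LinearMap.mul' ℂ H (TensorProduct.map π.alg.toLinearMap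
        (Algebra.linearMap ℂ H ∘ₗ Coalgebra.counit (R := ℂ) (A := A))
        ((coinvSub π).subtype.lTensor A x)))).rTensor (Φ M)
          (TensorProduct.map π.alg.toLinearMap (Φ.mk M) y) := by
    intro x y
    induction x with
    | zero => simp
    | add p q hp hq =>
      simp only [map_add, LinearMap.add_apply, LinearMap.rTensor_add, hp, hq]
    | tmul a b =>
      induction y with
      | zero => simp
      | add p q hp hq => simp only [map_add, hp, hq]
      | tmul c m =>
        simp only [diagL_tmul, map_tmul, LinearMap.lTensor_tmul, LinearMap.mul'_apply,
          LinearMap.rTensor_tmul, LinearMap.mul_apply',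
          Φ.mk_smul, AlgHom.toLinearMap_apply, map_mul, LinearMap.comp_apply,
          Algebra.linearMap_apply, Submodule.subtype_apply, Algebra.algebraMap_eq_smul_one,
          mul_one, smul_mul_assoc, tmul_smul, smul_tmul']
  change TensorProduct.map π.alg.toLinearMap (Φ.mk M) (coact A (b • m)) =
    _ • TensorProduct.map π.alg.toLinearMap (Φ.mk M) (coact A m)
  rw [M.coact_smul, e, lTensor_coact_coinvariants]
  have e2 : ∀ x : A ⊗[ℂ] A, LinearMap.mul' ℂ H (TensorProduct.map π.alg.toLinearMap
        (Algebra.linearMap ℂ H ∘ₗ Coalgebra.counit (R := ℂ) (A := A)) x) =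
      π.alg (TensorProduct.rid ℂ A ((Coalgebra.counit (R := ℂ) (A := A)).lTensor A x)) := by
    intro x
    induction x with
    | zero => simp
    | add p q hp hq => simp only [map_add, hp, hq]
    | tmul a b => simp [Algebra.algebraMap_eq_smul_one]
  rw [e2, Coalgebra.lTensor_counit_comul, TensorProduct.rid_tmul, one_smul, Φ.alg_coinvariant]
  induction TensorProduct.map π.alg.toLinearMap (Φ.mk M) (coact A m) with
  | zero => simp
  | add p q hp hq => simp only [map_add, smul_add, hp, hq]
  | tmul h v => simp [smul_tmul']

/-- The left `H`-coaction `[m] ↦ π(m₍₋₁₎) ⊗ [m₍₀₎]` on `Φ(M)`. -/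
instance : LeftComodule H (Φ M) where
  coact := Φ.lift (Φ.preCoact M) (fun b m hb => by rw [Φ.preCoact_smul, hb, zero_smul])
  coassoc v := by
    obtain ⟨m, rfl⟩ := Φ.mk_surjective v
    have e1 : ∀ z : A ⊗[ℂ] M, TensorProduct.assoc ℂ H H (Φ M)
        ((Coalgebra.comul (R := ℂ) (A := H)).rTensor (Φ M)
          (TensorProduct.map π.alg.toLinearMap (Φ.mk M) z)) =
        TensorProduct.map π.alg.toLinearMap (TensorProduct.map π.alg.toLinearMap (Φ.mk M))
          (TensorProduct.assoc ℂ A A M ((Coalgebra.comul (R := ℂ) (A := A)).rTensor M z)) := by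
      intro z
      induction z with
      | zero => simp
      | add p q hp hq => simp only [map_add, hp, hq]
      | tmul a m =>
        simp only [map_tmul, LinearMap.rTensor_tmul, AlgHom.toLinearMap_apply, π.comul_alg]
        induction Coalgebra.comul (R := ℂ) a with
        | zero => simp
        | add p q hp hq => simp only [map_add, add_tmul, hp, hq]
        | tmul p q => simp
    have e2 : ∀ z : A ⊗[ℂ] M,
        (Φ.lift (Φ.preCoact M) (fun b m hb => by rw [Φ.preCoact_smul, hb, zero_smul])).lTensor H
          (TensorProduct.map π.alg.toLinearMap (Φ.mk M) z) =
        TensorProduct.map π.alg.toLinearMap (TensorProduct.map π.alg.toLinearMap (Φ.mk M))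
          ((coact A).lTensor A z) := by
      intro z
      induction z with
      | zero => simp
      | add p q hp hq => simp only [map_add, hp, hq]
      | tmul a m => rfl
    rw [Φ.lift_mk]
    change TensorProduct.assoc ℂ H H (Φ M) ((Coalgebra.comul (R := ℂ) (A := H)).rTensor (Φ M)
      (TensorProduct.map π.alg.toLinearMap (Φ.mk M) (coact A m))) = LinearMap.lTensor H _
      (TensorProduct.map π.alg.toLinearMap (Φ.mk M) (coact A m))
    rw [e1, e2]
    exact congrArg _ (LeftComodule.coassoc m)
  counit v := by
    obtain ⟨m, rfl⟩ := Φ.mk_surjective v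
    have e1 : ∀ z : A ⊗[ℂ] M, TensorProduct.lid ℂ (Φ M)
        ((Coalgebra.counit (R := ℂ) (A := H)).rTensor (Φ M)
          (TensorProduct.map π.alg.toLinearMap (Φ.mk M) z)) =
        Φ.mk M (TensorProduct.lid ℂ M
          ((Coalgebra.counit (R := ℂ) (A := A)).rTensor M z)) := by
      intro z
      induction z with
      | zero => simp
      | add p q hp hq => simp only [map_add, hp, hq]
      | tmul a m => simp [π.counit_alg]
    rw [Φ.lift_mk]
    exact (e1 _).trans (congrArg _ (LeftComodule.counit m))

/-- The functor `Φ` on morphisms. -/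
def Φ.map (f : BimodHom M N) : Φ M →ₗ[ℂ] Φ N :=
  Φ.lift (Φ.mk N ∘ₗ f.1) (fun b m hb => by
    rw [LinearMap.comp_apply, f.2.1, Φ.mk_smul, hb, zero_smul])

/-- The identification `Φ(B) → ℂ`, `[b] ↦ ε(b)`. -/
def Φ.unitMap : Φ (RelHopfModule.unit A (coinvariants π)) →ₗ[ℂ] ℂ :=
  Φ.lift (Coalgebra.counit (R := ℂ) (A := A) ∘ₗ (coinvSub π).subtype ∘ₗ
      (unitVal A : _ ≃ₗ[ℂ] coinvariants π).toLinearMap)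
    (fun b m hb => by
      change Coalgebra.counit (R := ℂ) ((b : A) * ((unitVal A m : coinvariants π) : A)) = 0
      rw [Bialgebra.counit_mul, hb, zero_mul])

theorem Φ.mk_op_smul (hM : plusRight M = plusLeft M) (b : coinvariants π) (m : M) :
    Φ.mk M (op b • m) = Coalgebra.counit (R := ℂ) (b : A) • Φ.mk M m := by
  rw [← map_smul, ← sub_eq_zero, ← map_sub, Φ.mk_eq_zero, ← hM]
  refine Submodule.subset_span ⟨_, m, counit_sub_mem b, ?_⟩
  rw [op_sub, sub_smul]
  congr 1
  exact (algebraMap_smul (coinvariants π)ᵐᵒᵖ _ m).symm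

/-- The monoidal structure `Φ(M) ⊗ Φ(N) → Φ(M ⊗_B N)`, `[m] ⊗ [n] ↦ [m ⊗_B n]`, of `Φ`. -/
def Φ.mul (M N : RelHopfModule A (coinvariants π)) (hM : plusRight M = plusLeft M) :
    Φ M ⊗[ℂ] Φ N →ₗ[ℂ] Φ (M.tensor N) :=
  TensorProduct.lift (Φ.lift
    ((Φ.lift (LinearMap.flip (((TensorProduct.mk ℂ M N).compr₂
        (balMk (coinvariants π))).compr₂ (Φ.mk (M.tensor N))))
      (fun b n hb => by
        refine LinearMap.ext fun m => ?_
        change Φ.mk (M.tensor N) (balMk (coinvariants π) (m ⊗ₜ[ℂ] (b • n))) = 0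
        have h : op b • m ∈ plusLeft M := by
          rw [← Φ.mk_eq_zero, Φ.mk_op_smul hM, hb, zero_smul]
        rw [← balMk_balanced]
        refine Submodule.span_induction (p := fun x _ => Φ.mk (M.tensor N)
          (balMk (coinvariants π) (x ⊗ₜ[ℂ] n)) = 0) ?_ ?_ ?_ ?_ h
        · rintro _ ⟨c, m', hc, rfl⟩
          have := Φ.mk_smul (M := M.tensor N) c (tmulB m' n)
          rw [hc, zero_smul] at this
          exact this
        · rw [zero_tmul, map_zero]; exact map_zero _
        · intro x y _ _ hx hy
          rw [add_tmul, map_add]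
          exact (map_add _ _ _).trans (by rw [hx, hy, add_zero])
        · intro c x _ hx
          rw [← smul_tmul', map_smul]
          exact (map_smul _ _ _).trans (by rw [hx, smul_zero]))).flip)
    (fun b m hb => by
      refine LinearMap.ext fun v => ?_
      obtain ⟨n, rfl⟩ := Φ.mk_surjective v
      have := Φ.mk_smul (M := M.tensor N) b (tmulB m n)
      rw [hb, zero_smul] at this
      exact this))

theorem Φ.mul_tmul (hM : plusRight M = plusLeft M) (m : M) (n : N) :
    Φ.mul M N hM (Φ.mk M m ⊗ₜ Φ.mk N n) = Φ.mk (M.tensor N) (tmulB m n) := rfl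

end Takeuchi

/-! ### Invariant inner products and the metrics of a complex structure -/

/-- `(a, b) ↦ a b*`. -/
def mulStar (H : Type u) [Ring H] [HopfAlgebra ℂ H] [StarRing H] [StarModule ℂ H] :
    H →ₗ[ℂ] H →ₛₗ[starRingEnd ℂ] H :=
  LinearMap.mk₂'ₛₗ (RingHom.id ℂ) (starRingEnd ℂ) (fun a b => a * star b)
    (fun a a' b => add_mul a a' _) (fun c a b => smul_mul_assoc c a _)
    (fun a b b' => by rw [star_add, mul_add])
    (fun c a b => by rw [star_smul, mul_smul_comm]; rfl)

/-- `H`-invariant inner products on a left `H`-comodule `V`, conjugate-linear on the right;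
invariance is `v₍₋₁₎ w₍₋₁₎* ⟨v₍₀₎, w₍₀₎⟩ = ⟨v, w⟩ 1`. -/
structure InvariantInner (H V : Type u) [Ring H] [HopfAlgebra ℂ H] [StarRing H] [StarModule ℂ H]
    [AddCommGroup V] [Module ℂ V] [LeftComodule H V] where
  form : V →ₗ[ℂ] V →ₛₗ[starRingEnd ℂ] ℂ
  conj_symm : ∀ v w, form v w = starRingEnd ℂ (form w v)
  pos : ∀ v, v ≠ 0 → 0 < (form v v).re
  invariant : ∀ v w, TensorProduct.rid ℂ H
    (TensorProduct.map₂ (mulStar H) form (coact H v) (coact H w)) = form v w • (1 : H)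

/-- A basis `v` is orthonormal for the inner product. -/
def InvariantInner.IsOrthonormal {V : Type u} [AddCommGroup V] [Module ℂ V] [LeftComodule H V]
    (ip : InvariantInner H V) {n : ℕ} (v : Module.Basis (Fin n) ℂ V) : Prop :=
  ∀ i j, ip.form (v i) (v j) = if i = j then 1 else 0

theorem counit_star (a : A) :
    Coalgebra.counit (R := ℂ) (star a) = starRingEnd ℂ (Coalgebra.counit (R := ℂ) a) := by
  let e : A →ₗ[ℂ] ℂ :=
    { toFun := fun a => starRingEnd ℂ (Coalgebra.counit (R := ℂ) (star a))
      map_add' := fun a b => by simp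
      map_smul' := fun c a => by simp }
  have h1 : ∀ z : A ⊗[ℂ] A, TensorProduct.lid ℂ A (e.rTensor A z) =
      star (TensorProduct.lid ℂ A ((Coalgebra.counit (R := ℂ) (A := A)).rTensor A (star z))) := by
    intro z
    induction z with
    | zero => simp
    | add x y hx hy => simp only [map_add, star_add, hx, hy]
    | tmul x y => simp [e]
  have h2 : ∀ a : A, TensorProduct.lid ℂ A (e.rTensor A (Coalgebra.comul (R := ℂ) a)) = a := by
    intro a
    rw [h1, ← HopfStarAlgebra.comul_star]
    simp
  have h3 : ∀ z : A ⊗[ℂ] A, Coalgebra.counit (R := ℂ) (TensorProduct.lid ℂ A (e.rTensor A z)) =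
      e (TensorProduct.rid ℂ A ((Coalgebra.counit (R := ℂ) (A := A)).lTensor A z)) := by
    intro z
    induction z with
    | zero => simp
    | add x y hx hy => simp only [map_add, hx, hy]
    | tmul x y => simp [mul_comm]
  have h4 : Coalgebra.counit (R := ℂ) a = e a := by
    have := h3 (Coalgebra.comul (R := ℂ) a)
    rw [h2] at this
    simpa using this
  rw [h4]
  simp [e]

section Retract

variable {π} {M N : RelHopfModule A (coinvariants π)}

theorem BimodHom.plusLeft_le (f : BimodHom M N) : plusLeft M ≤ (plusLeft N).comap f.1 := by
  rw [plusLeft, Submodule.span_le]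
  rintro _ ⟨b, m, hb, rfl⟩
  exact Submodule.subset_span ⟨b, f.1 m, hb, f.2.1 b m⟩

theorem BimodHom.plusRight_le (f : BimodHom M N) : plusRight M ≤ (plusRight N).comap f.1 := by
  rw [plusRight, Submodule.span_le]
  rintro _ ⟨b, m, hb, rfl⟩
  exact Submodule.subset_span ⟨b, f.1 m, hb, f.2.2 b m⟩

theorem plus_eq_of_retract (f : BimodHom M N) (g : BimodHom N M) (h : ∀ m, g.1 (f.1 m) = m)
    (hN : plusRight N = plusLeft N) : plusRight M = plusLeft M := by
  apply le_antisymm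
  · intro m hm
    have := BimodHom.plusRight_le f hm
    rw [Submodule.mem_comap, hN] at this
    simpa [h] using BimodHom.plusLeft_le g this
  · intro m hm
    have := BimodHom.plusLeft_le f hm
    rw [Submodule.mem_comap, ← hN] at this
    simpa [h] using BimodHom.plusRight_le g this

end Retract

namespace CovariantComplexStructure

variable {π} (C : CovariantComplexStructure A (coinvariants π))

theorem proj_incl (p q : ℕ) (ω : C.biforms (p, q)) :
    (C.proj (p + q) (p, q)).1 ((C.incl p q).1 ω) = ω :=
  C.biVal_injective _ (DirectSum.decompose_of_mem_same C.bi (C.biVal_mem ω))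

variable {C}

theorem plus_eq (hΩ : IsModZero C.Ω1) {p q : ℕ} (h : p + q = 1) :
    plusRight (C.biforms (p, q)) = plusLeft (C.biforms (p, q)) := by
  refine plus_eq_of_retract (C.incl p q) (C.proj (p + q) (p, q)) (C.proj_incl p q) ?_
  rw [h]
  exact hΩ.2

/-- The conjugate-linear map `Φ(Ω^{(p,q)}) → Φ(Ω^{(q,p)})`, `[ω] ↦ [ω*]`, for `p + q = 1`. -/
def starΦ (hΩ : IsModZero C.Ω1) {p q : ℕ} (h : p + q = 1) :
    Φ (C.biforms (p, q)) →ₛₗ[starRingEnd ℂ] Φ (C.biforms (q, p)) :=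
  Φ.lift ((Φ.mk (C.biforms (q, p))).comp (C.starBi p q)) (fun b ω hb => by
    rw [LinearMap.comp_apply, C.starBi_smul,
      Φ.mk_op_smul (plus_eq hΩ ((add_comm q p).trans h))]
    have : Coalgebra.counit (R := ℂ) ((star b : coinvariants π) : A) = 0 := by
      rw [StarMemClass.coe_star, counit_star, hb, map_zero]
    rw [this, zero_smul])

/-- The evaluation `V^{(p,q)} ⊗ V^{(q,p)} → ℂ`, `[ω] ⊗ [η] ↦ ⟨[ω], [η*]⟩`, for `p + q = 1`. -/
def evV (hΩ : IsModZero C.Ω1) {p q : ℕ} (h : p + q = 1)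
    (ip : InvariantInner H (Φ (C.biforms (p, q)))) :
    Φ (C.biforms (p, q)) ⊗[ℂ] Φ (C.biforms (q, p)) →ₗ[ℂ] ℂ :=
  TensorProduct.lift (LinearMap.mk₂ ℂ
    (fun v w => ip.form v (starΦ hΩ ((add_comm q p).trans h) w))
    (fun v v' w => by rw [map_add, LinearMap.add_apply])
    (fun c v w => by rw [map_smul, LinearMap.smul_apply])
    (fun v w w' => by rw [map_add, map_add])
    (fun c v w => by rw [map_smulₛₗ, map_smulₛₗ, Complex.conj_conj]))

/-- The value at `1` of the coevaluation `ℂ → V^{(q,p)} ⊗ V^{(p,q)}`, `1 ↦ ∑ vᵢ* ⊗ vᵢ`,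
for a basis `v` of `V^{(p,q)}`, where `[ω]* = [ω*]`. -/
def coevV (hΩ : IsModZero C.Ω1) {p q : ℕ} (h : p + q = 1) {n : ℕ}
    (v : Module.Basis (Fin n) ℂ (Φ (C.biforms (p, q)))) :
    Φ (C.biforms (q, p)) ⊗[ℂ] Φ (C.biforms (p, q)) :=
  ∑ i, starΦ hΩ h (v i) ⊗ₜ[ℂ] v i

/-- `e : Ω^{(p,q)} ⊗_B Ω^{(q,p)} → B` is a morphism of relative Hopf modules and `Φ(e)` is the
evaluation `evV` of the inner product. -/
def IsPairing (hΩ : IsModZero C.Ω1) {p q : ℕ} (h : p + q = 1)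
    (ip : InvariantInner H (Φ (C.biforms (p, q))))
    (e : BimodHom ((C.biforms (p, q)).tensor (C.biforms (q, p)))
      (RelHopfModule.unit A (coinvariants π))) : Prop :=
  IsCovariant A e.1 ∧
    ∀ x, Φ.unitMap (Φ.map e (Φ.mul _ _ (plus_eq hΩ h) x)) = evV hΩ h ip x

/-- `c : B → Ω^{(q,p)} ⊗_B Ω^{(p,q)}` is a morphism of relative Hopf modules and `Φ(c)` is the
coevaluation `1 ↦ ∑ vᵢ* ⊗ vᵢ`, where `v` is an orthonormal basis of `V^{(p,q)}`. -/
def IsCoevaluation (hΩ : IsModZero C.Ω1) {p q : ℕ} (h : p + q = 1)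
    (ip : InvariantInner H (Φ (C.biforms (p, q))))
    (c : BimodHom (RelHopfModule.unit A (coinvariants π))
      ((C.biforms (q, p)).tensor (C.biforms (p, q)))) : Prop :=
  IsCovariant A c.1 ∧
    ∃ (n : ℕ) (v : Module.Basis (Fin n) ℂ (Φ (C.biforms (p, q)))), ip.IsOrthonormal v ∧
      Φ.map c (Φ.mk _ ((unitVal A).symm 1)) =
        Φ.mul _ _ (plus_eq hΩ ((add_comm q p).trans h)) (coevV hΩ h v)

variable (C)

/-- `e10 ⊕ (-λ⁻¹) e01 ⊕ 0 ⊕ 0 : Ω¹ ⊗_B Ω¹ → B`, with respect to the decomposition of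
`Ω¹ ⊗_B Ω¹` into the four subspaces `Ω^{(p,q)} ⊗_B Ω^{(p',q')}`. -/
def pairing (l : ℝ)
    (e10 : BimodHom (C.Ω10.tensor C.Ω01) (RelHopfModule.unit A (coinvariants π)))
    (e01 : BimodHom (C.Ω01.tensor C.Ω10) (RelHopfModule.unit A (coinvariants π))) :
    BimodHom (C.Ω1.tensor C.Ω1) (RelHopfModule.unit A (coinvariants π)) :=
  BimodHom.comp e10 (BimodHom.tensor (C.proj 1 (1, 0)) (C.proj 1 (0, 1))) +
    ((-l⁻¹ : ℝ) : ℂ) • BimodHom.comp e01 (BimodHom.tensor (C.proj 1 (0, 1)) (C.proj 1 (1, 0)))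

/-- The inclusion `Ω^{(1,0)} → Ω¹`. -/
def incl10 : BimodHom C.Ω10 C.Ω1 := C.incl 1 0

/-- The inclusion `Ω^{(0,1)} → Ω¹`. -/
def incl01 : BimodHom C.Ω01 C.Ω1 := C.incl 0 1

/-- `c10 ⊕ (-λ) c01 ⊕ 0 ⊕ 0 : B → Ω¹ ⊗_B Ω¹`. -/
def coevaluation (l : ℝ)
    (c10 : BimodHom (RelHopfModule.unit A (coinvariants π)) (C.Ω01.tensor C.Ω10))
    (c01 : BimodHom (RelHopfModule.unit A (coinvariants π)) (C.Ω10.tensor C.Ω01)) :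
    BimodHom (RelHopfModule.unit A (coinvariants π)) (C.Ω1.tensor C.Ω1) :=
  BimodHom.comp (BimodHom.tensor C.incl01 C.incl10) c10 +
    ((-l : ℝ) : ℂ) • BimodHom.comp (BimodHom.tensor C.incl10 C.incl01) c01

end CovariantComplexStructure

end HomogeneousSpace

end QuantumHomogeneous

end

open QuantumHomogeneous QuantumHomogeneous.CovariantComplexStructure

noncomputable section

open TensorProduct MulOpposite

set_option linter.unusedSectionVars false

namespace QuantumHomogeneous

/-! ### The Haar functional of a compact quantum group algebra -/

section Haar

variable {H : Type u} [Ring H] [HopfAlgebra ℂ H] [StarRing H] [StarModule ℂ H]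

/-! The functor `Φ` turns every assertion into one about finite-dimensional `H`-comodules, where it
is Hilbert space linear algebra. The evaluation `v ⊗ w ↦ ⟨v, w*⟩` is `H`-invariant because the inner
product is. The element `∑ vᵢ* ⊗ vᵢ` is `H`-coinvariant because the matrix of the coaction in an
orthonormal basis is unitary. The zigzag identities are the expansion `x = ∑ ⟨x, vᵢ⟩ vᵢ` and its
conjugate, and reality says that `x ⊗ y ↦ y* ⊗ x*` fixes `∑ vᵢ* ⊗ vᵢ`.

It remains to lift maps and equalities along `Φ`, and this is done by averaging. `H` has a Haar
functional `h` (`IsCQGAlgebra.exists_isHaar`), which gives a covariant, right `B`-linear projection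
`E(a) = a₍₁₎ h(π(a₍₂₎))` of `A` onto `B`. The map `a ⊗ [n] ↦ E(a S(n₍₋₁₎)) n₍₀₎` is a left inverse
of `n ↦ n₍₋₁₎ ⊗ [n₍₀₎]` (`reconstruct_coact`). Hence covariant maps and `A`-coinvariant elements are
determined by their images under `Φ` (`covariant_ext`, `coinvariant_ext`). The same formula lifts
each `H`-coinvariant class to an `A`-coinvariant element (`exists_coinvariant`).

The pairing is then `m ↦ m₍₋₁₎ φ([m₍₀₎])` for an invariant functional `φ` (`coextend`). The
coevaluation is `b ↦ b x` for a coinvariant `x`; this is a bimodule map since `x` commutes with `B`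
(`op_smul_eq_smul_of_coinvariant`), a consequence of `M B⁺ = B⁺ M`. In the metric the two mixed
summands of `Ω¹ ⊗_B Ω¹` do not interact, the weights `-λ` and `-λ⁻¹` cancel in the zigzags, and `λ`
is real, so `g† = g`.

The existence of `h` amounts to `1` lying outside the span of all `f(x₍₁₎) x₍₂₎ - f(1) x`. Each
element of this span comes from a single unitary corepresentation, where orthogonality for the
Hilbert–Schmidt inner product decides the matter (`IsUnitaryCorep.one_ne_sum`). -/

/-- Finite-dimensional unitary matrix corepresentations. -/
structure IsUnitaryCorep {ι : Type} [Fintype ι] [DecidableEq ι] (u : Matrix ι ι H) : Prop where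
  comul : ∀ i j, Coalgebra.comul (R := ℂ) (u i j) = ∑ k, u i k ⊗ₜ[ℂ] u k j
  counit : ∀ i j, Coalgebra.counit (R := ℂ) (u i j) = if i = j then 1 else 0
  conjTranspose_mul : u.conjTranspose * u = 1
  mul_conjTranspose : u * u.conjTranspose = 1

/-- This is `S(x₍₁₎) x₍₂₎ = ε(x) 1` read entrywise. Unitarity is not assumed, so that it can serve
to complete a one-sided unitarity relation in `IsOrthonormal.mul_coefficient`. -/
theorem map_antipode_mul {ι : Type} [Fintype ι] [DecidableEq ι] {u : Matrix ι ι H}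
    (hc : ∀ i j, Coalgebra.comul (R := ℂ) (u i j) = ∑ k, u i k ⊗ₜ[ℂ] u k j)
    (he : ∀ i j, Coalgebra.counit (R := ℂ) (u i j) = if i = j then 1 else 0) :
    u.map (HopfAlgebra.antipode ℂ) * u = 1 := by
  ext i j
  have h := HopfAlgebra.mul_antipode_rTensor_comul_apply (R := ℂ) (u i j)
  rw [hc, he] at h
  simp only [map_sum, LinearMap.rTensor_tmul, LinearMap.mul'_apply] at h
  rw [Matrix.mul_apply, Matrix.one_apply]
  simp only [Matrix.map_apply]
  rw [h]
  split_ifs <;> simp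

namespace IsUnitaryCorep

variable {ι κ : Type} [Fintype ι] [DecidableEq ι] [Fintype κ] [DecidableEq κ]
  {u : Matrix ι ι H} {w : Matrix κ κ H}

/-- `S(u)` is a left inverse of `u` and `u*` is a right inverse, so they coincide. -/
theorem antipode (hu : IsUnitaryCorep u) (i j : ι) :
    HopfAlgebra.antipode ℂ (u i j) = star (u j i) := by
  have h : u.map (HopfAlgebra.antipode ℂ) = u.conjTranspose := by
    rw [← Matrix.mul_one (u.map _), ← hu.mul_conjTranspose, ← Matrix.mul_assoc,
      map_antipode_mul hu.comul hu.counit, Matrix.one_mul]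
  exact congrFun (congrFun h i) j

theorem fromBlocks (hu : IsUnitaryCorep u) (hw : IsUnitaryCorep w) :
    IsUnitaryCorep (Matrix.fromBlocks u 0 0 w) where
  comul i j := by
    rcases i with i | i <;> rcases j with j | j <;>
      simp [Fintype.sum_sum_type, hu.comul, hw.comul]
  counit i j := by
    rcases i with i | i <;> rcases j with j | j <;> simp [hu.counit, hw.counit]
  conjTranspose_mul := by
    simp [Matrix.fromBlocks_conjTranspose, Matrix.fromBlocks_multiply, hu.conjTranspose_mul,
      hw.conjTranspose_mul]
  mul_conjTranspose := by
    simp [Matrix.fromBlocks_conjTranspose, Matrix.fromBlocks_multiply, hu.mul_conjTranspose,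
      hw.mul_conjTranspose]

end IsUnitaryCorep

/-- `c ↦ f(c₍₁₎) c₍₂₎`. -/
def convolve (f : H →ₗ[ℂ] ℂ) : H →ₗ[ℂ] H :=
  (TensorProduct.lid ℂ H).toLinearMap ∘ₗ f.rTensor H ∘ₗ Coalgebra.comul

theorem convolve_one (f : H →ₗ[ℂ] ℂ) : convolve f 1 = f 1 • (1 : H) := by
  simp [convolve, Algebra.TensorProduct.one_def]

/-! ### The Hilbert–Schmidt argument for one unitary corepresentation -/

section Matrix

variable {ι : Type} [Fintype ι] [DecidableEq ι] {u : Matrix ι ι H}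

theorem IsUnitaryCorep.convolve_apply (hu : IsUnitaryCorep u) (f : H →ₗ[ℂ] ℂ) (i j : ι) :
    convolve f (u i j) = ∑ k, f (u i k) • u k j := by
  simp [convolve, hu.comul]

/-- `T ↦ ∑ Tₖⱼ uₖⱼ`. -/
def coefficientMap (u : Matrix ι ι H) : EuclideanSpace ℂ (ι × ι) →ₗ[ℂ] H where
  toFun T := ∑ k, ∑ j, T (k, j) • u k j
  map_add' S T := by simp [add_smul, Finset.sum_add_distrib]
  map_smul' c T := by simp [mul_smul, Finset.smul_sum]

/-- The operator `T ↦ (∑ₖ f(uₖᵢ) Tₖⱼ)ᵢⱼ`. -/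
def coefficientAct (u : Matrix ι ι H) (f : H →ₗ[ℂ] ℂ) (T : EuclideanSpace ℂ (ι × ι)) :
    EuclideanSpace ℂ (ι × ι) :=
  WithLp.toLp 2 fun x => ∑ k, f (u k x.1) * T (k, x.2)

/-- `coefficientAct u f` lifts `convolve f` from matrix coefficients to matrices. In particular it
preserves the kernel of `coefficientMap u`. -/
theorem IsUnitaryCorep.coefficientMap_act (hu : IsUnitaryCorep u) (f : H →ₗ[ℂ] ℂ)
    (T : EuclideanSpace ℂ (ι × ι)) :
    coefficientMap u (coefficientAct u f T) = convolve f (coefficientMap u T) := by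
  simp only [coefficientMap, coefficientAct, LinearMap.coe_mk, AddHom.coe_mk, map_sum, map_smul,
    hu.convolve_apply, Finset.smul_sum, Finset.sum_smul, smul_smul]
  rw [Finset.sum_comm]
  conv_rhs => rw [Finset.sum_comm]
  refine Finset.sum_congr rfl fun j _ => ?_
  rw [Finset.sum_comm]
  simp only [mul_comm]

/-- The functional `x ↦ conj f(S(x)*)`. -/
def conjDual (f : H →ₗ[ℂ] ℂ) : H →ₗ[ℂ] ℂ where
  toFun x := starRingEnd ℂ (f (star (HopfAlgebra.antipode ℂ x)))
  map_add' x y := by simp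
  map_smul' c x := by simp

theorem IsUnitaryCorep.conjDual_apply (hu : IsUnitaryCorep u) (f : H →ₗ[ℂ] ℂ) (i j : ι) :
    conjDual f (u i j) = starRingEnd ℂ (f (u j i)) := by
  simp [conjDual, hu.antipode]

/-- The adjoint of the operator of `f` is again an operator of this family, that of `conjDual f`,
because `S(uᵢⱼ) = uⱼᵢ*`. A subspace stable under the whole family therefore has a stable orthogonal
complement. -/
theorem IsUnitaryCorep.inner_act (hu : IsUnitaryCorep u) (f : H →ₗ[ℂ] ℂ)
    (Z T : EuclideanSpace ℂ (ι × ι)) :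
    inner ℂ Z (coefficientAct u f T) = inner ℂ (coefficientAct u (conjDual f) Z) T := by
  simp only [PiLp.inner_apply, RCLike.inner_apply, coefficientAct, Fintype.sum_prod_type, map_sum,
    map_mul, hu.conjDual_apply, Complex.conj_conj, Finset.sum_mul, Finset.mul_sum]
  rw [Finset.sum_comm]
  conv_rhs => rw [Finset.sum_comm]
  refine Finset.sum_congr rfl fun j _ => ?_
  rw [Finset.sum_comm]
  refine Finset.sum_congr rfl fun k _ => Finset.sum_congr rfl fun i _ => ?_
  ring

/-- If `1` were such a sum, it would be represented by a matrix `T₀` whose component `T` orthogonal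
to the kernel of `coefficientMap u` is fixed by the corepresentation. Fixed matrices are orthogonal
to every matrix of the form of `T₀`, which forces `T = 0` although `T` represents `1`. -/
theorem IsUnitaryCorep.one_ne_sum (hu : IsUnitaryCorep u) (f : ι → ι → H →ₗ[ℂ] ℂ) :
    (1 : H) ≠ ∑ i, ∑ j, (convolve (f i j) (u i j) - f i j 1 • u i j) := by
  intro h
  -- The coefficients of `uₖⱼ` when the right-hand side is expanded with `convolve_apply`: `∑ᵢ
  -- fᵢⱼ(uᵢₖ) - fₖⱼ(1)`.
  let T₀ : EuclideanSpace ℂ (ι × ι) := WithLp.toLp 2 fun x =>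
    ∑ i, (f i x.2 (u i x.1) - if i = x.1 then f i x.2 1 else 0)
  have hT₀ : coefficientMap u T₀ = 1 := by
    rw [h]
    simp only [coefficientMap, LinearMap.coe_mk, AddHom.coe_mk, T₀, hu.convolve_apply,
      Finset.sum_smul, sub_smul, Finset.sum_sub_distrib]
    congr 1
    · rw [Finset.sum_comm]
      conv_rhs => rw [Finset.sum_comm]
      exact Finset.sum_congr rfl fun j _ => Finset.sum_comm
    · simp [ite_smul]
  let K := LinearMap.ker (coefficientMap u)
  obtain ⟨Z, hZ, T, hT, hZT⟩ := K.exists_add_mem_mem_orthogonal T₀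
  have hT1 : coefficientMap u T = 1 := by
    rw [hZT, map_add, LinearMap.mem_ker.1 hZ, zero_add] at hT₀
    exact hT₀
  -- The two sides have the same image under `coefficientMap u`, since `convolve g 1 = g(1) 1`.
  -- Their difference lies in `K` and in `Kᗮ`.
  have hact : ∀ g : H →ₗ[ℂ] ℂ, coefficientAct u g T = g 1 • T := by
    intro g
    have h1 : coefficientAct u g T ∈ Kᗮ := by
      intro Y hY
      rw [hu.inner_act]
      refine hT _ ?_
      rw [LinearMap.mem_ker, hu.coefficientMap_act, LinearMap.mem_ker.1 hY, map_zero]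
    have h2 : coefficientAct u g T - g 1 • T ∈ K := by
      rw [LinearMap.mem_ker, map_sub, hu.coefficientMap_act, map_smul, hT1, convolve_one, sub_self]
    have h3 : coefficientAct u g T - g 1 • T ∈ Kᗮ :=
      Submodule.sub_mem _ h1 (Submodule.smul_mem _ _ hT)
    rw [← sub_eq_zero]
    exact inner_self_eq_zero.1 (h3 _ h2)
  -- Linear functionals separate the points of `H`, so `hact` for all `g` becomes an identity in
  -- `H`.
  have hrow : ∀ i j, ∑ k, T (k, j) • u k i = T (i, j) • (1 : H) := by
    intro i j
    rw [← sub_eq_zero, ← Module.forall_dual_apply_eq_zero_iff ℂ]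
    intro g
    have := congrArg (fun Y : EuclideanSpace ℂ (ι × ι) => Y (i, j)) (hact g)
    simp only [coefficientAct, PiLp.smul_apply, smul_eq_mul] at this
    simp only [map_sub, map_sum, map_smul, smul_eq_mul, sub_eq_zero]
    rw [mul_comm, ← this]
    simp only [mul_comm]
  -- The adjoint of `hrow` says `u* t = t` for the conjugated column `t`; multiplying by `u` gives
  -- `u t = t`.
  have hcol : ∀ i j, ∑ k, starRingEnd ℂ (T (k, j)) • u i k = starRingEnd ℂ (T (i, j)) • (1 : H) := by
    intro i j
    let t : ι → H := fun k => starRingEnd ℂ (T (k, j)) • (1 : H)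
    have h1 : u.conjTranspose.mulVec t = t := by
      funext l
      have := congrArg star (hrow l j)
      simp only [star_sum, star_smul, star_one] at this
      simpa [Matrix.mulVec, dotProduct, t] using this
    have h2 : u.mulVec t = t := by
      conv_lhs => rw [← h1]
      rw [Matrix.mulVec_mulVec, hu.mul_conjTranspose, Matrix.one_mulVec]
    simpa [Matrix.mulVec, dotProduct, t] using congrFun h2 i
  -- After reordering, the inner product is the sum over `i, j` of `fᵢⱼ` applied to the difference
  -- of the two sides of `hcol`.
  have h0 : inner ℂ T T₀ = 0 := by
    simp only [PiLp.inner_apply, RCLike.inner_apply, Fintype.sum_prod_type, T₀, Finset.sum_mul]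
    rw [Finset.sum_comm]
    refine Finset.sum_eq_zero fun j _ => ?_
    rw [Finset.sum_comm]
    refine Finset.sum_eq_zero fun i _ => ?_
    have := congrArg (f i j) (hcol i j)
    simp only [map_sum, map_smul, smul_eq_mul] at this
    simp only [sub_mul, Finset.sum_sub_distrib, ite_mul, zero_mul, Finset.sum_ite_eq,
      Finset.mem_univ, if_true]
    rw [sub_eq_zero, mul_comm (f i j 1), ← this]
    simp only [mul_comm]
  -- `T₀ = Z + T` with `Z ∈ K` and `T ∈ Kᗮ`, so `⟨T, T₀⟩ = ⟨T, T⟩`.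
  rw [hZT, inner_add_right, Submodule.inner_left_of_mem_orthogonal hZ hT, zero_add,
    inner_self_eq_zero] at h0
  rw [h0, map_zero] at hT1
  have := congrArg (Coalgebra.counit (R := ℂ)) hT1
  simp at this

end Matrix

/-! ### Passage from one corepresentation to the whole algebra -/

/-- The elements of the form `∑ f(u₍₁₎) u₍₂₎ - f(1) u`, for matrix coefficients `u` of a unitary
corepresentation. -/
def IsHaarDefect (x : H) : Prop :=
  ∃ (ι : Type) (_ : Fintype ι) (_ : DecidableEq ι) (u : Matrix ι ι H) (f : ι → ι → H →ₗ[ℂ] ℂ),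
    IsUnitaryCorep u ∧ x = ∑ i, ∑ j, (convolve (f i j) (u i j) - f i j 1 • u i j)

theorem convolve_zero : convolve (0 : H →ₗ[ℂ] ℂ) = 0 := by
  simp [convolve]

theorem IsHaarDefect.add {x y : H} (hx : IsHaarDefect x) (hy : IsHaarDefect y) :
    IsHaarDefect (x + y) := by
  obtain ⟨ι, _, _, u, f, hu, rfl⟩ := hx
  obtain ⟨κ, _, _, w, g, hw, rfl⟩ := hy
  -- Two corepresentations are merged into their direct sum. The functionals vanish at the
  -- off-diagonal blocks, which is why a defect carries a whole family `f i j`.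
  refine ⟨ι ⊕ κ, inferInstance, inferInstance, Matrix.fromBlocks u 0 0 w,
    Sum.elim (fun i => Sum.elim (f i) 0) (fun i => Sum.elim 0 (g i)), hu.fromBlocks hw, ?_⟩
  simp [Fintype.sum_sum_type]
  abel

theorem IsHaarDefect.smul (c : ℂ) {x : H} (hx : IsHaarDefect x) : IsHaarDefect (c • x) := by
  obtain ⟨ι, _, _, u, f, hu, rfl⟩ := hx
  refine ⟨ι, inferInstance, inferInstance, u, fun i j => c • f i j, hu, ?_⟩
  have h : ∀ (f : H →ₗ[ℂ] ℂ) (x : H), convolve (c • f) x = c • convolve f x := by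
    intro f x
    simp [convolve, LinearMap.rTensor_smul]
  simp [Finset.smul_sum, smul_sub, h, mul_smul]

theorem isHaarDefect_zero : IsHaarDefect (0 : H) :=
  ⟨Empty, inferInstance, inferInstance, 0, 0,
    ⟨fun i => i.elim, fun i => i.elim, by ext i; exact i.elim, by ext i; exact i.elim⟩, by simp⟩

theorem IsCQGAlgebra.isHaarDefect (hH : IsCQGAlgebra H) (f : H →ₗ[ℂ] ℂ) (x : H) :
    IsHaarDefect (convolve f x - f 1 • x) := by
  have hx : x ∈ (⊤ : Submodule ℂ H) := Submodule.mem_top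
  rw [← hH.2] at hx
  induction hx using Submodule.span_induction with
  | zero => simpa using isHaarDefect_zero
  | add x y _ _ hx hy =>
    have := hx.add hy
    rwa [sub_add_sub_comm, ← map_add, ← smul_add] at this
  | smul c x _ hx =>
    have := hx.smul c
    rwa [smul_sub, ← map_smul, smul_comm] at this
  | mem x hx =>
    obtain ⟨n, u, h1, h2, h3, h4, i, j, rfl⟩ := hx
    -- The family is supported at the one entry `(i, j)`.
    refine ⟨Fin n, inferInstance, inferInstance, u, fun k l => if k = i then if l = j then f else 0
      else 0, ⟨h1, h2, h3, h4⟩, ?_⟩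
    rw [Finset.sum_eq_single i, Finset.sum_eq_single j]
    · simp
    · intro l _ hl; simp [hl, convolve_zero]
    · simp
    · intro k _ hk; simp [hk, convolve_zero]
    · simp

/-- A normalised invariant functional on a Hopf algebra. -/
structure IsHaar (h : H →ₗ[ℂ] ℂ) : Prop where
  map_one : h 1 = 1
  invariant : ∀ x, TensorProduct.rid ℂ H (h.lTensor H (Coalgebra.comul (R := ℂ) x)) = h x • (1 : H)

/-- A compact quantum group algebra has a Haar functional. -/
theorem IsCQGAlgebra.exists_isHaar (hH : IsCQGAlgebra H) : ∃ h : H →ₗ[ℂ] ℂ, IsHaar h := by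
  let K : Submodule ℂ H := Submodule.span ℂ {y | ∃ (f : H →ₗ[ℂ] ℂ) (x : H),
    y = convolve f x - f 1 • x}
  have hK : ∀ y ∈ K, IsHaarDefect y := by
    intro y hy
    induction hy using Submodule.span_induction with
    | zero => exact isHaarDefect_zero
    | add x y _ _ hx hy => exact hx.add hy
    | smul c x _ hx => exact hx.smul c
    | mem y hy =>
      obtain ⟨f, x, rfl⟩ := hy
      exact hH.isHaarDefect f x
  have h1 : (1 : H) ∉ K := by
    intro h
    obtain ⟨ι, _, _, u, f, hu, hf⟩ := hK 1 h
    exact hu.one_ne_sum f hf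
  -- A functional that kills `K` but not `1` satisfies `g(f(x₍₁₎) x₍₂₎) = f(1) g(x)` for all `f`.
  -- This is the invariance of `g` tested against `f`, and division by `g(1)` normalises it.
  obtain ⟨g, hg1, hgK⟩ := Submodule.exists_le_ker_of_notMem h1
  refine ⟨(g 1)⁻¹ • g, by simp [hg1], fun x => ?_⟩
  rw [← sub_eq_zero, ← Module.forall_dual_apply_eq_zero_iff ℂ]
  intro f
  have h2 : g (convolve f x - f 1 • x) = 0 := hgK (Submodule.subset_span ⟨f, x, rfl⟩)
  have h3 : ∀ z : H ⊗[ℂ] H, f (TensorProduct.rid ℂ H (((g 1)⁻¹ • g).lTensor H z)) =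
      (g 1)⁻¹ * g (TensorProduct.lid ℂ H (f.rTensor H z)) := by
    intro z
    induction z with
    | zero => simp
    | add x y hx hy => simp only [map_add, hx, hy, mul_add]
    | tmul x y => simp [-mul_eq_mul_left_iff]; ring
  rw [map_sub, h3, sub_eq_zero]
  rw [map_sub, sub_eq_zero] at h2
  change (g 1)⁻¹ * g (convolve f x) = _
  rw [h2]
  simp only [map_smul, smul_eq_mul, LinearMap.smul_apply]
  ring

end Haar

section Expectation

variable {A H : Type u} [Ring A] [HopfAlgebra ℂ A] [StarRing A] [StarModule ℂ A]
  [Ring H] [HopfAlgebra ℂ H] [StarRing H] [StarModule ℂ H] [HopfStarAlgebra A]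

/-! ### The conditional expectation onto the coinvariants -/

/-- `a ↦ a₍₁₎ h(π(a₍₂₎))`. -/
def expectationAux (π : HopfStarHom A H) (h : H →ₗ[ℂ] ℂ) : A →ₗ[ℂ] A :=
  (TensorProduct.rid ℂ A).toLinearMap ∘ₗ h.lTensor A ∘ₗ π.rightCoact.toLinearMap

variable {π : HopfStarHom A H} {h : H →ₗ[ℂ] ℂ}

theorem rightCoact_apply (a : A) :
    π.rightCoact a = π.alg.toLinearMap.lTensor A (Coalgebra.comul (R := ℂ) a) := rfl

theorem expectationAux_apply (a : A) : expectationAux π h a =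
    TensorProduct.rid ℂ A ((h ∘ₗ π.alg.toLinearMap).lTensor A (Coalgebra.comul (R := ℂ) a)) := by
  rw [LinearMap.lTensor_comp]
  rfl

/-- Coassociativity: `h ∘ π` is applied to the last leg only. This is the left `A`-covariance of
`E`, and it also reduces membership of `E(a)` in `B` to a computation of `π ∘ E`. -/
theorem comul_expectationAux (a : A) : Coalgebra.comul (R := ℂ) (expectationAux π h a) =
    (expectationAux π h).lTensor A (Coalgebra.comul (R := ℂ) a) := by
  let g : A ⊗[ℂ] A →ₗ[ℂ] A :=
    (TensorProduct.rid ℂ A).toLinearMap ∘ₗ (h ∘ₗ π.alg.toLinearMap).lTensor A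
  have e1 : ∀ z : A ⊗[ℂ] A, Coalgebra.comul (R := ℂ) (g z) =
      g.lTensor A (TensorProduct.assoc ℂ A A A
        ((Coalgebra.comul (R := ℂ) (A := A)).rTensor A z)) := by
    intro z
    induction z with
    | zero => simp
    | add x y hx hy => simp only [map_add, hx, hy]
    | tmul x y =>
      simp only [g, LinearMap.comp_apply, LinearEquiv.coe_coe, LinearMap.lTensor_tmul,
        TensorProduct.rid_tmul, LinearMap.rTensor_tmul, map_smul]
      induction Coalgebra.comul (R := ℂ) x with
      | zero => simp
      | add p q hp hq => simp only [map_add, add_tmul, smul_add, hp, hq]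
      | tmul p q => simp
  have e2 : expectationAux π h = g ∘ₗ Coalgebra.comul := LinearMap.ext expectationAux_apply
  rw [e2, LinearMap.lTensor_comp, LinearMap.comp_apply (LinearMap.lTensor A g),
    ← Coalgebra.coassoc_apply]
  exact e1 _

/-- Invariance of `h` gives `π(E(x)) = h(π(x)) 1`. Inserted in the second leg of `Δ(E(a)) = a₍₁₎ ⊗
E(a₍₂₎)`, it yields `E(a) ⊗ 1`. -/
theorem expectationAux_mem (hh : IsHaar h) (a : A) : expectationAux π h a ∈ coinvariants π := by
  rw [mem_coinvariants, rightCoact_apply, comul_expectationAux, ← LinearMap.comp_apply,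
    ← LinearMap.lTensor_comp]
  have e1 : ∀ x, π.alg (expectationAux π h x) = h (π.alg x) • (1 : H) := by
    intro x
    rw [← hh.invariant, π.comul_alg, expectationAux_apply]
    induction Coalgebra.comul (R := ℂ) x with
    | zero => simp
    | add p q hp hq => simp only [map_add, hp, hq]
    | tmul p q => simp
  rw [expectationAux_apply]
  induction Coalgebra.comul (R := ℂ) a with
  | zero => simp
  | add p q hp hq => simp only [map_add, add_tmul, hp, hq]
  | tmul p q => simp [e1, smul_tmul']

/-- The conditional expectation `E : A → A^{co H}`, `a ↦ a₍₁₎ h(π(a₍₂₎))`. -/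
def expectation (π : HopfStarHom A H) (hh : IsHaar h) : A →ₗ[ℂ] coinvariants π :=
  LinearMap.codRestrict (coinvSub π) (expectationAux π h) (expectationAux_mem hh)

theorem expectation_coe (hh : IsHaar h) (a : A) :
    (expectation π hh a : A) = expectationAux π h a := rfl

theorem expectation_one (hh : IsHaar h) : expectation π hh 1 = 1 := by
  apply Subtype.ext
  change TensorProduct.rid ℂ A (h.lTensor A (π.rightCoact 1)) = 1
  rw [map_one, Algebra.TensorProduct.one_def]
  simp [hh.map_one]

theorem expectation_mul (hh : IsHaar h) (a : A) (b : coinvariants π) :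
    expectation π hh (a * b) = expectation π hh a * b := by
  apply Subtype.ext
  change TensorProduct.rid ℂ A (h.lTensor A (π.rightCoact (a * b))) =
    TensorProduct.rid ℂ A (h.lTensor A (π.rightCoact a)) * b
  rw [map_mul, (mem_coinvariants π).1 b.2]
  induction π.rightCoact a with
  | zero => simp
  | add p q hp hq => simp only [map_add, add_mul, hp, hq]
  | tmul p q => simp

theorem coact_expectation (hh : IsHaar h) (a : A) :
    coact A (expectation π hh a) =
      (expectation π hh).lTensor A (Coalgebra.comul (R := ℂ) a) := by
  apply lTensor_subtype_injective (A := A) (coinvSub π)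
  refine (lTensor_coact_coinvariants π _).trans ((comul_expectationAux a).trans ?_)
  exact LinearMap.lTensor_comp_apply A (coinvSub π).subtype (expectation π hh) _

/-- This makes `E` computable after `Φ`, where `E(a)` acts as the scalar `h(π(a))`. -/
theorem counit_expectation (hh : IsHaar h) (a : A) :
    Coalgebra.counit (R := ℂ) (expectation π hh a : A) = h (π.alg a) := by
  rw [expectation_coe, expectationAux_apply]
  have e : ∀ z : A ⊗[ℂ] A, Coalgebra.counit (R := ℂ)
      (TensorProduct.rid ℂ A ((h ∘ₗ π.alg.toLinearMap).lTensor A z)) =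
      h (π.alg (TensorProduct.lid ℂ A ((Coalgebra.counit (R := ℂ) (A := A)).rTensor A z))) := by
    intro z
    induction z with
    | zero => simp
    | add p q hp hq => simp only [map_add, hp, hq]
    | tmul p q => simp [mul_comm]
  rw [e]
  simp

/-! ### Reconstruction of a relative Hopf module from `Φ`

Since `H` has a Haar functional, the unit `N → A ⊗ Φ(N)` has an explicit retraction built from the
conditional expectation `E`, so the faithful flatness of `A` over `B` is not needed here. -/

variable {M N : RelHopfModule A (coinvariants π)}

theorem Φ.coact_mk (m : M) :
    coact H (Φ.mk M m) = TensorProduct.map π.alg.toLinearMap (Φ.mk M) (coact A m) := rfl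

/-- `a ⊗ (c ⊗ n) ↦ E(a S(c)) n`. -/
def expectationAct (hh : IsHaar h) (N : RelHopfModule A (coinvariants π)) :
    A →ₗ[ℂ] A ⊗[ℂ] N →ₗ[ℂ] N :=
  LinearMap.mk₂ ℂ (fun a z => TensorProduct.lift
      (((Algebra.lsmul ℂ ℂ N : coinvariants π →ₐ[ℂ] _).toLinearMap ∘ₗ expectation π hh ∘ₗ
        LinearMap.mulLeft ℂ a ∘ₗ HopfAlgebra.antipode ℂ)) z)
    (fun a a' z => by
      induction z with
      | zero => simp
      | add p q hp hq => rw [map_add, hp, hq, map_add, map_add]; abel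
      | tmul p q => simp [add_mul])
    (fun c a z => by
      induction z with
      | zero => simp
      | add p q hp hq => rw [map_add, hp, hq, map_add, smul_add]
      | tmul p q => simp)
    (fun a z z' => map_add _ _ _)
    (fun c a z => map_smul _ _ _)

theorem expectationAct_tmul (hh : IsHaar h) (a c : A) (n : N) :
    expectationAct hh N a (c ⊗ₜ n) =
      expectation π hh (a * HopfAlgebra.antipode ℂ c) • n := rfl

/-- The antipode reverses products, so the coaction of `b n` produces `E(a S(n₍₋₁₎) S(b₍₁₎)) b₍₂₎
n₍₀₎`. Right `B`-linearity of `E` pulls `b₍₂₎` inside, where `S(b₍₁₎) b₍₂₎ = ε(b)`. Hence the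
expression depends only on the class of `n` in `Φ(N)`. -/
theorem expectationAct_coact_smul (hh : IsHaar h) (a : A) (b : coinvariants π) (n : N) :
    expectationAct hh N a (coact A (b • n)) =
      Coalgebra.counit (R := ℂ) (b : A) • expectationAct hh N a (coact A n) := by
  have e : ∀ (x : A ⊗[ℂ] coinvariants π) (y : A ⊗[ℂ] N),
      expectationAct hh N a (diagL x y) =
      TensorProduct.lift (((Algebra.lsmul ℂ ℂ N : coinvariants π →ₐ[ℂ] _).toLinearMap ∘ₗ
        expectation π hh ∘ₗ LinearMap.mulLeft ℂ a ∘ₗ LinearMap.mulRight ℂ (LinearMap.mul' ℂ A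
          ((HopfAlgebra.antipode ℂ).rTensor A ((coinvSub π).subtype.lTensor A x))) ∘ₗ
          HopfAlgebra.antipode ℂ)) y := by
    intro x y
    induction y with
    | zero => simp
    | add p q hp hq => simp only [map_add, hp, hq]
    | tmul d n =>
      induction x with
      | zero => simp
      | add p q hp hq =>
        rw [map_add, LinearMap.add_apply, map_add, hp, hq]
        simp [mul_add]
      | tmul c b' =>
        simp only [diagL_tmul, expectationAct_tmul, HopfAlgebra.antipode_mul_antidistrib, lift.tmul,
          LinearMap.comp_apply, LinearMap.lTensor_tmul, LinearMap.rTensor_tmul,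
          LinearMap.mul'_apply, LinearMap.mulLeft_apply, LinearMap.mulRight_apply,
          AlgHom.toLinearMap_apply, Algebra.lsmul_coe, Submodule.subtype_apply]
        rw [← mul_assoc, ← mul_smul, ← expectation_mul hh, mul_assoc, mul_assoc]
  rw [N.coact_smul, e, lTensor_coact_coinvariants, HopfAlgebra.mul_antipode_rTensor_comul_apply]
  induction coact A n with
  | zero => simp
  | add p q hp hq => simp only [map_add, smul_add, hp, hq]
  | tmul d n => simp [expectationAct_tmul, Algebra.algebraMap_eq_smul_one]

/-- The retraction `A ⊗ Φ(N) → N`, `a ⊗ [n] ↦ E(a S(n₍₋₁₎)) n₍₀₎`. -/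
def reconstruct (hh : IsHaar h) (N : RelHopfModule A (coinvariants π)) : A ⊗[ℂ] Φ N →ₗ[ℂ] N :=
  TensorProduct.lift
    { toFun := fun a => Φ.lift (expectationAct hh N a ∘ₗ coact A) (fun b m hb => by
        rw [LinearMap.comp_apply, expectationAct_coact_smul, hb, zero_smul])
      map_add' := fun a a' => by
        ext v
        obtain ⟨n, rfl⟩ := Φ.mk_surjective v
        simp
      map_smul' := fun c a => by
        ext v
        obtain ⟨n, rfl⟩ := Φ.mk_surjective v
        simp }

theorem reconstruct_tmul_mk (hh : IsHaar h) (a : A) (n : N) :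
    reconstruct hh N (a ⊗ₜ Φ.mk N n) = expectationAct hh N a (coact A n) := rfl

/-- `E(a n₍₋₂₎ S(n₍₋₁₎)) n₍₀₎ = E(a) n`. The case `a = 1` is the retraction property; general `a` is
needed to compute the coaction of `E(a) n`. -/
theorem reconstruct_mul_coact (hh : IsHaar h) (a : A) (n : N) :
    reconstruct hh N (TensorProduct.map (LinearMap.mulLeft ℂ a) (Φ.mk N) (coact A n)) =
      expectation π hh a • n := by
  have e1 : ∀ z : A ⊗[ℂ] N,
      reconstruct hh N (TensorProduct.map (LinearMap.mulLeft ℂ a) (Φ.mk N) z) =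
      TensorProduct.lift (expectationAct hh N ∘ₗ LinearMap.mulLeft ℂ a)
        ((coact A).lTensor A z) := by
    intro z
    induction z with
    | zero => simp
    | add p q hp hq => simp only [map_add, hp, hq]
    | tmul a n => rfl
  have e2 : ∀ z : A ⊗[ℂ] N,
      TensorProduct.lift (expectationAct hh N ∘ₗ LinearMap.mulLeft ℂ a)
        (TensorProduct.assoc ℂ A A N ((Coalgebra.comul (R := ℂ) (A := A)).rTensor N z)) =
      expectation π hh a •
        TensorProduct.lid ℂ N ((Coalgebra.counit (R := ℂ) (A := A)).rTensor N z) := by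
    intro z
    induction z with
    | zero => simp
    | add p q hp hq => simp only [map_add, smul_add, hp, hq]
    | tmul c n =>
      have e3 : ∀ w : A ⊗[ℂ] A,
          TensorProduct.lift (expectationAct hh N ∘ₗ LinearMap.mulLeft ℂ a)
            (TensorProduct.assoc ℂ A A N (w ⊗ₜ n)) =
          expectation π hh
            (a * LinearMap.mul' ℂ A ((HopfAlgebra.antipode ℂ).lTensor A w)) • n := by
        intro w
        induction w with
        | zero => simp
        | add p q hp hq => simp only [map_add, add_tmul, mul_add, add_smul, hp, hq]
        | tmul p q => simp [expectationAct_tmul, mul_assoc]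
      rw [LinearMap.rTensor_tmul, e3, HopfAlgebra.mul_antipode_lTensor_comul_apply,
        Algebra.algebraMap_eq_smul_one, mul_smul_comm, mul_one, map_smul, LinearMap.rTensor_tmul,
        TensorProduct.lid_tmul, smul_assoc, smul_comm]
  rw [e1, coact, ← LeftComodule.coassoc, e2, LeftComodule.counit]

theorem reconstruct_coact (hh : IsHaar h) (n : N) :
    reconstruct hh N ((Φ.mk N).lTensor A (coact A n)) = n := by
  have := reconstruct_mul_coact hh 1 n
  rwa [expectation_one, one_smul, LinearMap.mulLeft_one] at this

/-- The coaction of `E(a) n` is `a₍₁₎ n₍₋₁₎ ⊗ E(a₍₂₎) n₍₀₎`. Rewriting the second leg through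
`reconstruct` makes everything depend on the product `a n₍₋₁₎` and on `[n₍₀₎]`, so that antipodes
can cancel in `exists_coinvariant`. -/
theorem coact_expectation_smul (hh : IsHaar h) (a : A) (n : N) :
    coact A (expectation π hh a • n) = (reconstruct hh N).lTensor A (TensorProduct.assoc ℂ A A (Φ N)
      (TensorProduct.map Coalgebra.comul (Φ.mk N)
        ((LinearMap.mulLeft ℂ a).rTensor N (coact A n)))) := by
  let R : A →ₗ[ℂ] A ⊗[ℂ] N →ₗ[ℂ] N := LinearMap.mk₂ ℂ
    (fun q z => reconstruct hh N (TensorProduct.map (LinearMap.mulLeft ℂ q) (Φ.mk N) z))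
    (fun q q' z => by
      rw [← map_add, ← LinearMap.add_apply, ← TensorProduct.map_add_left]
      congr 3; ext; simp [add_mul])
    (fun c q z => by
      rw [← map_smul, ← LinearMap.smul_apply, ← TensorProduct.map_smul_left]
      congr 3; ext; simp)
    (fun q z z' => by rw [map_add, map_add])
    (fun c q z => by rw [map_smul, map_smul])
  have e1 : ∀ z : A ⊗[ℂ] N, (reconstruct hh N).lTensor A (TensorProduct.assoc ℂ A A (Φ N)
      (TensorProduct.map Coalgebra.comul (Φ.mk N) ((LinearMap.mulLeft ℂ a).rTensor N z))) =
      TensorProduct.map₂ (LinearMap.mul ℂ A) R (Coalgebra.comul (R := ℂ) a)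
        (TensorProduct.assoc ℂ A A N ((Coalgebra.comul (R := ℂ) (A := A)).rTensor N z)) := by
    intro z
    induction z with
    | zero => simp
    | add p q hp hq => simp only [map_add, hp, hq]
    | tmul c n =>
      simp only [LinearMap.rTensor_tmul, TensorProduct.map_tmul, LinearMap.mulLeft_apply,
        Bialgebra.comul_mul]
      induction Coalgebra.comul (R := ℂ) a with
      | zero => simp
      | add p q hp hq => simp only [map_add, add_mul, add_tmul, LinearMap.add_apply, hp, hq]
      | tmul p q =>
        induction Coalgebra.comul (R := ℂ) c with
        | zero => simp
        | add p q hp hq => simp only [map_add, mul_add, add_tmul, hp, hq]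
        | tmul r s => simp [R]
  have e2 : ∀ (w : A ⊗[ℂ] A) (z : A ⊗[ℂ] N),
      TensorProduct.map₂ (LinearMap.mul ℂ A) R w ((coact A).lTensor A z) =
      diagL ((expectation π hh).lTensor A w) z := by
    intro w z
    induction w with
    | zero => simp
    | add p q hp hq => simp only [map_add, LinearMap.add_apply, hp, hq]
    | tmul p q =>
      induction z with
      | zero => simp
      | add p q hp hq => simp only [map_add, hp, hq]
      | tmul c n => simp [R, reconstruct_mul_coact]
  rw [e1, coact, ← coact, N.coact_smul, coact_expectation, ← e2]
  congr 1
  exact (LeftComodule.coassoc n).symm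

/-- The unit `N → A ⊗ Φ(N)`, `n ↦ n₍₋₁₎ ⊗ [n₍₀₎]` of Takeuchi's equivalence is injective. -/
theorem unit_injective (hh : IsHaar h) (N : RelHopfModule A (coinvariants π)) :
    Function.Injective ((Φ.mk N).lTensor A ∘ₗ coact A) :=
  Function.LeftInverse.injective (g := reconstruct hh N) (reconstruct_coact hh)

/-- Faithfulness of `Φ`. -/
theorem covariant_ext (hh : IsHaar h) {f g : M →ₗ[ℂ] N} (hf : IsCovariant A f)
    (hg : IsCovariant A g) (hfg : ∀ m, Φ.mk N (f m) = Φ.mk N (g m)) : f = g := by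
  ext m
  apply unit_injective hh N
  have e : Φ.mk N ∘ₗ f = Φ.mk N ∘ₗ g := LinearMap.ext hfg
  rw [LinearMap.comp_apply, LinearMap.comp_apply, hf, hg, ← LinearMap.lTensor_comp_apply,
    ← LinearMap.lTensor_comp_apply, e]

/-- An `A`-coinvariant element of `N` is determined by its class in `Φ(N)`. -/
theorem coinvariant_ext (hh : IsHaar h) {n n' : N} (hn : coact A n = 1 ⊗ₜ n)
    (hn' : coact A n' = 1 ⊗ₜ n') (e : Φ.mk N n = Φ.mk N n') : n = n' := by
  apply unit_injective hh N
  simp [hn, hn', e]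

/-- `π ∘ S` and `S ∘ π` are both convolution inverses of `π`. -/
theorem HopfStarHom.alg_antipode (π : HopfStarHom A H) (a : A) :
    π.alg (HopfAlgebra.antipode ℂ a) = HopfAlgebra.antipode ℂ (π.alg a) := by
  have e : π.alg.toLinearMap ∘ₗ HopfAlgebra.antipode ℂ =
      HopfAlgebra.antipode ℂ ∘ₗ π.alg.toLinearMap := by
    apply WithConv.toConv_injective
    apply left_inv_eq_right_inv (a := WithConv.toConv π.alg.toLinearMap)
    · ext a
      rw [LinearMap.convMul_apply, LinearMap.convOne_apply]
      have := congrArg π.alg (HopfAlgebra.mul_antipode_rTensor_comul_apply (R := ℂ) a)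
      rw [AlgHom.commutes] at this
      rw [← this]
      induction Coalgebra.comul (R := ℂ) a with
      | zero => simp
      | add p q hp hq => simp only [map_add, hp, hq]
      | tmul p q => simp
    · ext a
      rw [LinearMap.convMul_apply, LinearMap.convOne_apply]
      have := HopfAlgebra.mul_antipode_lTensor_comul_apply (R := ℂ) (π.alg a)
      rw [π.counit_alg] at this
      rw [← this, π.comul_alg]
      induction Coalgebra.comul (R := ℂ) a with
      | zero => simp
      | add p q hp hq => simp only [map_add, hp, hq]
      | tmul p q => simp
  exact LinearMap.congr_fun e a

/-- Every `H`-coinvariant element of `Φ(N)` is the class of an `A`-coinvariant element. -/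
theorem exists_coinvariant (hh : IsHaar h) {x : Φ N} (hx : coact H x = 1 ⊗ₜ x) :
    ∃ n : N, coact A n = 1 ⊗ₜ n ∧ Φ.mk N n = x := by
  obtain ⟨n, rfl⟩ := Φ.mk_surjective x
  -- For any representative `n`, the lift is `E(S(n₍₋₁₎)) n₍₀₎`.
  refine ⟨expectationAct hh N 1 (coact A n), ?_, ?_⟩
  · have e1 : ∀ z : A ⊗[ℂ] N, coact A (expectationAct hh N 1 z) =
        (reconstruct hh N).lTensor A (TensorProduct.assoc ℂ A A (Φ N)
          (TensorProduct.map Coalgebra.comul (Φ.mk N)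
            ((LinearMap.mul' ℂ A ∘ₗ (HopfAlgebra.antipode ℂ).rTensor A).rTensor N
              ((TensorProduct.assoc ℂ A A N).symm ((coact A).lTensor A z))))) := by
      intro z
      induction z with
      | zero => simp
      | add p q hp hq => simp only [map_add, hp, hq]
      | tmul c n =>
        rw [expectationAct_tmul, one_mul, coact_expectation_smul, LinearMap.lTensor_tmul]
        congr 3
        induction coact A n with
        | zero => simp
        | add p q hp hq => simp only [map_add, tmul_add, hp, hq]
        | tmul p q => simp
    -- `S(n₍₋₂₎) n₍₋₁₎` collapses to `1`, so the coaction of the lift becomes `1 ⊗ reconstruct (1 ⊗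
    -- [n])`.
    have e2 : ∀ z : A ⊗[ℂ] N,
        (LinearMap.mul' ℂ A ∘ₗ (HopfAlgebra.antipode ℂ).rTensor A).rTensor N
          ((Coalgebra.comul (R := ℂ) (A := A)).rTensor N z) =
        1 ⊗ₜ TensorProduct.lid ℂ N ((Coalgebra.counit (R := ℂ) (A := A)).rTensor N z) := by
      intro z
      induction z with
      | zero => simp
      | add p q hp hq => simp only [map_add, tmul_add, hp, hq]
      | tmul c n =>
        simp only [LinearMap.rTensor_tmul, LinearMap.comp_apply,
          HopfAlgebra.mul_antipode_rTensor_comul_apply, Algebra.algebraMap_eq_smul_one,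
          TensorProduct.lid_tmul, smul_tmul]
    have e3 : (coact A).lTensor A (coact A n) = TensorProduct.assoc ℂ A A N
        ((Coalgebra.comul (R := ℂ) (A := A)).rTensor N (coact A n)) :=
      (LeftComodule.coassoc n).symm
    have e4 : TensorProduct.lid ℂ N ((Coalgebra.counit (R := ℂ) (A := A)).rTensor N
        (coact A n)) = n := LeftComodule.counit n
    rw [e1, e3, LinearEquiv.symm_apply_apply, e2, e4]
    simp [Algebra.TensorProduct.one_def, reconstruct_tmul_mk]
  -- The class of the lift is `h(S(x₍₋₁₎)) x₍₀₎` by `counit_expectation`. It equals `x` since `x` is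
  -- coinvariant, `S(1) = 1` and `h(1) = 1`.
  · have e : ∀ z : A ⊗[ℂ] N, Φ.mk N (expectationAct hh N 1 z) =
        TensorProduct.lid ℂ (Φ N) ((h ∘ₗ HopfAlgebra.antipode ℂ).rTensor (Φ N)
          (TensorProduct.map π.alg.toLinearMap (Φ.mk N) z)) := by
      intro z
      induction z with
      | zero => simp
      | add p q hp hq => simp only [map_add, hp, hq]
      | tmul a n =>
        rw [expectationAct_tmul, Φ.mk_smul, counit_expectation, one_mul, π.alg_antipode]
        simp
    rw [e, ← Φ.coact_mk, hx]
    simp [hh.map_one]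

end Expectation

/-! ### Morphisms to and from the unit object, and the monoidal structure of `Φ` -/

section Functor

variable {A H : Type u} [Ring A] [HopfAlgebra ℂ A] [StarRing A] [StarModule ℂ A]
  [Ring H] [HopfAlgebra ℂ H] [StarRing H] [StarModule ℂ H] [HopfStarAlgebra A]
  {π : HopfStarHom A H} {M N : RelHopfModule A (coinvariants π)}

theorem tensor_induction {p : M.tensor N → Prop} (x : M.tensor N)
    (tmul : ∀ m n, p (tmulB m n)) (add : ∀ x y, p x → p y → p (x + y)) : p x :=
  balTensor_induction x tmul add

/-- `(a ⊗ m, c ⊗ n) ↦ a c ⊗ (m ⊗_B n)`. -/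
def diagTensor (M N : RelHopfModule A (coinvariants π)) :
    A ⊗[ℂ] M →ₗ[ℂ] A ⊗[ℂ] N →ₗ[ℂ] A ⊗[ℂ] M.tensor N :=
  codiag M N

theorem diagTensor_tmul (a c : A) (m : M) (n : N) :
    diagTensor M N (a ⊗ₜ m) (c ⊗ₜ n) = (a * c) ⊗ₜ tmulB m n := rfl

theorem coact_tmulB (m : M) (n : N) :
    coact A (tmulB m n) = diagTensor M N (coact A m) (coact A n) := rfl

/-! ### Morphisms to the unit object -/

/-- `m ↦ m₍₋₁₎ φ([m₍₀₎])`. -/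
def coextendAux (φ : Φ M →ₗ[ℂ] ℂ) : M →ₗ[ℂ] A :=
  (TensorProduct.rid ℂ A).toLinearMap ∘ₗ (φ ∘ₗ Φ.mk M).lTensor A ∘ₗ coact A

theorem comul_coextendAux (φ : Φ M →ₗ[ℂ] ℂ) (m : M) :
    Coalgebra.comul (R := ℂ) (coextendAux φ m) = (coextendAux φ).lTensor A (coact A m) := by
  let g : A ⊗[ℂ] M →ₗ[ℂ] A := (TensorProduct.rid ℂ A).toLinearMap ∘ₗ (φ ∘ₗ Φ.mk M).lTensor A
  have e1 : ∀ z : A ⊗[ℂ] M, Coalgebra.comul (R := ℂ) (g z) =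
      g.lTensor A (TensorProduct.assoc ℂ A A M
        ((Coalgebra.comul (R := ℂ) (A := A)).rTensor M z)) := by
    intro z
    induction z with
    | zero => simp
    | add x y hx hy => simp only [map_add, hx, hy]
    | tmul x y =>
      simp only [g, LinearMap.comp_apply, LinearEquiv.coe_coe, LinearMap.lTensor_tmul,
        TensorProduct.rid_tmul, LinearMap.rTensor_tmul, map_smul]
      induction Coalgebra.comul (R := ℂ) x with
      | zero => simp
      | add p q hp hq => simp only [map_add, add_tmul, smul_add, hp, hq]
      | tmul p q => simp
  have e2 : coextendAux φ = g ∘ₗ coact A := rfl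
  have e3 : (coact A).lTensor A (coact A m) = TensorProduct.assoc ℂ A A M
      ((Coalgebra.comul (R := ℂ) (A := A)).rTensor M (coact A m)) :=
    (LeftComodule.coassoc m).symm
  rw [e2, LinearMap.lTensor_comp, LinearMap.comp_apply (LinearMap.lTensor A g), e3]
  exact e1 _

/-- As for `E`: invariance of `φ` gives `π(m₍₋₁₎) φ([m₍₀₎]) = φ([m]) 1`, and `comul_coextendAux`
places this in the second leg. -/
theorem coextendAux_mem {φ : Φ M →ₗ[ℂ] ℂ}
    (hφ : ∀ v, TensorProduct.rid ℂ H (φ.lTensor H (coact H v)) = φ v • (1 : H)) (m : M) :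
    coextendAux φ m ∈ coinvariants π := by
  rw [mem_coinvariants, rightCoact_apply, comul_coextendAux, ← LinearMap.lTensor_comp_apply]
  have e1 : ∀ x, π.alg (coextendAux φ x) = φ (Φ.mk M x) • (1 : H) := by
    intro x
    rw [← hφ, Φ.coact_mk, coextendAux, LinearMap.comp_apply, LinearMap.comp_apply]
    induction coact A x with
    | zero => simp
    | add p q hp hq => simp only [map_add, hp, hq]
    | tmul p q => simp
  have e2 : ∀ z : A ⊗[ℂ] M, (π.alg.toLinearMap ∘ₗ coextendAux φ).lTensor A z =
      TensorProduct.rid ℂ A ((φ ∘ₗ Φ.mk M).lTensor A z) ⊗ₜ[ℂ] (1 : H) := by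
    intro z
    induction z with
    | zero => simp
    | add p q hp hq => simp only [map_add, add_tmul, hp, hq]
    | tmul p q => simp [e1, smul_tmul']
  exact e2 _

/-- The morphism `M → B`, `m ↦ m₍₋₁₎ φ([m₍₀₎])` induced by an `H`-comodule map `φ : Φ(M) → ℂ`. -/
def coextend (φ : Φ M →ₗ[ℂ] ℂ)
    (hφ : ∀ v, TensorProduct.rid ℂ H (φ.lTensor H (coact H v)) = φ v • (1 : H))
    (hM : ∀ (b : coinvariants π) (m : M),
      Φ.mk M (op b • m) = Coalgebra.counit (R := ℂ) (b : A) • Φ.mk M m) :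
    BimodHom M (RelHopfModule.unit A (coinvariants π)) :=
  -- `b = b₍₁₎ ε(b₍₂₎)`, with the second leg kept in `B`. Both module laws follow since `b₍₂₎` acts
  -- on `Φ(M)` by `ε(b₍₂₎)` from the left, and from the right by `hM`.
  have e (b : coinvariants π) : TensorProduct.rid ℂ A
      ((Coalgebra.counit (R := ℂ) (A := A)).lTensor A
        ((coinvSub π).subtype.lTensor A (coact A b : A ⊗[ℂ] coinvariants π))) = b := by
    rw [lTensor_coact_coinvariants, Coalgebra.lTensor_counit_comul]
    simp
  ⟨(LinearMap.codRestrict (coinvSub π) (coextendAux φ) (coextendAux_mem hφ) :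
      M →ₗ[ℂ] coinvariants π),
    fun b m => by
      apply Subtype.ext
      change coextendAux φ (b • m) = (b : A) * coextendAux φ m
      conv_rhs => rw [← e b]
      rw [coextendAux, LinearMap.comp_apply, LinearMap.comp_apply, LinearMap.comp_apply,
        LinearMap.comp_apply, M.coact_smul]
      induction coact A m with
      | zero => simp
      | add p q hp hq => simp only [map_add, mul_add, hp, hq]
      | tmul a m =>
        induction coact A b with
        | zero => simp
        | add p q hp hq => simp only [map_add, LinearMap.add_apply, add_mul, hp, hq]
        | tmul c b => simp [Φ.mk_smul, mul_smul, smul_comm (φ _)],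
    fun b m => by
      apply Subtype.ext
      change coextendAux φ (op b • m) = coextendAux φ m * (b : A)
      conv_rhs => rw [← e b]
      rw [coextendAux, LinearMap.comp_apply, LinearMap.comp_apply, LinearMap.comp_apply,
        LinearMap.comp_apply, M.coact_op_smul]
      induction coact A m with
      | zero => simp
      | add p q hp hq => simp only [map_add, add_mul, hp, hq]
      | tmul a m =>
        induction coact A b with
        | zero => simp
        | add p q hp hq => simp only [map_add, LinearMap.add_apply, mul_add, hp, hq]
        | tmul c b => simp [hM, mul_smul]⟩

section Coextend

variable (φ : Φ M →ₗ[ℂ] ℂ)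
    (hφ : ∀ v, TensorProduct.rid ℂ H (φ.lTensor H (coact H v)) = φ v • (1 : H))
    (hM : ∀ (b : coinvariants π) (m : M),
      Φ.mk M (op b • m) = Coalgebra.counit (R := ℂ) (b : A) • Φ.mk M m)

theorem isCovariant_coextend : IsCovariant A (coextend φ hφ hM).1 := by
  intro m
  apply lTensor_subtype_injective (A := A) (coinvSub π)
  refine (lTensor_coact_coinvariants π _).trans ((comul_coextendAux φ m).trans ?_)
  exact LinearMap.lTensor_comp_apply A (coinvSub π).subtype
    (LinearMap.codRestrict (coinvSub π) (coextendAux φ) (coextendAux_mem hφ)) _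

/-- Under the identification of `Φ(B)` with `ℂ`, this says that `Φ` sends `coextend φ` back to `φ`.
-/
theorem counit_coextend (m : M) : Coalgebra.counit (R := ℂ)
    ((unitVal A ((coextend φ hφ hM).1 m) : coinvariants π) : A) = φ (Φ.mk M m) := by
  change Coalgebra.counit (R := ℂ) (coextendAux φ m) = _
  have e : ∀ z : A ⊗[ℂ] M, Coalgebra.counit (R := ℂ)
      (TensorProduct.rid ℂ A ((φ ∘ₗ Φ.mk M).lTensor A z)) =
      φ (Φ.mk M (TensorProduct.lid ℂ M ((Coalgebra.counit (R := ℂ) (A := A)).rTensor M z))) := by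
    intro z
    induction z with
    | zero => simp
    | add p q hp hq => simp only [map_add, hp, hq]
    | tmul p q => simp [mul_comm]
  refine (e _).trans ?_
  exact congrArg (fun x => φ (Φ.mk M x)) (LeftComodule.counit m)

end Coextend

/-! ### The inverse of the monoidal structure of `Φ` -/

/-- The inverse `Φ(M ⊗_B N) → Φ(M) ⊗ Φ(N)`, `[m ⊗_B n] ↦ [m] ⊗ [n]`, of `Φ.mul`. -/
def Φ.comul (M N : RelHopfModule A (coinvariants π)) (hM : plusRight M = plusLeft M) :
    Φ (M.tensor N) →ₗ[ℂ] Φ M ⊗[ℂ] Φ N :=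
  let f : M.tensor N →ₗ[ℂ] Φ M ⊗[ℂ] Φ N :=
    balLift (coinvariants π) (TensorProduct.map (Φ.mk M) (Φ.mk N)) (fun m b n => by
      rw [map_tmul, map_tmul, Φ.mk_op_smul hM, Φ.mk_smul, smul_tmul])
  Φ.lift f (fun b x hb => by
    induction x using tensor_induction with
    | add x y hx hy => rw [smul_add, map_add, hx, hy, add_zero]
    | tmul m n =>
      change Φ.mk M (b • m) ⊗ₜ[ℂ] Φ.mk N n = 0
      rw [Φ.mk_smul, hb, zero_smul, zero_tmul])

theorem Φ.comul_mk (hM : plusRight M = plusLeft M) (m : M) (n : N) :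
    Φ.comul M N hM (Φ.mk (M.tensor N) (tmulB m n)) = Φ.mk M m ⊗ₜ Φ.mk N n := rfl

theorem Φ.comul_mul (hM : plusRight M = plusLeft M) (x : Φ M ⊗[ℂ] Φ N) :
    Φ.comul M N hM (Φ.mul M N hM x) = x := by
  induction x with
  | zero => simp
  | add x y hx hy => simp only [map_add, hx, hy]
  | tmul v w =>
    obtain ⟨m, rfl⟩ := Φ.mk_surjective v
    obtain ⟨n, rfl⟩ := Φ.mk_surjective w
    rw [Φ.mul_tmul, Φ.comul_mk]

theorem Φ.mul_comul (hM : plusRight M = plusLeft M) (x : Φ (M.tensor N)) :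
    Φ.mul M N hM (Φ.comul M N hM x) = x := by
  obtain ⟨x, rfl⟩ := Φ.mk_surjective x
  induction x using tensor_induction with
  | add x y hx hy => simp only [map_add, hx, hy]
  | tmul m n => rw [Φ.comul_mk, Φ.mul_tmul]

/-- The right action of `B` touches only the factor `N`. This is the form in which `M B⁺ = B⁺ M`
passes to tensor products in `coextend` and in the commutation of coinvariants with `B`. -/
theorem Φ.mk_tensor_op_smul (hM : plusRight M = plusLeft M) (hN : plusRight N = plusLeft N)
    (b : coinvariants π) (x : M.tensor N) :
    Φ.mk (M.tensor N) (op b • x) = Coalgebra.counit (R := ℂ) (b : A) • Φ.mk (M.tensor N) x := by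
  induction x using tensor_induction with
  | add x y hx hy => rw [smul_add, map_add, map_add, smul_add, hx, hy]
  | tmul m n =>
    change Φ.mk (M.tensor N) (tmulB m (op b • n)) = _
    rw [← Φ.mul_tmul hM, ← Φ.mul_tmul hM, Φ.mk_op_smul hN, tmul_smul, map_smul]

/-- The diagonal coaction on a tensor product of two comodules. -/
def diagonalCoact (H : Type u) [Ring H] [HopfAlgebra ℂ H] {V W : Type u}
    [AddCommGroup V] [Module ℂ V] [LeftComodule H V]
    [AddCommGroup W] [Module ℂ W] [LeftComodule H W] (v : V) (w : W) : H ⊗[ℂ] (V ⊗[ℂ] W) :=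
  TensorProduct.map₂ (LinearMap.mul ℂ H) (TensorProduct.mk ℂ V W) (coact H v) (coact H w)

theorem Φ.coact_mul (hM : plusRight M = plusLeft M) (v : Φ M) (w : Φ N) :
    coact H (Φ.mul M N hM (v ⊗ₜ w)) =
      (Φ.mul M N hM).lTensor H (diagonalCoact H v w) := by
  obtain ⟨m, rfl⟩ := Φ.mk_surjective v
  obtain ⟨n, rfl⟩ := Φ.mk_surjective w
  rw [Φ.mul_tmul, Φ.coact_mk, diagonalCoact, Φ.coact_mk, Φ.coact_mk, coact_tmulB]
  induction coact A m with
  | zero => simp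
  | add x y hx hy => simp only [map_add, LinearMap.add_apply, hx, hy]
  | tmul a m =>
    induction coact A n with
    | zero => simp
    | add x y hx hy => simp only [map_add, hx, hy]
    | tmul c n =>
      rw [diagTensor_tmul, map_tmul, map_tmul, map_tmul, map₂_apply_tmul, map_tmul, LinearMap.lTensor_tmul]
      simp only [AlgHom.toLinearMap_apply, map_mul, LinearMap.mul_apply', TensorProduct.mk_apply]
      rw [Φ.mul_tmul]

/-! ### Morphisms from the unit object -/

theorem coact_one_tmul_smul {x : N} (hx : coact A x = 1 ⊗ₜ x) (b : coinvariants π) :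
    coact A (b • x) =
      ((Algebra.lsmul ℂ ℂ N : coinvariants π →ₐ[ℂ] _).toLinearMap.flip x).lTensor A
        (coact A b) := by
  rw [N.coact_smul, hx]
  induction coact A b with
  | zero => simp
  | add p q hp hq => simp only [map_add, LinearMap.add_apply, hp, hq]
  | tmul p q => simp

theorem coact_one_tmul_op_smul {x : N} (hx : coact A x = 1 ⊗ₜ x) (b : coinvariants π) :
    coact A (op b • x) =
      ((Algebra.lsmul ℂ ℂ N : (coinvariants π)ᵐᵒᵖ →ₐ[ℂ] _).toLinearMap.flip x ∘ₗ
        (opLinearEquiv ℂ : coinvariants π ≃ₗ[ℂ] (coinvariants π)ᵐᵒᵖ).toLinearMap).lTensor A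
        (coact A b) := by
  rw [N.coact_op_smul, hx]
  induction coact A b with
  | zero => simp
  | add p q hp hq => simp only [map_add, LinearMap.add_apply, hp, hq]
  | tmul p q => simp

/-- An `A`-coinvariant element commutes with `B`. -/
theorem op_smul_eq_smul_of_coinvariant {h : H →ₗ[ℂ] ℂ} (hh : IsHaar h) {x : N}
    (hx : coact A x = 1 ⊗ₜ x) (hN : ∀ (b : coinvariants π) (m : N),
      Φ.mk N (op b • m) = Coalgebra.counit (R := ℂ) (b : A) • Φ.mk N m) (b : coinvariants π) :
    op b • x = b • x := by
  apply unit_injective hh N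
  rw [LinearMap.comp_apply, LinearMap.comp_apply, coact_one_tmul_smul hx,
    coact_one_tmul_op_smul hx, ← LinearMap.lTensor_comp_apply, ← LinearMap.lTensor_comp_apply]
  -- The unit of the equivalence sends `x b` and `b x` to `b₍₁₎ ⊗ [x b₍₂₎]` and `b₍₁₎ ⊗ [b₍₂₎ x]`.
  -- Both classes are `ε(b₍₂₎) [x]`.
  congr 2
  ext c
  exact (hN c x).trans (Φ.mk_smul c x).symm

/-- The morphism `B → N`, `b ↦ b x`, for an element `x` of `N` which commutes with `B`. -/
def extendUnit (x : N) (hx : ∀ b : coinvariants π, op b • x = b • x) :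
    BimodHom (RelHopfModule.unit A (coinvariants π)) N :=
  ⟨((Algebra.lsmul ℂ ℂ N : coinvariants π →ₐ[ℂ] _).toLinearMap.flip x) ∘ₗ
      (unitVal A : _ ≃ₗ[ℂ] coinvariants π).toLinearMap,
    fun b c => mul_smul b (unitVal A c : coinvariants π) x,
    fun b c => by
      change ((unitVal A c : coinvariants π) * b) • x =
        op b • (unitVal A c : coinvariants π) • x
      rw [← smul_comm, hx, mul_smul]⟩

theorem extendUnit_one (x : N) (hx : ∀ b : coinvariants π, op b • x = b • x) :
    (extendUnit x hx).1 ((unitVal A).symm 1) = x := one_smul (coinvariants π) x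

theorem isCovariant_extendUnit {x : N} (hx : ∀ b : coinvariants π, op b • x = b • x)
    (h : coact A x = 1 ⊗ₜ x) : IsCovariant A (extendUnit x hx).1 := fun b =>
  coact_one_tmul_smul h (unitVal A b : coinvariants π)

theorem isCovariant_coevOf {g : M.tensor M} (h : coact A g = 1 ⊗ₜ g) :
    IsCovariant A (coevOf g) := fun b =>
  coact_one_tmul_smul h (unitVal A b : coinvariants π)

theorem coact_unit_one :
    coact A ((unitVal A).symm (1 : coinvariants π)) = 1 ⊗ₜ (unitVal A).symm (1 : coinvariants π) :=
  ComoduleStarAlgebra.coact_one (A := A) (B := coinvariants π)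

theorem BimodHom.apply_unit (f : BimodHom (RelHopfModule.unit A (coinvariants π)) N)
    (b : coinvariants π) : f.1 ((unitVal A).symm b) = b • f.1 ((unitVal A).symm 1) := by
  rw [← f.2.1]
  congr 1
  exact (mul_one b).symm

theorem BimodHom.coact_apply_one {f : BimodHom (RelHopfModule.unit A (coinvariants π)) N}
    (hf : IsCovariant A f.1) :
    coact A (f.1 ((unitVal A).symm 1)) = 1 ⊗ₜ f.1 ((unitVal A).symm 1) := by
  rw [hf, coact_unit_one, LinearMap.lTensor_tmul]

theorem BimodHom.ext_unit {f g : BimodHom (RelHopfModule.unit A (coinvariants π)) N}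
    (h : f.1 ((unitVal A).symm 1) = g.1 ((unitVal A).symm 1)) : f = g := by
  apply Subtype.ext
  ext b
  obtain ⟨b, rfl⟩ := (unitVal A : _ ≃ₗ[ℂ] coinvariants π).symm.surjective b
  rw [BimodHom.apply_unit f, BimodHom.apply_unit g, h]

end Functor

/-! ### Covariance of the star, the inclusions and the projections -/

section Calculus

variable {A : Type u} [Ring A] [HopfAlgebra ℂ A] [StarRing A] [StarModule ℂ A]
  {B : Type u} [Ring B] [Algebra ℂ B] [StarRing B] [StarModule ℂ B] [ComoduleStarAlgebra A B]

theorem CovariantStarCalculus.lTensor_formVal_coact (K : CovariantStarCalculus A B) (k : ℕ)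
    (ω : K.forms k) : (K.formVal k).lTensor A (coact A ω) = K.δ (K.formVal k ω) :=
  let _ : LeftComodule A K.Ω := ⟨K.δ.toLinearMap, K.δ_coassoc, K.δ_counit⟩
  lTensor_restrictCoact _ (K.form k) (K.δ_mem k) ω

theorem CovariantStarCalculus.lTensor_formVal_injective (K : CovariantStarCalculus A B) (k : ℕ) :
    Function.Injective ((K.formVal k).lTensor A) :=
  lTensor_subtype_injective (K.form k)

namespace CovariantComplexStructure

variable (C : CovariantComplexStructure A B)

theorem lTensor_biVal_coact (pq : ℕ × ℕ) (ω : C.biforms pq) :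
    (C.biVal pq).lTensor A (coact A ω) = C.δ (C.biVal pq ω) :=
  let _ : LeftComodule A C.Ω := ⟨C.δ.toLinearMap, C.δ_coassoc, C.δ_counit⟩
  lTensor_restrictCoact _ (C.bi pq) (C.δ_bi pq) ω

theorem lTensor_biVal_injective (pq : ℕ × ℕ) : Function.Injective ((C.biVal pq).lTensor A) :=
  lTensor_subtype_injective (C.bi pq)

theorem coact_starBi (p q : ℕ) (ω : C.biforms (p, q)) : coact A (C.starBi p q ω) =
    TensorProduct.map (starLinearEquiv ℂ (A := A)).toLinearMap (C.starBi p q) (coact A ω) := by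
  apply C.lTensor_biVal_injective
  refine (C.lTensor_biVal_coact _ _).trans ((C.δ_conj _).trans ?_)
  rw [← C.lTensor_biVal_coact]
  induction coact A ω with
  | zero => simp
  | add x y hx hy => simp only [map_add, hx, hy]
  | tmul a ω => rfl

theorem starBi_starBi (p q : ℕ) (ω : C.biforms (p, q)) :
    C.starBi q p (C.starBi p q ω) = ω :=
  C.biVal_injective (p, q) (C.conj_conj _)

theorem starBi_op_smul (p q : ℕ) (b : B) (ω : C.biforms (p, q)) :
    C.starBi p q (op b • ω) = star b • C.starBi p q ω :=
  C.biVal_injective (q, p) (C.conj_mul_ofBase b (C.bi_le_form p q (C.biVal_mem ω)))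

theorem isCovariant_incl (p q : ℕ) : IsCovariant A (C.incl p q).1 := by
  intro ω
  apply C.lTensor_formVal_injective
  refine (C.lTensor_formVal_coact _ _).trans ?_
  rw [← LinearMap.lTensor_comp_apply]
  exact (C.lTensor_biVal_coact _ ω).symm

/-- The projection of `Ω` to `Ω^{(p,q)}`. -/
def component (pq : ℕ × ℕ) : C.Ω →ₗ[ℂ] C.Ω :=
  (C.bi pq).subtype ∘ₗ DirectSum.component ℂ (ℕ × ℕ) (fun i => C.bi i) pq ∘ₗ
    (DirectSum.decomposeLinearEquiv C.bi).toLinearMap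

theorem component_of_mem {pq : ℕ × ℕ} {x : C.Ω} (hx : x ∈ C.bi pq) : C.component pq x = x :=
  DirectSum.decompose_of_mem_same C.bi hx

theorem component_of_mem_ne {pq rs : ℕ × ℕ} {x : C.Ω} (hx : x ∈ C.bi rs) (h : rs ≠ pq) :
    C.component pq x = 0 :=
  DirectSum.decompose_of_mem_ne C.bi hx h

theorem biVal_proj (k : ℕ) (pq : ℕ × ℕ) (ω : C.forms k) :
    C.biVal pq ((C.proj k pq).1 ω) = C.component pq (C.formVal k ω) := rfl

/-- It suffices to take `x` homogeneous. Then `δ(x)` lies in `A ⊗ Ω^{(r,s)}`, where the projection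
in the second leg is the identity or zero. -/
theorem δ_component (pq : ℕ × ℕ) (x : C.Ω) :
    C.δ (C.component pq x) = (C.component pq).lTensor A (C.δ x) := by
  induction x using DirectSum.Decomposition.inductionOn C.bi with
  | zero => simp
  | add x y hx hy => simp only [map_add, hx, hy]
  | @homogeneous rs x =>
    obtain ⟨y, hy⟩ := C.δ_bi rs x x.2
    rw [← hy, ← LinearMap.lTensor_comp_apply]
    by_cases h : rs = pq
    · subst h
      rw [C.component_of_mem x.2, ← hy]
      congr 2
      ext z
      exact (C.component_of_mem z.2).symm
    · rw [C.component_of_mem_ne x.2 h, map_zero]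
      have : C.component pq ∘ₗ (C.bi rs).subtype = 0 := by
        ext z
        exact C.component_of_mem_ne z.2 h
      rw [this, LinearMap.lTensor_zero, LinearMap.zero_apply]

theorem isCovariant_proj (k : ℕ) (pq : ℕ × ℕ) : IsCovariant A (C.proj k pq).1 := by
  intro ω
  apply C.lTensor_biVal_injective
  refine (C.lTensor_biVal_coact _ _).trans ?_
  rw [← LinearMap.lTensor_comp_apply, biVal_proj, C.δ_component,
    ← C.lTensor_formVal_coact, ← LinearMap.lTensor_comp_apply]
  rfl

theorem component_add_component {x : C.Ω} (hx : x ∈ C.form 1) :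
    C.component (1, 0) x + C.component (0, 1) x = x := by
  rw [C.form_eq] at hx
  have h : (⨆ pq : {pq : ℕ × ℕ // pq.1 + pq.2 = 1}, C.bi pq.1) ≤
      LinearMap.ker (C.component (1, 0) + C.component (0, 1) - LinearMap.id) := by
    refine iSup_le ?_
    rintro ⟨⟨p, q⟩, hpq⟩ y hy
    rw [LinearMap.mem_ker, LinearMap.sub_apply, LinearMap.add_apply, LinearMap.id_apply,
      sub_eq_zero]
    obtain ⟨rfl, rfl⟩ | ⟨rfl, rfl⟩ : p = 1 ∧ q = 0 ∨ p = 0 ∧ q = 1 := by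
      change p + q = 1 at hpq
      omega
    · rw [C.component_of_mem hy, C.component_of_mem_ne hy (by simp), add_zero]
    · rw [C.component_of_mem hy, C.component_of_mem_ne hy (by simp), zero_add]
  have := h hx
  rwa [LinearMap.mem_ker, LinearMap.sub_apply, LinearMap.add_apply, LinearMap.id_apply,
    sub_eq_zero] at this

end CovariantComplexStructure

end Calculus

/-! ### Orthonormal bases, unitarity of the coaction, and invariance of evaluation and coevaluation
-/

section Invariance

variable {A H : Type u} [Ring A] [HopfAlgebra ℂ A] [StarRing A] [StarModule ℂ A]
  [Ring H] [HopfAlgebra ℂ H] [StarRing H] [StarModule ℂ H] [HopfStarAlgebra A]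
  {π : HopfStarHom A H}

namespace CovariantComplexStructure

variable (C : CovariantComplexStructure A (coinvariants π))

theorem incl_proj_add_incl_proj (ω : C.Ω1) :
    C.incl10.1 ((C.proj 1 (1, 0)).1 ω) + C.incl01.1 ((C.proj 1 (0, 1)).1 ω) = ω :=
  C.formVal_injective 1 (C.component_add_component (C.formVal_mem ω))

theorem proj_incl10 (ω : C.Ω10) : (C.proj 1 (1, 0)).1 (C.incl10.1 ω) = ω :=
  C.proj_incl 1 0 ω

end CovariantComplexStructure

namespace InvariantInner

variable {V : Type u} [AddCommGroup V] [Module ℂ V] [LeftComodule H V]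
  (ip : InvariantInner H V)

/-- An inner product on a finite-dimensional space has an orthonormal basis. -/
theorem exists_orthonormal [Module.Finite ℂ V] :
    ∃ (n : ℕ) (v : Module.Basis (Fin n) ℂ V), ip.IsOrthonormal v := by
  let core : InnerProductSpace.Core ℂ V :=
    -- The arguments are exchanged: `ip.form` is conjugate-linear on the right, `inner` on the left.
    { inner := fun x y => ip.form y x
      conj_inner_symm := fun x y => (ip.conj_symm y x).symm
      re_inner_nonneg := fun x => by
        by_cases hx : x = 0
        · simp [hx]
        · exact (ip.pos x hx).le
      add_left := fun x y z => by simp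
      smul_left := fun x y c => by simp
      definite := fun x hx => by
        by_contra h
        have h1 := ip.pos x h
        change ip.form x x = 0 at hx
        rw [hx] at h1
        exact lt_irrefl _ h1 }
  let _ : NormedAddCommGroup V := core.toNormedAddCommGroup
  let _ : InnerProductSpace ℂ V := InnerProductSpace.ofCore core.toCore
  refine ⟨_, (stdOrthonormalBasis ℂ V).toBasis, fun i j => ?_⟩
  have := (orthonormal_iff_ite.1 (stdOrthonormalBasis ℂ V).orthonormal) j i
  simp only [OrthonormalBasis.coe_toBasis]
  refine Eq.trans this ?_
  simp only [eq_comm]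

variable {ip} {n : ℕ} {v : Module.Basis (Fin n) ℂ V}

theorem IsOrthonormal.sum_form_smul (hv : ip.IsOrthonormal v) (x : V) :
    ∑ i, ip.form x (v i) • v i = x := by
  have h : LinearMap.id = ∑ i, (ip.form.flip (v i)).smulRight (v i) := by
    refine v.ext fun j => ?_
    simp [LinearMap.sum_apply, hv j]
  conv_rhs => rw [← LinearMap.id_apply (R := ℂ) x, h]
  simp [LinearMap.sum_apply]

end InvariantInner

section Coefficients

variable {V : Type u} [AddCommGroup V] [Module ℂ V] [LeftComodule H V] {n : ℕ}
  (v : Module.Basis (Fin n) ℂ V)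

theorem sum_coord_tmul {X : Type u} [AddCommGroup X] [Module ℂ X] (z : X ⊗[ℂ] V) :
    ∑ j, TensorProduct.rid ℂ X ((v.coord j).lTensor X z) ⊗ₜ[ℂ] v j = z := by
  induction z with
  | zero => simp
  | add x y hx hy => simp only [map_add, add_tmul, Finset.sum_add_distrib, hx, hy]
  | tmul x w =>
    simp only [LinearMap.lTensor_tmul, TensorProduct.rid_tmul, smul_tmul, ← tmul_sum,
      Module.Basis.coord_apply, v.sum_repr]

theorem coord_sum_tmul {X : Type u} [AddCommGroup X] [Module ℂ X] (x : Fin n → X) (j : Fin n) :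
    TensorProduct.rid ℂ X ((v.coord j).lTensor X (∑ k, x k ⊗ₜ[ℂ] v k)) = x j := by
  simp [Finsupp.single_apply]

/-- The matrix coefficients `aᵢⱼ` of a comodule: `δ(vᵢ) = ∑ aᵢⱼ ⊗ vⱼ`. -/
def coefficient (H : Type u) [Ring H] [HopfAlgebra ℂ H] {V : Type u} [AddCommGroup V] [Module ℂ V]
    [LeftComodule H V] {n : ℕ} (v : Module.Basis (Fin n) ℂ V) : Matrix (Fin n) (Fin n) H :=
  fun i j => TensorProduct.rid ℂ H ((v.coord j).lTensor H (coact H (v i)))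

theorem coact_basis (i : Fin n) : coact H (v i) = ∑ j, coefficient H v i j ⊗ₜ v j :=
  (sum_coord_tmul v _).symm

/-- Coassociativity of the coaction at `vᵢ`, with the coordinates along `vⱼ` compared once the
associator is removed. -/
theorem comul_coefficient (i j : Fin n) : Coalgebra.comul (R := ℂ) (coefficient H v i j) =
    ∑ k, coefficient H v i k ⊗ₜ coefficient H v k j := by
  have h : TensorProduct.assoc ℂ H H V
      ((Coalgebra.comul (R := ℂ) (A := H)).rTensor V (coact H (v i))) =
      (coact H).lTensor H (coact H (v i)) := LeftComodule.coassoc (v i)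
  have h1 : (coact H).lTensor H (coact H (v i)) = TensorProduct.assoc ℂ H H V
      (∑ j, (∑ k, coefficient H v i k ⊗ₜ coefficient H v k j) ⊗ₜ v j) := by
    rw [coact_basis v i]
    simp only [map_sum, LinearMap.lTensor_tmul, coact_basis v, sum_tmul, tmul_sum,
      TensorProduct.assoc_tmul]
    exact Finset.sum_comm
  rw [h1, coact_basis v i] at h
  have h2 := congrArg (fun z => TensorProduct.rid ℂ (H ⊗[ℂ] H) ((v.coord j).lTensor (H ⊗[ℂ] H) z))
    ((TensorProduct.assoc ℂ H H V).injective h)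
  simp only [map_sum (LinearMap.rTensor V _), LinearMap.rTensor_tmul] at h2
  rwa [coord_sum_tmul v, coord_sum_tmul v] at h2

theorem counit_coefficient (i j : Fin n) :
    Coalgebra.counit (R := ℂ) (coefficient H v i j) = if i = j then 1 else 0 := by
  have h : TensorProduct.lid ℂ V ((Coalgebra.counit (R := ℂ) (A := H)).rTensor V
      (coact H (v i))) = v i := LeftComodule.counit (v i)
  rw [coact_basis v i] at h
  have := congrArg (v.coord j) h
  simpa [Finsupp.single_apply] using this

/-- The `(i, j)` entry is the invariance of the inner product for the pair `vᵢ, vⱼ`. -/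
theorem InvariantInner.IsOrthonormal.coefficient_mul {ip : InvariantInner H V}
    (hv : ip.IsOrthonormal v) :
    coefficient H v * (coefficient H v).conjTranspose = 1 := by
  ext i j
  have h := ip.invariant (v i) (v j)
  rw [coact_basis v i, coact_basis v j, hv i j] at h
  simp only [map_sum, LinearMap.sum_apply, map₂_apply_tmul, map_tmul, hv _ _, TensorProduct.rid_tmul,
    ite_smul, one_smul, zero_smul, Finset.sum_ite_eq', Finset.mem_univ, if_true] at h
  rw [Matrix.mul_apply, Matrix.one_apply]
  exact h

/-- A one-sided inverse over a noncommutative ring need not be two-sided, but `S(u)` is a left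
inverse of `u`, so it equals the right inverse `u*`. -/
theorem InvariantInner.IsOrthonormal.mul_coefficient {ip : InvariantInner H V}
    (hv : ip.IsOrthonormal v) :
    (coefficient H v).conjTranspose * coefficient H v = 1 := by
  have h := map_antipode_mul (H := H) (comul_coefficient v) (counit_coefficient v)
  rwa [left_inv_eq_right_inv h hv.coefficient_mul] at h

end Coefficients

namespace CovariantComplexStructure

variable {C : CovariantComplexStructure A (coinvariants π)} (hΩ : IsModZero C.Ω1) {p q : ℕ}

theorem starΦ_mk (h : p + q = 1) (ω : C.biforms (p, q)) :
    starΦ hΩ h (Φ.mk _ ω) = Φ.mk _ (C.starBi p q ω) := rfl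

theorem starΦ_starΦ (h : p + q = 1) (h' : q + p = 1) (v : Φ (C.biforms (p, q))) :
    starΦ hΩ h' (starΦ hΩ h v) = v := by
  obtain ⟨ω, rfl⟩ := Φ.mk_surjective v
  rw [starΦ_mk, starΦ_mk, starBi_starBi]

theorem coact_starΦ (h : p + q = 1) (v : Φ (C.biforms (p, q))) :
    coact H (starΦ hΩ h v) =
      TensorProduct.map (starLinearEquiv ℂ (A := H)).toLinearMap (starΦ hΩ h) (coact H v) := by
  obtain ⟨ω, rfl⟩ := Φ.mk_surjective v
  rw [starΦ_mk, Φ.coact_mk, Φ.coact_mk, coact_starBi]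
  induction coact A ω with
  | zero => simp
  | add x y hx hy => simp only [map_add, hx, hy]
  | tmul a ω => exact congrArg (· ⊗ₜ[ℂ] _) (π.map_star a)

theorem evV_tmul (h : p + q = 1) (ip : InvariantInner H (Φ (C.biforms (p, q))))
    (v : Φ (C.biforms (p, q))) (w : Φ (C.biforms (q, p))) :
    evV hΩ h ip (v ⊗ₜ w) = ip.form v (starΦ hΩ ((add_comm q p).trans h) w) := rfl

/-- The coaction of `w*` is the star of that of `w`, and this star cancels the one in `v₍₋₁₎
w₍₋₁₎*`. Invariance of the inner product at `v` and `w*` is thus invariance of the evaluation. -/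
theorem evV_diagonalCoact (h : p + q = 1) (ip : InvariantInner H (Φ (C.biforms (p, q))))
    (v : Φ (C.biforms (p, q))) (w : Φ (C.biforms (q, p))) :
    TensorProduct.rid ℂ H ((evV hΩ h ip).lTensor H (diagonalCoact H v w)) =
      evV hΩ h ip (v ⊗ₜ w) • (1 : H) := by
  rw [evV_tmul, ← ip.invariant, coact_starΦ, diagonalCoact]
  induction coact H v with
  | zero => simp
  | add x y hx hy => simp only [map_add, LinearMap.add_apply, hx, hy]
  | tmul a v =>
    induction coact H w with
    | zero => simp
    | add x y hx hy => simp only [map_add, hx, hy]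
    | tmul c w =>
      simp only [map₂_apply_tmul, map_tmul, LinearMap.lTensor_tmul, TensorProduct.rid_tmul,
        TensorProduct.mk_apply, evV_tmul]
      simp [mulStar]

theorem invariant_evV (h : p + q = 1) (ip : InvariantInner H (Φ (C.biforms (p, q))))
    (x : Φ ((C.biforms (p, q)).tensor (C.biforms (q, p)))) :
    TensorProduct.rid ℂ H ((evV hΩ h ip ∘ₗ Φ.comul _ _ (plus_eq hΩ h)).lTensor H (coact H x)) =
      (evV hΩ h ip ∘ₗ Φ.comul _ _ (plus_eq hΩ h)) x • (1 : H) := by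
  have e : evV hΩ h ip ∘ₗ Φ.comul _ _ (plus_eq hΩ h) ∘ₗ Φ.mul _ _ (plus_eq hΩ h) =
      evV hΩ h ip := LinearMap.ext fun y => congrArg _ (Φ.comul_mul _ y)
  rw [← Φ.mul_comul (plus_eq hΩ h) x]
  induction Φ.comul _ _ (plus_eq hΩ h) x with
  | zero => simp
  | add x y hx hy => simp only [map_add, add_smul, hx, hy]
  | tmul v w =>
    rw [Φ.coact_mul, ← LinearMap.lTensor_comp_apply, LinearMap.comp_assoc, e, evV_diagonalCoact,
      LinearMap.comp_apply, Φ.comul_mul]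

/-- The coefficient of `vⱼ* ⊗ vₖ` is `∑ᵢ aᵢⱼ* aᵢₖ`, an entry of `a* a`. This is the unitarity
relation that invariance does not give directly. -/
theorem diagonalCoact_coevV (h : p + q = 1) {ip : InvariantInner H (Φ (C.biforms (p, q)))}
    {n : ℕ} {v : Module.Basis (Fin n) ℂ (Φ (C.biforms (p, q)))} (hv : ip.IsOrthonormal v) :
    ∑ i, diagonalCoact H (starΦ hΩ h (v i)) (v i) = 1 ⊗ₜ coevV hΩ h v := by
  have e : ∀ i, diagonalCoact H (starΦ hΩ h (v i)) (v i) =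
      ∑ k, ∑ j, (star (coefficient H v i j) * coefficient H v i k) ⊗ₜ
        (starΦ hΩ h (v j) ⊗ₜ v k) := by
    intro i
    rw [diagonalCoact, coact_starΦ, coact_basis v i]
    simp only [map_sum, LinearMap.sum_apply, map_tmul, map₂_apply_tmul]
    rfl
  have e2 : ∀ j k, ∑ i, star (coefficient H v i j) * coefficient H v i k =
      if j = k then 1 else 0 := fun j k => by
    have := congrFun (congrFun hv.mul_coefficient j) k
    rwa [Matrix.mul_apply, Matrix.one_apply] at this
  simp only [e]
  rw [Finset.sum_comm, coevV, tmul_sum]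
  refine Finset.sum_congr rfl fun k _ => ?_
  rw [Finset.sum_comm]
  simp only [← sum_tmul, e2, ite_tmul, Finset.sum_ite_eq', Finset.mem_univ, if_true]

theorem coact_mul_coevV (h : p + q = 1) {ip : InvariantInner H (Φ (C.biforms (p, q)))}
    {n : ℕ} {v : Module.Basis (Fin n) ℂ (Φ (C.biforms (p, q)))} (hv : ip.IsOrthonormal v) :
    coact H (Φ.mul _ _ (plus_eq hΩ ((add_comm q p).trans h)) (coevV hΩ h v)) =
      1 ⊗ₜ Φ.mul _ _ (plus_eq hΩ ((add_comm q p).trans h)) (coevV hΩ h v) := by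
  rw [← LinearMap.lTensor_tmul, ← diagonalCoact_coevV hΩ h hv, coevV, map_sum, map_sum, map_sum]
  exact Finset.sum_congr rfl fun i _ => Φ.coact_mul _ _ _

/-- The coevaluation does not depend on the orthonormal basis. -/
theorem coevV_eq (h : p + q = 1) {ip : InvariantInner H (Φ (C.biforms (p, q)))}
    {m n : ℕ} {v : Module.Basis (Fin n) ℂ (Φ (C.biforms (p, q)))} (hv : ip.IsOrthonormal v)
    {w : Module.Basis (Fin m) ℂ (Φ (C.biforms (p, q)))} (hw : ip.IsOrthonormal w) :
    coevV hΩ h v = coevV hΩ h w := by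
  -- Expand the starred `vᵢ` in the basis `w`. The star conjugates the coefficient `⟨vᵢ, wⱼ⟩` to
  -- `⟨wⱼ, vᵢ⟩`, after which the sum over `i` is the expansion of `wⱼ` in `v`.
  have e1 : coevV hΩ h v = ∑ i, ∑ j, starΦ hΩ h (w j) ⊗ₜ (ip.form (w j) (v i) • v i) := by
    refine Finset.sum_congr rfl fun i _ => ?_
    conv_lhs => rw [← hw.sum_form_smul (v i)]
    rw [map_sum, sum_tmul]
    refine Finset.sum_congr rfl fun j _ => ?_
    rw [map_smulₛₗ, smul_tmul, ← ip.conj_symm, hw.sum_form_smul]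
  rw [e1, Finset.sum_comm]
  refine Finset.sum_congr rfl fun j _ => ?_
  rw [← tmul_sum, hv.sum_form_smul]

/-- `B` acts on `Φ(M)` through `ε`, so classes of `B`-generators span over `ℂ`. -/
theorem finite_Φ {M : RelHopfModule A (coinvariants π)}
    (hM : Module.Finite (coinvariants π) M) : Module.Finite ℂ (Φ M) := by
  classical
  obtain ⟨s, hs⟩ := hM.fg_top
  refine ⟨⟨s.image (Φ.mk M), ?_⟩⟩
  rw [eq_top_iff]
  rintro v -
  obtain ⟨m, rfl⟩ := Φ.mk_surjective v
  have hm : m ∈ Submodule.span (coinvariants π) (s : Set M) := hs ▸ Submodule.mem_top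
  induction hm using Submodule.span_induction with
  | zero => simp
  | add x y _ _ hx hy => rw [map_add]; exact Submodule.add_mem _ hx hy
  | smul b x _ hx => rw [Φ.mk_smul]; exact Submodule.smul_mem _ _ hx
  | mem x hx => exact Submodule.subset_span (Finset.mem_coe.2 (Finset.mem_image_of_mem _ hx))

theorem finite_Φ_biforms (hΩ : IsModZero C.Ω1) (h : p + q = 1) : Module.Finite ℂ (Φ (C.biforms (p, q))) := by
  have : Module.Finite ℂ (Φ (C.forms (p + q))) := by
    rw [h]
    exact finite_Φ hΩ.1
  refine Module.Finite.of_surjective (Φ.map (C.proj (p + q) (p, q))) fun v => ?_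
  obtain ⟨ω, rfl⟩ := Φ.mk_surjective v
  exact ⟨Φ.mk _ ((C.incl p q).1 ω), congrArg _ (C.proj_incl p q ω)⟩

end CovariantComplexStructure

end Invariance

section Contraction

variable {A H : Type u} [Ring A] [HopfAlgebra ℂ A] [StarRing A] [StarModule ℂ A]
  [Ring H] [HopfAlgebra ℂ H] [StarRing H] [StarModule ℂ H] [HopfStarAlgebra A]
  {π : HopfStarHom A H} {M N : RelHopfModule A (coinvariants π)}

/-! ### Covariant morphisms -/

theorem IsCovariant.comp {M N P : Type u} [AddCommGroup M] [Module ℂ M] [LeftComodule A M]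
    [AddCommGroup N] [Module ℂ N] [LeftComodule A N] [AddCommGroup P] [Module ℂ P]
    [LeftComodule A P] {g : N →ₗ[ℂ] P} {f : M →ₗ[ℂ] N} (hg : IsCovariant A g)
    (hf : IsCovariant A f) : IsCovariant A (g ∘ₗ f) := fun m => by
  rw [LinearMap.comp_apply, hg, hf, ← LinearMap.lTensor_comp_apply]

theorem IsCovariant.add_smul {M N : Type u} [AddCommGroup M] [Module ℂ M] [LeftComodule A M]
    [AddCommGroup N] [Module ℂ N] [LeftComodule A N] {f g : M →ₗ[ℂ] N} (hf : IsCovariant A f)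
    (c : ℂ) (hg : IsCovariant A g) : IsCovariant A (f + c • g) := fun m => by
  rw [LinearMap.add_apply, LinearMap.smul_apply, map_add, map_smul, hf, hg,
    LinearMap.lTensor_add, LinearMap.lTensor_smul, LinearMap.add_apply, LinearMap.smul_apply]

theorem isCovariant_tensor {M' N' : RelHopfModule A (coinvariants π)} {f : BimodHom M M'}
    {g : BimodHom N N'} (hf : IsCovariant A f.1) (hg : IsCovariant A g.1) :
    IsCovariant A (BimodHom.tensor f g).1 := by
  intro x
  induction x using tensor_induction with
  | add x y hx hy => simp only [map_add, hx, hy]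
  | tmul m n =>
    have e : (BimodHom.tensor f g).1 (tmulB m n) = tmulB (f.1 m) (g.1 n) := rfl
    rw [e, coact_tmulB, coact_tmulB, hf, hg]
    induction coact A m with
    | zero => simp
    | add x y hx hy => simp only [map_add, LinearMap.add_apply, hx, hy]
    | tmul a m =>
      induction coact A n with
      | zero => simp
      | add x y hx hy => simp only [map_add, hx, hy]
      | tmul c n => rfl

theorem Φ.map_mk (f : BimodHom M N) (m : M) : Φ.map f (Φ.mk M m) = Φ.mk N (f.1 m) := rfl

theorem Φ.unitMap_mk (b : RelHopfModule.unit A (coinvariants π)) :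
    Φ.unitMap (Φ.mk _ b) = Coalgebra.counit (R := ℂ) ((unitVal A b : coinvariants π) : A) := rfl

/-- If `ε(b) = 0`, then `b = b · 1` lies in `B⁺ B`. -/
theorem Φ.unitMap_injective : Function.Injective (Φ.unitMap (π := π)) := by
  rw [← LinearMap.ker_eq_bot, LinearMap.ker_eq_bot']
  intro v hv
  obtain ⟨b, rfl⟩ := Φ.mk_surjective v
  rw [Φ.mk_eq_zero]
  refine Submodule.subset_span ⟨unitVal A b, (unitVal A).symm 1, hv, ?_⟩
  exact (mul_one (unitVal A b : coinvariants π)).symm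

/-! ### Contractions with a pairing -/

theorem tensor_hom_ext {P : Type u} [AddCommGroup P] [Module ℂ P] {σ : ℂ →+* ℂ}
    {f g : M.tensor N →ₛₗ[σ] P} (h : ∀ m n, f (tmulB m n) = g (tmulB m n)) : f = g :=
  balTensor_ext (coinvariants π) h

/-- The contraction `(m, x ⊗ y) ↦ e(m, x) y`. -/
def contractL (e : BimodHom (M.tensor N) (RelHopfModule.unit A (coinvariants π)))
    (P : RelHopfModule A (coinvariants π)) : M →ₗ[ℂ] N.tensor P →ₗ[ℂ] P where
  toFun m := balLift (coinvariants π) (TensorProduct.lift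
      ((Algebra.lsmul ℂ ℂ P : coinvariants π →ₐ[ℂ] _).toLinearMap ∘ₗ pair e m))
    (fun x b y => by simp [pair_op_smul])
  map_add' m m' := tensor_hom_ext fun x y => by
    change pair e (m + m') x • y = pair e m x • y + pair e m' x • y
    rw [map_add, LinearMap.add_apply, add_smul]
  map_smul' c m := tensor_hom_ext fun x y => by
    change pair e (c • m) x • y = c • pair e m x • y
    rw [map_smul, LinearMap.smul_apply, smul_assoc]

/-- The contraction `(n, x ⊗ y) ↦ x e(y, n)`. -/
def contractR (e : BimodHom (M.tensor N) (RelHopfModule.unit A (coinvariants π)))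
    (P : RelHopfModule A (coinvariants π)) : N →ₗ[ℂ] P.tensor M →ₗ[ℂ] P where
  toFun n := balLift (coinvariants π) (TensorProduct.lift
      ((Algebra.lsmul ℂ ℂ P : (coinvariants π)ᵐᵒᵖ →ₐ[ℂ] _).toLinearMap ∘ₗ
        (opLinearEquiv ℂ : coinvariants π ≃ₗ[ℂ] _).toLinearMap ∘ₗ (pair e).flip n).flip)
    (fun x b y => by simp [pair_smul])
  map_add' n n' := tensor_hom_ext fun x y => by
    change op (pair e y (n + n')) • x = op (pair e y n) • x + op (pair e y n') • x
    rw [map_add, op_add, add_smul]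
  map_smul' c n := tensor_hom_ext fun x y => by
    change op (pair e y (c • n)) • x = c • op (pair e y n) • x
    rw [map_smul, op_smul, smul_assoc]

variable {P : RelHopfModule A (coinvariants π)}
  (e : BimodHom (M.tensor N) (RelHopfModule.unit A (coinvariants π)))

theorem contractL_tmulB (m : M) (x : N) (y : P) :
    contractL e P m (tmulB x y) = pair e m x • y := rfl

theorem contractR_tmulB (n : N) (x : P) (y : M) :
    contractR e P n (tmulB x y) = op (pair e y n) • x := rfl

variable {e}

theorem coact_pair (he : IsCovariant A e.1) (m : M) (n : N) :
    coact A (pair e m n) = ((unitVal A : _ ≃ₗ[ℂ] coinvariants π).toLinearMap ∘ₗ e.1).lTensor A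
      (diagTensor M N (coact A m) (coact A n)) := by
  rw [← coact_tmulB]
  have h := he (tmulB m n)
  rw [LinearMap.lTensor_comp_apply, ← h]
  exact (LinearMap.lTensor_id_apply A _ _).symm

theorem coact_contractL (he : IsCovariant A e.1) (m : M) (z : N.tensor P) :
    coact A (contractL e P m z) =
      TensorProduct.map₂ (LinearMap.mul ℂ A) (contractL e P) (coact A m) (coact A z) := by
  induction z using tensor_induction with
  | add x y hx hy => simp only [map_add, hx, hy]
  | tmul x y =>
    rw [contractL_tmulB, P.coact_smul, coact_pair he, coact_tmulB]
    induction coact A m with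
    | zero => simp
    | add p q hp hq => simp only [map_add, LinearMap.add_apply, hp, hq]
    | tmul a m =>
      induction coact A x with
      | zero => simp
      | add p q hp hq => simp only [map_add, LinearMap.add_apply, hp, hq]
      | tmul c x =>
        induction coact A y with
        | zero => simp
        | add p q hp hq => simp only [map_add, hp, hq]
        | tmul d y =>
          simp only [diagTensor_tmul, LinearMap.lTensor_tmul, map₂_apply_tmul, map_tmul,
            LinearMap.mul_apply', contractL_tmulB, ← mul_assoc]
          rfl

/-- Here `n` stands to the right of `z`, so its `A`-leg multiplies from the right; hence the flipped
multiplication, unlike in `coact_contractL`. -/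
theorem coact_contractR (he : IsCovariant A e.1) (n : N) (z : P.tensor M) :
    coact A (contractR e P n z) =
      TensorProduct.map₂ (LinearMap.mul ℂ A).flip (contractR e P) (coact A n) (coact A z) := by
  induction z using tensor_induction with
  | add x y hx hy => simp only [map_add, hx, hy]
  | tmul x y =>
    rw [contractR_tmulB, P.coact_op_smul, coact_pair he, coact_tmulB]
    induction coact A n with
    | zero => simp
    | add p q hp hq => simp only [map_add, LinearMap.add_apply, hp, hq]
    | tmul a n =>
      induction coact A x with
      | zero => simp
      | add p q hp hq => simp only [map_add, LinearMap.add_apply, hp, hq]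
      | tmul c x =>
        induction coact A y with
        | zero => simp
        | add p q hp hq => simp only [map_add, LinearMap.add_apply, hp, hq]
        | tmul d y =>
          simp only [diagTensor_tmul, LinearMap.lTensor_tmul, map₂_apply_tmul, map_tmul,
            LinearMap.mul_apply', contractR_tmulB, LinearMap.flip_apply, mul_assoc]
          rfl

/-- A coinvariant `z` contributes only `1` to the coaction. Contraction against it is therefore a
covariant map, and can be compared with the identity through `covariant_ext`. -/
theorem isCovariant_contractL (he : IsCovariant A e.1) {z : N.tensor P}
    (hz : coact A z = 1 ⊗ₜ z) : IsCovariant A ((contractL e P).flip z) := fun m => by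
  rw [LinearMap.flip_apply, coact_contractL he, hz]
  induction coact A m with
  | zero => simp
  | add p q hp hq => simp only [map_add, LinearMap.add_apply, hp, hq]
  | tmul a m => simp

theorem isCovariant_contractR (he : IsCovariant A e.1) {z : P.tensor M}
    (hz : coact A z = 1 ⊗ₜ z) : IsCovariant A ((contractR e P).flip z) := fun n => by
  rw [LinearMap.flip_apply, coact_contractR he, hz]
  induction coact A n with
  | zero => simp
  | add p q hp hq => simp only [map_add, LinearMap.add_apply, hp, hq]
  | tmul a m => simp

theorem isCovariant_id : IsCovariant A (LinearMap.id : M →ₗ[ℂ] M) := fun m => by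
  simp

/-! ### Existence and uniqueness of the pairing and the coevaluation -/

namespace CovariantComplexStructure

variable {C : CovariantComplexStructure A (coinvariants π)} {hΩ : IsModZero C.Ω1} {p q : ℕ}
  {h : p + q = 1} {ip : InvariantInner H (Φ (C.biforms (p, q)))}

theorem IsPairing.counit_pair {e : BimodHom ((C.biforms (p, q)).tensor (C.biforms (q, p)))
    (RelHopfModule.unit A (coinvariants π))} (he : IsPairing hΩ h ip e)
    (ω : C.biforms (p, q)) (η : C.biforms (q, p)) :
    Coalgebra.counit (R := ℂ) (pair e ω η : A) = evV hΩ h ip (Φ.mk _ ω ⊗ₜ Φ.mk _ η) := by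
  rw [← he.2, Φ.mul_tmul, Φ.map_mk, Φ.unitMap_mk]
  rfl

/-- Existence coextends the invariant functional `evV`, transported to `Φ(M ⊗_B N)` by `Φ.comul`.
Uniqueness is faithfulness of `Φ` together with `Φ.unitMap_injective`. -/
theorem existsUnique_isPairing {f : H →ₗ[ℂ] ℂ} (hf : IsHaar f) :
    ∃! e, IsPairing hΩ h ip e := by
  refine ⟨coextend (evV hΩ h ip ∘ₗ Φ.comul _ _ (plus_eq hΩ h)) (invariant_evV hΩ h ip)
    (Φ.mk_tensor_op_smul (plus_eq hΩ h) (plus_eq hΩ ((add_comm q p).trans h))),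
    ⟨isCovariant_coextend _ _ _, fun x => ?_⟩, fun e he => ?_⟩
  · induction x with
    | zero => simp
    | add x y hx hy => simp only [map_add, hx, hy]
    | tmul v w =>
      obtain ⟨ω, rfl⟩ := Φ.mk_surjective v
      obtain ⟨η, rfl⟩ := Φ.mk_surjective w
      rw [Φ.mul_tmul, Φ.map_mk, Φ.unitMap_mk, counit_coextend, LinearMap.comp_apply, Φ.comul_mk]
  · apply Subtype.ext
    refine covariant_ext hf he.1 (isCovariant_coextend _ _ _) fun x => ?_
    apply Φ.unitMap_injective
    rw [Φ.unitMap_mk, Φ.unitMap_mk, counit_coextend]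
    induction x using tensor_induction with
    | add x y hx hy =>
      rw [map_add e.1, map_add (Φ.mk _), map_add (evV hΩ h ip ∘ₗ _), ← hx, ← hy,
        map_add (unitVal A)]
      exact map_add (Coalgebra.counit (R := ℂ) (A := A)) _ _
    | tmul ω η => rw [LinearMap.comp_apply, Φ.comul_mk, ← he.counit_pair]; rfl

theorem IsCoevaluation.coact_one {c : BimodHom (RelHopfModule.unit A (coinvariants π))
    ((C.biforms (q, p)).tensor (C.biforms (p, q)))} (hc : IsCoevaluation hΩ h ip c) :
    coact A (c.1 ((unitVal A).symm 1)) = 1 ⊗ₜ c.1 ((unitVal A).symm 1) :=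
  BimodHom.coact_apply_one hc.1

theorem IsCoevaluation.exists_comul_mk {c : BimodHom (RelHopfModule.unit A (coinvariants π))
    ((C.biforms (q, p)).tensor (C.biforms (p, q)))} (hc : IsCoevaluation hΩ h ip c) :
    ∃ (n : ℕ) (v : Module.Basis (Fin n) ℂ (Φ (C.biforms (p, q)))), ip.IsOrthonormal v ∧
      Φ.comul _ _ (plus_eq hΩ ((add_comm q p).trans h)) (Φ.mk _ (c.1 ((unitVal A).symm 1))) =
        coevV hΩ h v := by
  obtain ⟨n, v, hv, e⟩ := hc.2
  refine ⟨n, v, hv, ?_⟩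
  rw [← Φ.map_mk, e, Φ.comul_mul]

/-- A morphism from `B` is determined by its value at `1`, a coinvariant element. The coinvariant
class of `coevV` has exactly one coinvariant lift, and this lift commutes with `B`. -/
theorem existsUnique_isCoevaluation {f : H →ₗ[ℂ] ℂ} (hf : IsHaar f) :
    ∃! c, IsCoevaluation hΩ h ip c := by
  have := finite_Φ_biforms hΩ h
  obtain ⟨n, v, hv⟩ := ip.exists_orthonormal
  obtain ⟨x, hx, hxv⟩ := exists_coinvariant hf (coact_mul_coevV hΩ h hv)
  have hcomm := op_smul_eq_smul_of_coinvariant hf hx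
    (Φ.mk_tensor_op_smul (plus_eq hΩ ((add_comm q p).trans h)) (plus_eq hΩ h))
  refine ⟨extendUnit x hcomm, ⟨isCovariant_extendUnit hcomm hx, n, v, hv, ?_⟩, fun c hc => ?_⟩
  · rw [Φ.map_mk, extendUnit_one, hxv]
  · apply BimodHom.ext_unit
    rw [extendUnit_one]
    refine coinvariant_ext hf hc.coact_one hx ?_
    -- The competitor `c` may use another orthonormal basis; `coevV_eq` removes the difference.
    obtain ⟨m, w, hw, e⟩ := hc.2
    rw [hxv, coevV_eq hΩ h hv hw, ← e, Φ.map_mk]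

/-! ### The zigzag identities -/

/-- Both sides are covariant in `ω`. On classes the identity is `∑ ⟨x, vᵢ⟩ vᵢ = x`, since `vᵢ** =
vᵢ`. -/
theorem contractL_coevaluation {f : H →ₗ[ℂ] ℂ} (hf : IsHaar f)
    {e : BimodHom ((C.biforms (p, q)).tensor (C.biforms (q, p)))
      (RelHopfModule.unit A (coinvariants π))} (he : IsPairing hΩ h ip e)
    {c : BimodHom (RelHopfModule.unit A (coinvariants π))
      ((C.biforms (q, p)).tensor (C.biforms (p, q)))} (hc : IsCoevaluation hΩ h ip c)
    (ω : C.biforms (p, q)) :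
    contractL e (C.biforms (p, q)) ω (c.1 ((unitVal A).symm 1)) = ω := by
  refine LinearMap.congr_fun (covariant_ext hf (isCovariant_contractL he.1 hc.coact_one)
    isCovariant_id fun ω => ?_) ω
  have hq := plus_eq hΩ ((add_comm q p).trans h)
  have key : ∀ z, Φ.mk _ (contractL e (C.biforms (p, q)) ω z) =
      TensorProduct.lid ℂ _ ((evV hΩ h ip ∘ₗ TensorProduct.mk ℂ _ _ (Φ.mk _ ω)).rTensor _
        (Φ.comul _ _ hq (Φ.mk _ z))) := by
    intro z
    induction z using tensor_induction with
    | add x y hx hy => simp only [map_add, hx, hy]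
    | tmul x y =>
      rw [contractL_tmulB, Φ.mk_smul, he.counit_pair, Φ.comul_mk]
      rfl
  obtain ⟨n, v, hv, ec⟩ := hc.exists_comul_mk
  rw [LinearMap.flip_apply, key, ec, coevV]
  simp only [map_sum, LinearMap.rTensor_tmul, LinearMap.comp_apply, TensorProduct.mk_apply,
    evV_tmul, starΦ_starΦ, TensorProduct.lid_tmul, hv.sum_form_smul, LinearMap.id_apply]

/-- On classes this is the conjugate expansion `∑ ⟨vᵢ, y*⟩ vᵢ* = (∑ ⟨y*, vᵢ⟩ vᵢ)* = y`. The right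
scalar passes to `Φ` because `M B⁺ = B⁺ M`. -/
theorem contractR_coevaluation {f : H →ₗ[ℂ] ℂ} (hf : IsHaar f)
    {e : BimodHom ((C.biforms (p, q)).tensor (C.biforms (q, p)))
      (RelHopfModule.unit A (coinvariants π))} (he : IsPairing hΩ h ip e)
    {c : BimodHom (RelHopfModule.unit A (coinvariants π))
      ((C.biforms (q, p)).tensor (C.biforms (p, q)))} (hc : IsCoevaluation hΩ h ip c)
    (η : C.biforms (q, p)) :
    contractR e (C.biforms (q, p)) η (c.1 ((unitVal A).symm 1)) = η := by
  refine LinearMap.congr_fun (covariant_ext hf (isCovariant_contractR he.1 hc.coact_one)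
    isCovariant_id fun η => ?_) η
  have h' := (add_comm q p).trans h
  have hq := plus_eq hΩ h'
  have key : ∀ z, Φ.mk _ (contractR e (C.biforms (q, p)) η z) =
      TensorProduct.rid ℂ _ ((evV hΩ h ip ∘ₗ (TensorProduct.mk ℂ _ _).flip (Φ.mk _ η)).lTensor _
        (Φ.comul _ _ hq (Φ.mk _ z))) := by
    intro z
    induction z using tensor_induction with
    | add x y hx hy => simp only [map_add, hx, hy]
    | tmul x y =>
      rw [contractR_tmulB, Φ.mk_op_smul hq, he.counit_pair, Φ.comul_mk]
      rfl
  obtain ⟨n, v, hv, ec⟩ := hc.exists_comul_mk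
  rw [LinearMap.flip_apply, key, ec, coevV]
  have e1 : starΦ hΩ h (starΦ hΩ h' (Φ.mk _ η)) = Φ.mk _ η := starΦ_starΦ hΩ h' h _
  conv_rhs => rw [LinearMap.id_apply, ← e1, ← hv.sum_form_smul (starΦ hΩ h' _)]
  simp only [map_sum, LinearMap.lTensor_tmul, LinearMap.comp_apply, LinearMap.flip_apply,
    TensorProduct.mk_apply, evV_tmul, TensorProduct.rid_tmul, map_smulₛₗ, ← ip.conj_symm]

/-! ### Reality of the coevaluation -/

/-- The map `x ⊗ y ↦ y* ⊗ x*` on `Ω^{(q,p)} ⊗_B Ω^{(p,q)}`. -/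
def daggerBi (C : CovariantComplexStructure A (coinvariants π)) (p q : ℕ) :
    (C.biforms (q, p)).tensor (C.biforms (p, q)) →ₛₗ[starRingEnd ℂ]
      (C.biforms (q, p)).tensor (C.biforms (p, q)) :=
  balLift (coinvariants π) (P := BalTensor (coinvariants π) (C.biforms (q, p)) (C.biforms (p, q)))
    ((balMk (coinvariants π) ∘ₗ
      (TensorProduct.comm ℂ (C.biforms (p, q)) (C.biforms (q, p))).toLinearMap).comp
      (TensorProduct.map (C.starBi q p) (C.starBi p q)))
    (fun ω b η => by
      simp only [LinearMap.comp_apply, TensorProduct.map_tmul, LinearEquiv.coe_coe,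
        TensorProduct.comm_tmul, starBi_smul, starBi_op_smul, balMk_balanced])

theorem daggerBi_tmulB (x : C.biforms (q, p)) (y : C.biforms (p, q)) :
    C.daggerBi p q (tmulB x y) = tmulB (C.starBi p q y) (C.starBi q p x) := rfl

/-- The exchange of tensor factors matches the rule `(a c)* = c* a*` in `A`. -/
theorem coact_daggerBi (z : (C.biforms (q, p)).tensor (C.biforms (p, q))) :
    coact A (C.daggerBi p q z) =
      TensorProduct.map (starLinearEquiv ℂ (A := A)).toLinearMap (C.daggerBi p q) (coact A z) := by
  induction z using tensor_induction with
  | add x y hx hy => simp only [map_add, hx, hy]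
  | tmul x y =>
    rw [daggerBi_tmulB, coact_tmulB, coact_tmulB, coact_starBi, coact_starBi]
    induction coact A x with
    | zero => simp
    | add p q hp hq => simp only [map_add, LinearMap.add_apply, hp, hq]
    | tmul a x =>
      induction coact A y with
      | zero => simp
      | add p q hp hq => simp only [map_add, LinearMap.add_apply, hp, hq]
      | tmul c y =>
        rw [map_tmul, map_tmul, diagTensor_tmul, diagTensor_tmul, map_tmul, daggerBi_tmulB]
        simp

/-- Both elements are coinvariant, so it suffices to compare classes, and `vᵢ* ⊗ vᵢ` is sent to `vᵢ*
⊗ vᵢ**`. -/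
theorem daggerBi_coevaluation {f : H →ₗ[ℂ] ℂ} (hf : IsHaar f)
    {c : BimodHom (RelHopfModule.unit A (coinvariants π))
      ((C.biforms (q, p)).tensor (C.biforms (p, q)))} (hc : IsCoevaluation hΩ h ip c) :
    C.daggerBi p q (c.1 ((unitVal A).symm 1)) = c.1 ((unitVal A).symm 1) := by
  have h' := (add_comm q p).trans h
  have hq := plus_eq hΩ h'
  refine coinvariant_ext hf ?_ hc.coact_one ?_
  · rw [coact_daggerBi, hc.coact_one, map_tmul]
    simp
  · have key : ∀ z, Φ.comul _ _ hq (Φ.mk _ (C.daggerBi p q z)) =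
        TensorProduct.comm ℂ _ _ (TensorProduct.map (starΦ hΩ h') (starΦ hΩ h)
          (Φ.comul _ _ hq (Φ.mk _ z))) := by
      intro z
      induction z using tensor_induction with
      | add x y hx hy => simp only [map_add, hx, hy]
      | tmul x y => rfl
    rw [← Φ.mul_comul hq (Φ.mk _ (C.daggerBi p q _)),
      ← Φ.mul_comul hq (Φ.mk _ (c.1 _)), key]
    obtain ⟨n, v, hv, ec⟩ := hc.exists_comul_mk
    rw [ec, coevV]
    simp only [map_sum, map_tmul, TensorProduct.comm_tmul, starΦ_starΦ]

end CovariantComplexStructure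

end Contraction

section Metric

variable {A H : Type u} [Ring A] [HopfAlgebra ℂ A] [StarRing A] [StarModule ℂ A]
  [Ring H] [HopfAlgebra ℂ H] [StarRing H] [StarModule ℂ H] [HopfStarAlgebra A]
  {π : HopfStarHom A H}

/-! ### The metric -/

namespace CovariantComplexStructure

variable (C : CovariantComplexStructure A (coinvariants π))

theorem proj_incl01 (ω : C.Ω01) : (C.proj 1 (0, 1)).1 (C.incl01.1 ω) = ω :=
  C.proj_incl 0 1 ω

theorem proj_incl10_eq_zero (ω : C.Ω10) : (C.proj 1 (0, 1)).1 (C.incl10.1 ω) = 0 :=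
  C.biVal_injective _ ((C.component_of_mem_ne (C.biVal_mem ω) (by simp)).trans
    (map_zero (C.biVal (0, 1))).symm)

theorem proj_incl01_eq_zero (ω : C.Ω01) : (C.proj 1 (1, 0)).1 (C.incl01.1 ω) = 0 :=
  C.biVal_injective _ ((C.component_of_mem_ne (C.biVal_mem ω) (by simp)).trans
    (map_zero (C.biVal (1, 0))).symm)

theorem isCovariant_incl10 : IsCovariant A C.incl10.1 := C.isCovariant_incl 1 0

theorem isCovariant_incl01 : IsCovariant A C.incl01.1 := C.isCovariant_incl 0 1

section Pairing

variable (l : ℝ) (e10 : BimodHom (C.Ω10.tensor C.Ω01) (RelHopfModule.unit A (coinvariants π)))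
  (e01 : BimodHom (C.Ω01.tensor C.Ω10) (RelHopfModule.unit A (coinvariants π)))

theorem pair_pairing (x y : C.Ω1) : pair (C.pairing l e10 e01) x y =
    pair e10 ((C.proj 1 (1, 0)).1 x) ((C.proj 1 (0, 1)).1 y) +
      ((-l⁻¹ : ℝ) : ℂ) • pair e01 ((C.proj 1 (0, 1)).1 x) ((C.proj 1 (1, 0)).1 y) := rfl

/-- A form of type `(0,1)` in the second slot pairs only with the `(1,0)` part of `ω`. Each mixed
summand of `g` thus meets a single summand of the pairing; the next three lemmas are the other
cases. -/
theorem contractLeft_incl01_incl10 (ω : C.Ω1) (z : C.Ω01.tensor C.Ω10) :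
    contractLeft (C.pairing l e10 e01) ω ((BimodHom.tensor C.incl01 C.incl10).1 z) =
      C.incl10.1 (contractL e10 C.Ω10 ((C.proj 1 (1, 0)).1 ω) z) := by
  induction z using tensor_induction with
  | add x y hx hy => simp only [map_add, hx, hy]
  | tmul x y =>
    change pair _ ω (C.incl01.1 x) • C.incl10.1 y = _
    rw [pair_pairing, proj_incl01, proj_incl01_eq_zero, map_zero, smul_zero, add_zero,
      contractL_tmulB, C.incl10.2.1]

theorem contractLeft_incl10_incl01 (ω : C.Ω1) (z : C.Ω10.tensor C.Ω01) :
    contractLeft (C.pairing l e10 e01) ω ((BimodHom.tensor C.incl10 C.incl01).1 z) =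
      ((-l⁻¹ : ℝ) : ℂ) • C.incl01.1 (contractL e01 C.Ω01 ((C.proj 1 (0, 1)).1 ω) z) := by
  induction z using tensor_induction with
  | add x y hx hy => simp only [map_add, hx, hy, smul_add]
  | tmul x y =>
    change pair _ ω (C.incl10.1 x) • C.incl01.1 y = _
    rw [pair_pairing, proj_incl10, proj_incl10_eq_zero, map_zero, zero_add,
      contractL_tmulB, C.incl01.2.1, smul_assoc]

theorem contractRight_incl01_incl10 (ω : C.Ω1) (z : C.Ω01.tensor C.Ω10) :
    contractRight (C.pairing l e10 e01) ω ((BimodHom.tensor C.incl01 C.incl10).1 z) =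
      C.incl01.1 (contractR e10 C.Ω01 ((C.proj 1 (0, 1)).1 ω) z) := by
  induction z using tensor_induction with
  | add x y hx hy => simp only [map_add, hx, hy]
  | tmul x y =>
    change op (pair _ (C.incl10.1 y) ω) • C.incl01.1 x = _
    rw [pair_pairing, proj_incl10, proj_incl10_eq_zero, map_zero, LinearMap.zero_apply, smul_zero,
      add_zero, contractR_tmulB, C.incl01.2.2]

theorem contractRight_incl10_incl01 (ω : C.Ω1) (z : C.Ω10.tensor C.Ω01) :
    contractRight (C.pairing l e10 e01) ω ((BimodHom.tensor C.incl10 C.incl01).1 z) =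
      ((-l⁻¹ : ℝ) : ℂ) • C.incl10.1 (contractR e01 C.Ω10 ((C.proj 1 (1, 0)).1 ω) z) := by
  induction z using tensor_induction with
  | add x y hx hy => simp only [map_add, hx, hy, smul_add]
  | tmul x y =>
    change op (pair _ (C.incl01.1 y) ω) • C.incl10.1 x = _
    rw [pair_pairing, proj_incl01, proj_incl01_eq_zero, map_zero, LinearMap.zero_apply,
      zero_add, contractR_tmulB, C.incl10.2.2, op_smul, smul_assoc]

theorem isCovariant_pairing {e10 e01} (h10 : IsCovariant A e10.1) (h01 : IsCovariant A e01.1) :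
    IsCovariant A (C.pairing l e10 e01).1 :=
  (h10.comp (isCovariant_tensor (C.isCovariant_proj 1 (1, 0))
    (C.isCovariant_proj 1 (0, 1)))).add_smul _
    (h01.comp (isCovariant_tensor (C.isCovariant_proj 1 (0, 1)) (C.isCovariant_proj 1 (1, 0))))

end Pairing

theorem coevaluation_one (l : ℝ)
    (c10 : BimodHom (RelHopfModule.unit A (coinvariants π)) (C.Ω01.tensor C.Ω10))
    (c01 : BimodHom (RelHopfModule.unit A (coinvariants π)) (C.Ω10.tensor C.Ω01)) :
    (C.coevaluation l c10 c01).1 ((unitVal A).symm 1) =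
      (BimodHom.tensor C.incl01 C.incl10).1 (c10.1 ((unitVal A).symm 1)) + ((-l : ℝ) : ℂ) •
        (BimodHom.tensor C.incl10 C.incl01).1 (c01.1 ((unitVal A).symm 1)) := rfl

theorem isCovariant_coevaluation (l : ℝ)
    {c10 : BimodHom (RelHopfModule.unit A (coinvariants π)) (C.Ω01.tensor C.Ω10)}
    {c01 : BimodHom (RelHopfModule.unit A (coinvariants π)) (C.Ω10.tensor C.Ω01)}
    (h10 : IsCovariant A c10.1) (h01 : IsCovariant A c01.1) :
    IsCovariant A (C.coevaluation l c10 c01).1 :=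
  ((isCovariant_tensor C.isCovariant_incl01 C.isCovariant_incl10).comp h10).add_smul _
    ((isCovariant_tensor C.isCovariant_incl10 C.isCovariant_incl01).comp h01)

theorem dagger_incl01_incl10 (z : C.Ω01.tensor C.Ω10) :
    C.dagger ((BimodHom.tensor C.incl01 C.incl10).1 z) =
      (BimodHom.tensor C.incl01 C.incl10).1 (C.daggerBi 1 0 z) := by
  induction z using tensor_induction with
  | add x y hx hy => simp only [map_add, hx, hy]
  | tmul x y => rfl

theorem dagger_incl10_incl01 (z : C.Ω10.tensor C.Ω01) :
    C.dagger ((BimodHom.tensor C.incl10 C.incl01).1 z) =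
      (BimodHom.tensor C.incl10 C.incl01).1 (C.daggerBi 0 1 z) := by
  induction z using tensor_induction with
  | add x y hx hy => simp only [map_add, hx, hy]
  | tmul x y => rfl

end CovariantComplexStructure

end Metric

end QuantumHomogeneous

end

/-! ### Assembly of the metric -/

theorem mainTheorem9 {A H : Type u}
    [Ring A] [HopfAlgebra ℂ A] [StarRing A] [StarModule ℂ A] [HopfStarAlgebra A]
    [Ring H] [HopfAlgebra ℂ H] [StarRing H] [StarModule ℂ H] (hH : IsCQGAlgebra H)
    (π : HopfStarHom A H) (hB : IsQuantumHomogeneousSpace π)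
    (C : CovariantComplexStructure A (coinvariants π)) (hΩ : IsModZero C.Ω1)
    (ip10 : InvariantInner H (Φ C.Ω10)) (ip01 : InvariantInner H (Φ C.Ω01)) :
    (∃! e10, IsPairing hΩ (add_zero 1) ip10 e10) ∧
    (∃! c10, IsCoevaluation hΩ (add_zero 1) ip10 c10) ∧
    (∃! e01, IsPairing hΩ (zero_add 1) ip01 e01) ∧
    (∃! c01, IsCoevaluation hΩ (zero_add 1) ip01 c01) ∧
    ∀ e10 c10 e01 c01,
      IsPairing hΩ (add_zero 1) ip10 e10 → IsCoevaluation hΩ (add_zero 1) ip10 c10 →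
      IsPairing hΩ (zero_add 1) ip01 e01 → IsCoevaluation hΩ (zero_add 1) ip01 c01 →
      ∀ l : ℝ, l ≠ 0 →
        ∀ g, g = (C.coevaluation l c10 c01).1 ((unitVal A).symm 1) →
          IsCovariantMetric g (C.pairing l e10 e01) ∧
          C.dagger g = g ∧
          (∀ ω η : C.Ω10, pair (C.pairing l e10 e01) (C.incl10.1 ω) (C.incl10.1 η) = 0) ∧
          (∀ ω η : C.Ω01, pair (C.pairing l e10 e01) (C.incl01.1 ω) (C.incl01.1 η) = 0) := by
  obtain ⟨f, hf⟩ := hH.exists_isHaar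
  refine ⟨existsUnique_isPairing hf, existsUnique_isCoevaluation hf, existsUnique_isPairing hf,
    existsUnique_isCoevaluation hf, ?_⟩
  rintro e10 c10 e01 c01 he10 hc10 he01 hc01 l hl g rfl
  -- The weight of `c01` in `g` and that of `e01` in the pairing are inverse, so the zigzag on
  -- `Ω^{(0,1)} ⊗_B Ω^{(1,0)}` is unaffected by the scaling.
  have hl' : ((-l : ℝ) : ℂ) * ((-l⁻¹ : ℝ) : ℂ) = 1 := by
    rw [← Complex.ofReal_mul, neg_mul_neg, mul_inv_cancel₀ hl, Complex.ofReal_one]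
  refine ⟨⟨fun ω => ⟨?_, ?_⟩, C.isCovariant_pairing l he10.1 he01.1, isCovariant_coevOf
    (BimodHom.coact_apply_one (C.isCovariant_coevaluation l hc10.1 hc01.1))⟩, ?_, ?_, ?_⟩
  · rw [coevaluation_one, map_add, map_smul, contractLeft_incl01_incl10,
      contractLeft_incl10_incl01, contractL_coevaluation hf he10 hc10,
      contractL_coevaluation hf he01 hc01, smul_smul, hl', one_smul, incl_proj_add_incl_proj]
  · rw [coevaluation_one, map_add, map_smul, contractRight_incl01_incl10,
      contractRight_incl10_incl01, contractR_coevaluation hf he10 hc10,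
      contractR_coevaluation hf he01 hc01, smul_smul, hl', one_smul, add_comm,
      incl_proj_add_incl_proj]
  -- `†` fixes both mixed summands and conjugates the coefficient `-l`, which is real.
  · rw [coevaluation_one, map_add, LinearMap.map_smulₛₗ, dagger_incl01_incl10,
      dagger_incl10_incl01, daggerBi_coevaluation hf hc10, daggerBi_coevaluation hf hc01,
      Complex.conj_ofReal]
  · intro ω η
    rw [pair_pairing, proj_incl10_eq_zero, proj_incl10_eq_zero, map_zero, map_zero,
      LinearMap.zero_apply, smul_zero, add_zero]
  · intro ω η
    rw [pair_pairing, proj_incl01_eq_zero, proj_incl01_eq_zero, map_zero, map_zero,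
      LinearMap.zero_apply, smul_zero, zero_add]
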